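/- **Setting.** A query node $Q$, an aggregator (cloud) $A$ and $J$ sensor groups take part; group $j$ has $I_j$ sensors. The public parameters are rational: $F,\,Q_k\in\mathbb{Q}^{n\times n}$ with $n\ge 1$, $H_{i}\in\mathbb{Q}^{p\times n}$, $R_{i,k}\in\mathbb{Q}^{p\times p}$ and $P_{q,0}\in\mathbb{Q}^{n\times n}$. Here $P_{q,0}$ and all $R_{i,k}$ are positive definite, all $Q_k$ are positive semidefinite, and all global covariances $P_{q,k}$ defined below are invertible. The private data are the initial state $\hat x_{q,0}$ of $Q$ and the measurements $y_{i,k}\in\mathbb{Q}^p$ of each group, all multiples of $1/\beta$ for a public $\beta\ge1$. Numbers are encrypted as integer mantissas, modulo the Paillier modulus, over public common denominators. Messages can be read only by their endpoints. **Protocol.** $Q$ generates a Paillier key pair, with $N=ab$ for random distinct $\kappa$-bit primes $a,b$. It publishes $N$ and sends $\hat x_{q,0}$ to the groups. At each step $k=1,\dots,K$: 1. Group $j$ computes $P^-_{g_j,k}=\big(P_{q,k-1}^{-1}+\sum_{i=1}^{I_j}H_i^TR_{i,k}^{-1}H_i\big)^{-1}$, $K_{i,k}=P^-_{g_j,k}H_i^TR_{i,k}^{-1}$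 and $\hat x^-_{g_j,k}=\hat x_{q,k-1}+\sum_i K_{i,k}(y_{i,k}-H_i\hat x_{q,k-1})$. 2. It sends the Paillier encryption $[\![\hat x^-_{g_j,k}]\!]$ to $A$. 3. $A$ computes $P^-_{a,k}=\big(\sum_j (P^-_{g_j,k})^{-1}\big)^{-1}$ and, homomorphically, $[\![\hat x^-_{a,k}]\!]=P^-_{a,k}\sum_j (P^-_{g_j,k})^{-1}[\![\hat x^-_{g_j,k}]\!]$. 4. $A$ computes $[\![\hat x_{a,k}]\!]=F[\![\hat x^-_{a,k}]\!]$ and $P_{a,k}=FP^-_{a,k}F^T+Q_k$. 5. $A$ sends $[\![\hat x_{a,k}]\!]$ and $P_{a,k}$ to $Q$, which decrypts and sends the results $\hat x_{q,k}=\hat x_{a,k}$ and $P_{q,k}=P_{a,k}$ to all groups. A *sensor coalition* is a set of groups. A *cloud coalition* is $A$ together with a set of groups. A *query coalition* is $Q$ together with a set of groups. The *view* of a coalition consists of the public parameters, the public key, and its members' inputs, encryption coins, received messages and results of computations; with $Q$ it also contains the secret key. *Computational privacy* against a class of coalitions means two things. * (i) There is a probabilistic polynomial-time simulator $S$ such that,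 for every coalition of the class and all private data, $S$ is computationally indistinguishable from the coalition's view, as ensembles in the security parameter $\kappa$. Its input consists of the coalition's inputs and outputs, that is: the coalition's members, the public key, the measurements of the colluding groups, the global estimates delivered so far (if a group or $Q$ takes part), and the secret key if $Q$ takes part. * (ii) For any two choices of the private data that agree on these inputs and outputs, the coalition's views are computationally indistinguishable. **Theorem.** Assume the decisional composite residuosity assumption and let $K\ge 0$. Then the protocol computes the diffusion Kalman filter: for all private data and all sufficiently large $\kappa$, the decrypted values $\hat x_{q,k}$ ($k\le K$) are exactly the estimates given by the above recursion without encryption. Moreover, $K$ steps of the protocol preserve computational privacy against * sensor coalitions, * cloud coalitions, in both cases before as well as after the result $\hat x_{q,K}$ of the last step is delivered (before delivery, $\hat x_{q,K}$ is not among the outputs given to the simulator), * query coalitions if $d_r>1$, where $d_r$ is the number of non-colluding groups. In this case, moreover, at each step the linear system $P_rX_r=z$ does not determine the local estimates of the non-colluding groups $j_1,\dots,j_{d_r}$. Here $$P_r=\big[(P^-_{g_{j_1},k})^{-1},\dots,(P^-_{g_{j_{d_r}},k})^{-1}\big]\in\mathbb{R}^{n\times nd_r},\qquad z=(P^-_{a,k})^{-1}\hat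 x^-_{a,k}-\sum_{j\ \text{colluding}}(P^-_{g_j,k})^{-1}\hat x^-_{g_j,k},$$ and $X_r\in\mathbb{R}^{nd_r}$ is the unknown stacked vector of their estimates. The true estimates solve the system. Every solution yields the observed $\hat x_{a,k}$, and if $F$ is invertible, only solutions do. There are infinitely many solutions, and for each single non-colluding group every vector of $\mathbb{R}^n$ occurs as its component in some solution. -/

import Mathlib

open scoped Matrix

/-! # Data, programs and running time -/

/-- Data handled by algorithms: finite binary trees whose leaves carry integers. -/
inductive Val : Type
  | int (z : ℤ) : Val
  | pair (a b : Val) : Val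

namespace Val

/-- Length of a datum: the number of nodes plus the number of binary digits in the leaves. -/
def size : Val → ℕ
  | int z => z.natAbs.size + 1
  | pair a b => a.size + b.size + 1

/-- First component (`0` on a leaf). -/
def left : Val → Val
  | int _ => int 0
  | pair a _ => a

/-- Second component (`0` on a leaf). -/
def right : Val → Val
  | int _ => int 0
  | pair _ b => b

/-- Apply an integer operation to a pair of leaves (`0` on data of another shape). -/
def binop (f : ℤ → ℤ → ℤ) : Val → Val
  | pair (int a) (int b) => int (f a b)
  | _ => int 0

/-- The test of conditionals and loops: the datum is a pair whose first component is a
positive integer. -/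
def test : Val → Bool
  | pair (int a) _ => decide (0 < a)
  | _ => false

/-- A finite list of data as one datum. -/
def list : List Val → Val
  | [] => int 0
  | a :: l => pair a (list l)

def nat (m : ℕ) : Val := int m

def rat (a : ℚ) : Val := pair (int a.num) (int a.den)

def vec {m : ℕ} (v : Fin m → ℤ) : Val := list (List.ofFn fun i => int (v i))

def mat {m l : ℕ} (A : Matrix (Fin m) (Fin l) ℚ) : Val :=
  list (List.ofFn fun i => list (List.ofFn fun j => rat (A i j)))

/-- The security parameter as a word of length `κ + 1`, namely `1` followed by `κ` zeros. -/
def param (κ : ℕ) : Val := int (2 ^ κ)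

end Val

/-- Integer arithmetic operations available to programs. -/
inductive Arith : Type
  | plus | minus | times | quot | rem

/-- Quotient and remainder are those of Euclidean division. -/
def Arith.eval : Arith → ℤ → ℤ → ℤ
  | plus, a, b => a + b
  | minus, a, b => a - b
  | times, a, b => a * b
  | quot, a, b => a / b
  | rem, a, b => a % b

/-- Structured programs transforming one datum into another. -/
inductive Prog : Type
  | skip : Prog
  | const (v : Val) : Prog
  | left : Prog
  | right : Prog
  | op (o : Arith) : Prog
  | fork (f g : Prog) : Prog
  | seq (f g : Prog) : Prog
  | cond (f g : Prog) : Prog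
  | loop (f : Prog) : Prog

/-- `Exec f x y t`: program `f`, started on `x`, halts with result `y` at cost `t`.
Every elementary operation costs one more than the length of the data that it handles
(logarithmic cost), so the length of a result never exceeds the cost of producing it. -/
inductive Exec : Prog → Val → Val → ℕ → Prop
  | skip (x : Val) : Exec .skip x x (x.size + 1)
  | const (v x : Val) : Exec (.const v) x v (x.size + v.size + 1)
  | left (x : Val) : Exec .left x x.left (x.size + 1)
  | right (x : Val) : Exec .right x x.right (x.size + 1)
  | op (o : Arith) (x : Val) : Exec (.op o) x (x.binop o.eval) (x.size + 1)
  | fork {f g : Prog} {x y z : Val} {s t : ℕ} :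
      Exec f x y s → Exec g x z t → Exec (.fork f g) x (.pair y z) (s + t + x.size + 1)
  | seq {f g : Prog} {x y z : Val} {s t : ℕ} :
      Exec f x y s → Exec g y z t → Exec (.seq f g) x z (s + t + 1)
  | cond_pos {f g : Prog} {x y : Val} {t : ℕ} :
      x.test = true → Exec f x y t → Exec (.cond f g) x y (t + x.size + 1)
  | cond_neg {f g : Prog} {x y : Val} {t : ℕ} :
      x.test = false → Exec g x y t → Exec (.cond f g) x y (t + x.size + 1)
  | loop_stop {f : Prog} {x : Val} :
      x.test = false → Exec (.loop f) x x (x.size + 1)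
  | loop_step {f : Prog} {x y z : Val} {s t : ℕ} :
      x.test = true → Exec f x y s → Exec (.loop f) y z t →
        Exec (.loop f) x z (s + t + x.size + 1)

/-! # Probabilistic polynomial time and computational indistinguishability -/

/-- Uniform distribution on a finite set; the point mass at `d` if the set is empty. -/
noncomputable def unif {α : Type} (s : Finset α) (d : α) : PMF α :=
  open Classical in if h : s.Nonempty then PMF.uniformOfFinset s h else PMF.pure d

/-- A probabilistic polynomial-time algorithm: a program that receives the security parameter
`1^κ`, an input `x` and a string of `coins κ` fair coin tosses (written as a number `ρ`), and
halts on all of them within polynomial cost. `out κ x ρ` is its result. -/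
structure PPT : Type where
  prog : Prog
  coins : Polynomial ℕ
  time : Polynomial ℕ
  out : ℕ → Val → ℕ → Val
  halts : ∀ (κ : ℕ) (x : Val) (ρ : ℕ), ρ < 2 ^ coins.eval κ →
    ∃ t, t ≤ time.eval (κ + x.size) ∧
      Exec prog (.pair (.param κ) (.pair x (.nat ρ))) (out κ x ρ) t

/-- Output distribution of an algorithm on a given input. -/
noncomputable def PPT.run (A : PPT) (κ : ℕ) (x : Val) : PMF Val :=
  (unif (Finset.range (2 ^ A.coins.eval κ)) 0).map (A.out κ x)

/-- Probability that the algorithm `D` outputs `1` on a sample of `X`. -/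
noncomputable def PPT.accept (D : PPT) (κ : ℕ) (X : PMF Val) : ℝ :=
  ((X.bind (D.run κ)) (.int 1)).toReal

/-- Computational indistinguishability of two ensembles. -/
def CompIndist (X Y : ℕ → PMF Val) : Prop :=
  ∀ (D : PPT) (P : Polynomial ℝ), (∀ m : ℕ, 0 < P.eval (m : ℝ)) →
    ∃ κ₀ : ℕ, ∀ κ ≥ κ₀, |D.accept κ (X κ) - D.accept κ (Y κ)| < 1 / P.eval (κ : ℝ)

/-! # The Paillier cryptosystem -/

namespace Paillier

/-- Primes with exactly `κ` binary digits. -/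
def bitPrimes (κ : ℕ) : Finset ℕ :=
  (Finset.range (2 ^ κ)).filter fun m => m.Prime ∧ 2 ^ κ ≤ 2 * m

/-- Secret keys: pairs of distinct primes with `κ` binary digits. -/
def keyPairs (κ : ℕ) : Finset (ℕ × ℕ) :=
  (bitPrimes κ ×ˢ bitPrimes κ).filter fun s => s.1 ≠ s.2

/-- Key generation. The public key of the secret key `(a, b)` is `a * b`. (There are no secret
keys for `κ ≤ 1`, where the value is immaterial.) -/
noncomputable def keyGen (κ : ℕ) : PMF (ℕ × ℕ) := unif (keyPairs κ) (2, 3)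

/-- The invertible residues modulo `N`. -/
def units (N : ℕ) : Finset ℕ := (Finset.range N).filter fun r => r.Coprime N

/-- Encryption of the integer `m` (as a residue modulo `N`) with randomness `r`. -/
def enc (N : ℕ) (m : ℤ) (r : ℕ) : ℕ := ((1 + N) ^ (m : ZMod N).val * r ^ N) % N ^ 2

/-- Decryption with the secret key `s`. -/
def dec (s : ℕ × ℕ) (c : ℕ) : ZMod (s.1 * s.2) :=
  let N := s.1 * s.2
  let lam := Nat.lcm (s.1 - 1) (s.2 - 1)
  (((c ^ lam % N ^ 2 - 1) / N : ℕ) : ZMod N) * (lam : ZMod N)⁻¹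

/-- The plaintext as a signed integer (representative of least absolute value). -/
def decInt (s : ℕ × ℕ) (c : ℕ) : ℤ := (dec s c).valMinAbs

/-- Homomorphic sum of a family of encrypted vectors. -/
def hsum (N : ℕ) {J n : ℕ} (c : Fin J → Fin n → ℕ) : Fin n → ℕ :=
  fun l => (∏ j, c j l) % N ^ 2

/-- Homomorphic product of a plaintext integer matrix and an encrypted vector. -/
def hmul (N : ℕ) {m n : ℕ} (A : Matrix (Fin m) (Fin n) ℤ) (c : Fin n → ℕ) : Fin m → ℕ :=
  fun i => (∏ l, c l ^ (A i l : ZMod N).val) % N ^ 2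

/-- Decisional composite residuosity assumption: for a random modulus `N`, a random `N`-th power
in the group of units modulo `N ^ 2` is computationally indistinguishable from a random unit. -/
def DCRA : Prop :=
  CompIndist
    (fun κ => (keyGen κ).bind fun s => (unif (units ((s.1 * s.2) ^ 2)) 1).map fun u =>
      Val.pair (.nat (s.1 * s.2)) (.nat (u ^ (s.1 * s.2) % (s.1 * s.2) ^ 2)))
    (fun κ => (keyGen κ).bind fun s => (unif (units ((s.1 * s.2) ^ 2)) 1).map fun u =>
      Val.pair (.nat (s.1 * s.2)) (.nat u))

end Paillier

/-! # The diffusion Kalman filter over sensor groups -/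

/-- A common denominator of the entries of a rational matrix. -/
def matDen {m l : ℕ} (A : Matrix (Fin m) (Fin l) ℚ) : ℕ := ∏ i, ∏ j, (A i j).den

/-- The integer matrix `d • A` (exact if `d` is a common denominator of the entries). -/
def mantMat {m l : ℕ} (d : ℕ) (A : Matrix (Fin m) (Fin l) ℚ) : Matrix (Fin m) (Fin l) ℤ :=
  A.map fun a => ⌊(d : ℚ) * a⌋

/-- The integer vector `d • v` (exact if `d` is a common denominator of the entries). -/
def mantVec {m : ℕ} (d : ℕ) (v : Fin m → ℚ) : Fin m → ℤ := fun i => ⌊(d : ℚ) * v i⌋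

/-- The vector with integer mantissas `v` at scale `d`. -/
def ofMant {m : ℕ} (d : ℕ) (v : Fin m → ℤ) : Fin m → ℚ := fun i => (v i : ℚ) / d

/-- Public parameters: state dimension `n`, measurement dimension `p`, and `J` groups, group `j`
having `I j` sensors. Rounds are numbered from `0`; round `k` leads from the `k`-th to the
`(k+1)`-st global estimate. `res` is the resolution of the measurements and of the initial state,
which are multiples of `1 / res`. -/
structure Model (n p J : ℕ) (I : Fin J → ℕ) : Type where
  F : Matrix (Fin n) (Fin n) ℚ
  Q : ℕ → Matrix (Fin n) (Fin n) ℚ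
  H : (j : Fin J) → Fin (I j) → Matrix (Fin p) (Fin n) ℚ
  R : (j : Fin J) → Fin (I j) → ℕ → Matrix (Fin p) (Fin p) ℚ
  P₀ : Matrix (Fin n) (Fin n) ℚ
  res : ℕ

/-- Private data, as integer mantissas: the initial state of the query node and the measurements
of the sensors of each group in each round. -/
structure Inputs (n p J : ℕ) (I : Fin J → ℕ) : Type where
  x₀ : Fin n → ℤ
  y : (j : Fin J) → Fin (I j) → ℕ → Fin p → ℤ

namespace Model

variable {n p J : ℕ} {I : Fin J → ℕ}

noncomputable section

/-- Covariance of the local estimate of group `j`, from the previous global covariance `P`. -/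
def groupCovOf (M : Model n p J I) (k : ℕ) (P : Matrix (Fin n) (Fin n) ℚ) (j : Fin J) :
    Matrix (Fin n) (Fin n) ℚ :=
  (P⁻¹ + ∑ i, (M.H j i)ᵀ * (M.R j i k)⁻¹ * M.H j i)⁻¹

/-- The global covariance after `k` rounds. -/
def cov (M : Model n p J I) : ℕ → Matrix (Fin n) (Fin n) ℚ
  | 0 => M.P₀
  | k + 1 => M.F * (∑ j, (M.groupCovOf k (M.cov k) j)⁻¹)⁻¹ * M.Fᵀ + M.Q k

/-- Covariance of the local estimate of group `j` in round `k`. -/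
def groupCov (M : Model n p J I) (k : ℕ) (j : Fin J) : Matrix (Fin n) (Fin n) ℚ :=
  M.groupCovOf k (M.cov k) j

/-- Covariance after the diffusion update of round `k`. -/
def diffCov (M : Model n p J I) (k : ℕ) : Matrix (Fin n) (Fin n) ℚ :=
  (∑ j, (M.groupCov k j)⁻¹)⁻¹

/-- Kalman gain of sensor `i` of group `j` in round `k`. -/
def gain (M : Model n p J I) (k : ℕ) (j : Fin J) (i : Fin (I j)) : Matrix (Fin n) (Fin p) ℚ :=
  M.groupCov k j * (M.H j i)ᵀ * (M.R j i k)⁻¹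

/-- Measurement update of group `j` in round `k`, from the previous global estimate `x`. -/
def localUpdate (M : Model n p J I) (k : ℕ) (j : Fin J) (x : Fin n → ℚ)
    (y : Fin (I j) → Fin p → ℚ) : Fin n → ℚ :=
  x + ∑ i, M.gain k j i *ᵥ (y i - M.H j i *ᵥ x)

/-- Diffusion update (weighted average) of the local estimates `x` in round `k`. -/
def diffuse (M : Model n p J I) (k : ℕ) (x : Fin J → Fin n → ℚ) : Fin n → ℚ :=
  M.diffCov k *ᵥ ∑ j, (M.groupCov k j)⁻¹ *ᵥ x j

/-- The measurements of group `j` in round `k`. -/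
def meas (M : Model n p J I) (x : Inputs n p J I) (k : ℕ) (j : Fin J) (i : Fin (I j)) :
    Fin p → ℚ :=
  ofMant M.res (x.y j i k)

/-- The global estimates of the diffusion Kalman filter: the function that the protocol has to
compute. -/
def estimate (M : Model n p J I) (x : Inputs n p J I) : ℕ → Fin n → ℚ
  | 0 => ofMant M.res x.x₀
  | k + 1 => M.F *ᵥ M.diffuse k fun j => M.localUpdate k j (M.estimate x k) (M.meas x k j)

/-- The local estimates of the diffusion Kalman filter. -/
def localEstimate (M : Model n p J I) (x : Inputs n p J I) (k : ℕ) (j : Fin J) : Fin n → ℚ :=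
  M.localUpdate k j (M.estimate x k) (M.meas x k j)

/-- The estimates after the diffusion update and before the time update. -/
def diffEstimate (M : Model n p J I) (x : Inputs n p J I) (k : ℕ) : Fin n → ℚ :=
  M.diffuse k (M.localEstimate x k)

/-- Admissible parameters: noise and initial covariances are covariance matrices, and those that
the filter inverts are invertible. -/
structure Valid (M : Model n p J I) : Prop where
  res_pos : 0 < M.res
  posDef_P₀ : (M.P₀.map (Rat.cast : ℚ → ℝ)).PosDef
  posDef_R : ∀ j i k, ((M.R j i k).map (Rat.cast : ℚ → ℝ)).PosDef
  posSemidef_Q : ∀ k, ((M.Q k).map (Rat.cast : ℚ → ℝ)).PosSemidef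
  isUnit_cov : ∀ k, IsUnit (M.cov k).det

/-! ## Fixed-point encoding: public denominators that make the mantissas exact -/

def invDen (M : Model n p J I) (k : ℕ) : ℕ := ∏ j, matDen (M.groupCov k j)⁻¹

def localDen (M : Model n p J I) (k : ℕ) : ℕ :=
  M.res * ∏ j, ∏ i, matDen (M.gain k j i) * matDen (M.H j i)

/-- Scale of the global estimates after `k` rounds. -/
def scale (M : Model n p J I) : ℕ → ℕ
  | 0 => M.res
  | k + 1 => matDen M.F * (matDen (M.diffCov k) * (M.invDen k * (M.localDen k * M.scale k)))

/-- Scale of the local estimates in round `k`. -/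
def localScale (M : Model n p J I) (k : ℕ) : ℕ := M.localDen k * M.scale k

/-! ## The protocol -/

/-- Step 1: mantissas of the local estimate of group `j`, from those of the global estimate. -/
def localMant (M : Model n p J I) (x : Inputs n p J I) (k : ℕ) (xq : Fin n → ℤ) (j : Fin J) :
    Fin n → ℤ :=
  mantVec (M.localScale k) (M.localUpdate k j (ofMant (M.scale k) xq) (M.meas x k j))

/-- Step 2: the encrypted local estimate of group `j`, with encryption randomness `ρ k j`. -/
def localCipher (M : Model n p J I) (N : ℕ) (x : Inputs n p J I) (ρ : ℕ → Fin J → Fin n → ℕ)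
    (k : ℕ) (xq : Fin n → ℤ) (j : Fin J) : Fin n → ℕ :=
  fun l => Paillier.enc N (M.localMant x k xq j l) (ρ k j l)

/-- Steps 3 and 4: diffusion update and time update by the aggregator on ciphertexts. -/
def aggregate (M : Model n p J I) (N : ℕ) (k : ℕ) (c : Fin J → Fin n → ℕ) : Fin n → ℕ :=
  Paillier.hmul N (mantMat (matDen M.F) M.F)
    (Paillier.hmul N (mantMat (matDen (M.diffCov k)) (M.diffCov k))
      (Paillier.hsum N fun j =>
        Paillier.hmul N (mantMat (M.invDen k) (M.groupCov k j)⁻¹) (c j)))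

/-- The execution: mantissas of the global estimate that the query node holds after `k` rounds.
In each round it decrypts the result of the aggregator (Step 5). -/
def exec (M : Model n p J I) (s : ℕ × ℕ) (x : Inputs n p J I) (ρ : ℕ → Fin J → Fin n → ℕ) :
    ℕ → Fin n → ℤ
  | 0 => x.x₀
  | k + 1 => fun l => Paillier.decInt s
      (M.aggregate (s.1 * s.2) k (M.localCipher (s.1 * s.2) x ρ k (M.exec s x ρ k)) l)

/-- Ciphertexts that the aggregator receives in round `k` of the execution. -/
def received (M : Model n p J I) (s : ℕ × ℕ) (x : Inputs n p J I) (ρ : ℕ → Fin J → Fin n → ℕ)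
    (k : ℕ) : Fin J → Fin n → ℕ :=
  M.localCipher (s.1 * s.2) x ρ k (M.exec s x ρ k)

/-- Ciphertexts that the aggregator sends to the query node in round `k` of the execution. -/
def sent (M : Model n p J I) (s : ℕ × ℕ) (x : Inputs n p J I) (ρ : ℕ → Fin J → Fin n → ℕ)
    (k : ℕ) : Fin n → ℕ :=
  M.aggregate (s.1 * s.2) k (M.received s x ρ k)

end

end Model

/-! # Coalitions, their views and their knowledge -/

/-- The party that the colluding groups join: none, the aggregator, or the query node. -/
inductive Kind : Type
  | sensor | cloud | query
  deriving DecidableEq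

/-- The elements of a set of groups in increasing order. -/
def members {J : ℕ} (g : Finset (Fin J)) : List (Fin J) := (List.finRange J).filter (· ∈ g)

/-- The datum `f 0, …, f (K - 1)`. -/
def rounds (K : ℕ) (f : ℕ → Val) : Val := .list ((List.range K).map f)

namespace Model

variable {n p J : ℕ} {I : Fin J → ℕ}

noncomputable section

/-- The public parameters of `K` rounds, with the public covariances of the local estimates. -/
def publicVal (M : Model n p J I) (K : ℕ) : Val :=
  .list [.nat M.res, .mat M.F, .mat M.P₀, rounds K fun k => .mat (M.Q k),
    .list (List.ofFn fun j => .list (List.ofFn fun i => .mat (M.H j i))),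
    rounds K fun k => .list (List.ofFn fun j => .list (List.ofFn fun i => .mat (M.R j i k))),
    rounds K fun k => .list (List.ofFn fun j => .mat (M.groupCov k j))]

/-- The measurements of group `j` in the first `K` rounds. -/
def measVal (x : Inputs n p J I) (K : ℕ) (j : Fin J) : Val :=
  rounds K fun k => .list (List.ofFn fun i => .vec (x.y j i k))

/-- View of group `j`: measurements; the global estimates and covariances received so far (those
with number less than `L`); and for each round the local estimate, its ciphertext, and the
encryption randomness. -/
def groupView (M : Model n p J I) (K L : ℕ) (s : ℕ × ℕ) (x : Inputs n p J I)
    (ρ : ℕ → Fin J → Fin n → ℕ) (j : Fin J) : Val :=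
  .list [measVal x K j,
    rounds L fun k => .pair (.vec (M.exec s x ρ k)) (.mat (M.cov k)),
    rounds K fun k => .list [.vec (M.localMant x k (M.exec s x ρ k) j),
      .vec fun l => (M.received s x ρ k j l : ℤ), .vec fun l => (ρ k j l : ℤ)]]

/-- View of the aggregator: the ciphertexts and covariances received from all groups, and the
result that it computes from them. -/
def cloudView (M : Model n p J I) (K : ℕ) (s : ℕ × ℕ) (x : Inputs n p J I)
    (ρ : ℕ → Fin J → Fin n → ℕ) : Val :=
  rounds K fun k => .list
    [.list (List.ofFn fun j => .pair (.vec fun l => (M.received s x ρ k j l : ℤ))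
        (.mat (M.groupCov k j))),
      .vec fun l => (M.sent s x ρ k l : ℤ), .mat (M.cov (k + 1))]

/-- View of the query node: secret key, initial state, and for each round the received ciphertexts
and covariance and the decrypted estimate. -/
def queryView (M : Model n p J I) (K : ℕ) (s : ℕ × ℕ) (x : Inputs n p J I)
    (ρ : ℕ → Fin J → Fin n → ℕ) : Val :=
  .list [.nat s.1, .nat s.2, .vec x.x₀,
    rounds K fun k => .list [.vec fun l => (M.sent s x ρ k l : ℤ), .mat (M.cov (k + 1)),
      .vec (M.exec s x ρ (k + 1))]]

/-- View of the coalition of the groups in `g` with the party `c`. -/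
def viewVal (M : Model n p J I) (c : Kind) (K L : ℕ) (g : Finset (Fin J)) (s : ℕ × ℕ)
    (x : Inputs n p J I) (ρ : ℕ → Fin J → Fin n → ℕ) : Val :=
  .list [M.publicVal K, .nat (s.1 * s.2), .list ((members g).map (M.groupView K L s x ρ)),
    match c with
    | .sensor => .int 0
    | .cloud => M.cloudView K s x ρ
    | .query => M.queryView K s x ρ]

/-- The joint encryption randomness of all groups in `K` rounds: independent uniformly distributed
units modulo `N`. -/
def coinSet (J n K N : ℕ) : Finset (Fin K → Fin J → Fin n → ℕ) :=
  Fintype.piFinset fun _ => Fintype.piFinset fun _ => Fintype.piFinset fun _ => Paillier.units N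

/-- Randomness indexed by all rounds (those after the last one executed play no role). -/
def extend {K : ℕ} (ρ : Fin K → Fin J → Fin n → ℕ) : ℕ → Fin J → Fin n → ℕ :=
  fun k => if h : k < K then ρ ⟨k, h⟩ else 1

/-- The view as an ensemble indexed by the security parameter. -/
def view (M : Model n p J I) (c : Kind) (K L : ℕ) (g : Finset (Fin J)) (x : Inputs n p J I) :
    ℕ → PMF Val :=
  fun κ => (Paillier.keyGen κ).bind fun s =>
    (unif (coinSet J n K (s.1 * s.2)) 1).map fun ρ => M.viewVal c K L g s x (extend ρ)

/-- The estimates with number less than `L`, as mantissas. -/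
def outputVal (M : Model n p J I) (L : ℕ) (x : Inputs n p J I) : Val :=
  rounds L fun k => .vec (mantVec (M.scale k) (M.estimate x k))

/-- Inputs and outputs of the coalition: its members; the public key, and the secret key if the
query node takes part; the measurements of the colluding groups; and, if the coalition contains
a group or the query node, the global estimates with number less than `L`. -/
def known (M : Model n p J I) (c : Kind) (K L : ℕ) (g : Finset (Fin J)) (s : ℕ × ℕ)
    (x : Inputs n p J I) : Val :=
  .list [.list ((members g).map fun j => .nat j), .nat (s.1 * s.2),
    .list ((members g).map (measVal x K)),
    if c = .query then .pair (.nat s.1) (.nat s.2) else .int 0,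
    if g.Nonempty ∨ c = .query then M.outputVal L x else .int 0]

/-- Output of the simulator `S` on the inputs and outputs of the coalition, as an ensemble. -/
def simulated (M : Model n p J I) (S : PPT) (c : Kind) (K L : ℕ) (g : Finset (Fin J))
    (x : Inputs n p J I) : ℕ → PMF Val :=
  fun κ => (Paillier.keyGen κ).bind fun s => S.run κ (M.known c K L g s x)

/-- The coalition has the same inputs and outputs under `x` and `x'`. -/
def Agree (M : Model n p J I) (c : Kind) (K L : ℕ) (g : Finset (Fin J))
    (x x' : Inputs n p J I) : Prop :=
  (∀ j ∈ g, ∀ i, ∀ k < K, x.y j i k = x'.y j i k) ∧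
    (g.Nonempty ∨ c = .query → ∀ k < L, M.estimate x k = M.estimate x' k)

/-- Computational privacy of `K` rounds against the coalitions of groups `g` with `ok g`, joined by
the party `c`. (1) One simulator reproduces the view of every such coalition from its inputs and
outputs alone. (2) Apart from these inputs and outputs, private data of the other parties do not
influence the view in a detectable way. -/
def PrivateAgainst (M : Model n p J I) (c : Kind) (K L : ℕ) (ok : Finset (Fin J) → Prop) : Prop :=
  (∃ S : PPT, ∀ g, ok g → ∀ x, CompIndist (M.simulated S c K L g x) (M.view c K L g x)) ∧
    ∀ g, ok g → ∀ x x', M.Agree c K L g x x' → CompIndist (M.view c K L g x) (M.view c K L g x')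

/-! ## The linear system for the estimates of the non-colluding groups -/

/-- The `n × (n * d)` matrix of the inverse covariances of the `d` groups outside `g`. -/
def sysMatrix (M : Model n p J I) (g : Finset (Fin J)) (k : ℕ) :
    Matrix (Fin n) ({j : Fin J // j ∉ g} × Fin n) ℝ :=
  fun a b => (((M.groupCov k b.1.1)⁻¹ a b.2 : ℚ) : ℝ)

/-- The stacked local estimates of the groups outside `g`. -/
def sysUnknown (M : Model n p J I) (g : Finset (Fin J)) (x : Inputs n p J I) (k : ℕ) :
    {j : Fin J // j ∉ g} × Fin n → ℝ :=
  fun b => ((M.localEstimate x k b.1.1 b.2 : ℚ) : ℝ)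

/-- The right-hand side, from the diffused estimate and the local estimates of the groups in `g`. -/
def sysRhs (M : Model n p J I) (g : Finset (Fin J)) (x : Inputs n p J I) (k : ℕ) : Fin n → ℝ :=
  fun a => ((((M.diffCov k)⁻¹ *ᵥ M.diffEstimate x k
    - ∑ j ∈ g, (M.groupCov k j)⁻¹ *ᵥ M.localEstimate x k j) a : ℚ) : ℝ)

/-- The global estimate of the next round when the stacked local estimates of the groups
outside `g` are `X` and those of the groups in `g` are the actual ones. -/
def outcome (M : Model n p J I) (g : Finset (Fin J)) (x : Inputs n p J I) (k : ℕ)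
    (X : {j : Fin J // j ∉ g} × Fin n → ℝ) : Fin n → ℝ :=
  (M.F * M.diffCov k).map (Rat.cast : ℚ → ℝ) *ᵥ
    ((fun a => (((∑ j ∈ g, (M.groupCov k j)⁻¹ *ᵥ M.localEstimate x k j) a : ℚ) : ℝ))
      + M.sysMatrix g k *ᵥ X)

/-- The system `P_r X = z` for the non-colluding groups does not determine their estimates.
Its solutions include the true estimates, all yield the global estimate that the coalition
sees (and are the only ones that do if `F` is invertible), are infinite in number, and leave the
estimate of every single non-colluding group arbitrary. -/
structure Underdetermined (M : Model n p J I) (g : Finset (Fin J)) (x : Inputs n p J I)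
    (k : ℕ) : Prop where
  solves : M.sysMatrix g k *ᵥ M.sysUnknown g x k = M.sysRhs g x k
  consistent : ∀ X, M.sysMatrix g k *ᵥ X = M.sysRhs g x k →
    M.outcome g x k X = fun a => ((M.estimate x (k + 1) a : ℚ) : ℝ)
  complete : IsUnit M.F.det → ∀ X, (M.outcome g x k X = fun a => ((M.estimate x (k + 1) a : ℚ) : ℝ)) →
    M.sysMatrix g k *ᵥ X = M.sysRhs g x k
  infinite : {X | M.sysMatrix g k *ᵥ X = M.sysRhs g x k}.Infinite
  free : ∀ (j : {j : Fin J // j ∉ g}) (v : Fin n → ℝ),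
    ∃ X, M.sysMatrix g k *ᵥ X = M.sysRhs g x k ∧ ∀ l, X (j, l) = v l

end

end Model

open scoped BigOperators

/-! # Polynomial-time functions on data -/

/-! Correctness. Modulo N², the number N squares to 0, so an encryption of m has the form (1 + mN)·v
with v the N-th power of a unit. Products and powers of ciphertexts act linearly on m and keep v an
N-th power (`Model.cast_aggregate`, `Model.isResidue_aggregate`). Raising to λ = lcm(a - 1, b - 1)
turns v into 1 and leaves 1 + mλN, hence m modulo N (`Paillier.dec_eq`). The public denominators
make every rounding of the encoding exact, so the plaintexts are the integer mantissas of the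
filter. For given private data these are finitely many fixed integers, while N ≥ 2^κ; signed
decryption is therefore exact for all large κ (`Model.exec_eq_estimateMant`).

Privacy. All coalitions are treated through one ensemble, `Model.ideal`: the plaintexts of the
groups outside the coalition are replaced by 0, and the ciphertext handed to a colluding query node
is (1 + N)^result times an aggregate of encryptions of 0. This view is a function of the coalition's
inputs and outputs and of the coins, so one program samples it up to an error O(2^-κ), caused by
drawing units as 3κ-bit numbers reduced modulo N (`Model.exists_simulator`). Requirement (ii) then
follows from (i), because agreeing inputs and outputs give the simulator the same input
(`Model.privateAgainst_of_ideal`).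

It remains to compare each view with the ideal one. A sensor coalition sees no foreign ciphertext,
and a query coalition sees only aggregates, from which the plaintext factor splits off
(`Model.aggregate_enc`); both views equal the ideal one coin by coin as soon as decryption is exact
(`Model.view_compIndist_ideal`). A cloud coalition sees the foreign ciphertexts themselves. They are
changed one at a time: by the residuosity assumption the N-th power in one of them may become a
random unit modulo N², which absorbs the plaintext (`Model.hybrid_compIndist_update`). The number of
positions does not depend on κ, so a finite chain suffices (`Model.hybrid_compIndist`).

Simulator and reduction have to be actual programs. `PT` and its integer, natural and rational
variants form a calculus of polynomial-time functions closed under composition, branching, bounded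
loops and modular exponentiation, from which both are assembled.

Underdetermination is linear algebra: every block of the system matrix is the inverse of a positive
definite matrix, so the estimate of one group can be prescribed and the equation solved for another
group (`Model.underdetermined`). -/

theorem Polynomial.eval_mono_nat (q : Polynomial ℕ) {a b : ℕ} (h : a ≤ b) : q.eval a ≤ q.eval b := by
  rw [Polynomial.eval_eq_sum, Polynomial.eval_eq_sum]
  exact Finset.sum_le_sum fun i _ => Nat.mul_le_mul_left _ (Nat.pow_le_pow_left h i)

theorem Val.left_size_le (x : Val) : x.left.size ≤ x.size := by
  cases x <;> simp [Val.left, Val.size]; omega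

theorem Val.right_size_le (x : Val) : x.right.size ≤ x.size := by
  cases x <;> simp [Val.right, Val.size]; omega

theorem Int.natAbs_size_add_le (a b : ℤ) :
    (a + b).natAbs.size ≤ a.natAbs.size + b.natAbs.size + 1 := by
  rw [Nat.size_le]
  have h1 := Nat.lt_size_self a.natAbs
  have h2 := Nat.lt_size_self b.natAbs
  have h3 := Int.natAbs_add_le a b
  have h4 : 2 ^ a.natAbs.size ≤ 2 ^ (a.natAbs.size + b.natAbs.size) :=
    Nat.pow_le_pow_right (by norm_num) (by omega)
  have h5 : 2 ^ b.natAbs.size ≤ 2 ^ (a.natAbs.size + b.natAbs.size) :=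
    Nat.pow_le_pow_right (by norm_num) (by omega)
  rw [pow_succ]
  omega

theorem Arith.size_eval_le (o : Arith) (a b : ℤ) :
    (o.eval a b).natAbs.size ≤ a.natAbs.size + b.natAbs.size + 1 := by
  cases o with
  | plus => exact Int.natAbs_size_add_le a b
  | minus =>
    have := Int.natAbs_size_add_le a (-b)
    rwa [Int.natAbs_neg] at this
  | times =>
    rw [Nat.size_le]
    simp only [Arith.eval, Int.natAbs_mul]
    calc a.natAbs * b.natAbs < 2 ^ a.natAbs.size * 2 ^ b.natAbs.size :=
          Nat.mul_lt_mul'' (Nat.lt_size_self _) (Nat.lt_size_self _)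
      _ ≤ _ := by rw [← pow_add]; exact Nat.pow_le_pow_right (by norm_num) (by omega)
  | quot =>
    exact (Nat.size_le_size (Int.natAbs_ediv_le_natAbs a b)).trans (by omega)
  | rem =>
    simp only [Arith.eval]
    rcases eq_or_ne b 0 with rfl | hb
    · simp
    · refine (Nat.size_le_size (?_ : (a % b).natAbs ≤ b.natAbs)).trans (by omega)
      have h1 := Int.emod_nonneg a hb
      have h2 := Int.emod_lt_abs a hb
      rw [Int.abs_eq_natAbs] at h2
      omega

theorem Val.size_binop_le (o : Arith) (x : Val) : (x.binop o.eval).size ≤ x.size := by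
  rcases x with z | ⟨a | ⟨_, _⟩, b | ⟨_, _⟩⟩ <;>
    simp only [Val.binop, Val.size, Int.natAbs_zero, Nat.size_zero] <;> try omega
  have := o.size_eval_le a b
  omega

/-- Each rule charges more than the length of the data it handles. This bound on intermediate
results is what makes composition stay polynomial. -/
theorem Exec.size_le {f : Prog} {x y : Val} {t : ℕ} (h : Exec f x y t) : y.size ≤ t := by
  induction h with
  | skip x => omega
  | const v x => omega
  | left x => have := x.left_size_le; omega
  | right x => have := x.right_size_le; omega
  | op o x => have := x.size_binop_le o; omega
  | fork _ _ _ _ => simp only [Val.size]; omega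
  | seq _ _ _ _ => omega
  | cond_pos _ _ _ => omega
  | cond_neg _ _ _ => omega
  | loop_stop _ => omega
  | loop_step _ _ _ _ _ => omega

/-- A function on data that some program computes in time polynomial in the size of its input. -/
def PT (f : Val → Val) : Prop :=
  ∃ (P : Prog) (q : Polynomial ℕ), ∀ x, ∃ t ≤ q.eval x.size, Exec P x (f x) t

namespace PT

theorem congr {f g : Val → Val} (hf : PT f) (h : ∀ x, f x = g x) : PT g := funext h ▸ hf

open Polynomial

theorem size_le {f : Val → Val} (hf : PT f) : ∃ q : Polynomial ℕ, ∀ x, (f x).size ≤ q.eval x.size := by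
  obtain ⟨P, q, h⟩ := hf
  exact ⟨q, fun x => by obtain ⟨t, ht, hx⟩ := h x; exact hx.size_le.trans ht⟩

theorem id : PT fun x => x := ⟨.skip, X + 1, fun x => ⟨_, by simp, .skip x⟩⟩

theorem const (v : Val) : PT fun _ => v :=
  ⟨.const v, X + C (v.size + 1), fun x => ⟨_, by simp [add_assoc], .const v x⟩⟩

theorem comp {f g : Val → Val} (hf : PT f) (hg : PT g) : PT fun x => f (g x) := by
  obtain ⟨P, p, hP⟩ := hf
  obtain ⟨Q, q, hQ⟩ := hg
  -- The intermediate result is no longer than the time `q` that produced it, so the second program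
  -- runs within `p` of `q`.
  refine ⟨.seq Q P, q + p.comp q + 1, fun x => ?_⟩
  obtain ⟨s, hs, hx⟩ := hQ x
  obtain ⟨t, ht, hy⟩ := hP (g x)
  refine ⟨s + t + 1, ?_, .seq hx hy⟩
  have := p.eval_mono_nat (hx.size_le.trans hs)
  simp only [eval_add, eval_comp, eval_one]
  omega

theorem left {f : Val → Val} (hf : PT f) : PT fun x => (f x).left :=
  comp ⟨.left, X + 1, fun x => ⟨_, by simp, .left x⟩⟩ hf

theorem right {f : Val → Val} (hf : PT f) : PT fun x => (f x).right :=
  comp ⟨.right, X + 1, fun x => ⟨_, by simp, .right x⟩⟩ hf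

theorem binop {f : Val → Val} (o : Arith) (hf : PT f) : PT fun x => (f x).binop o.eval :=
  comp ⟨.op o, X + 1, fun x => ⟨_, by simp, .op o x⟩⟩ hf

theorem pair {f g : Val → Val} (hf : PT f) (hg : PT g) : PT fun x => .pair (f x) (g x) := by
  obtain ⟨P, p, hP⟩ := hf
  obtain ⟨Q, q, hQ⟩ := hg
  refine ⟨.fork P Q, p + q + X + 1, fun x => ?_⟩
  obtain ⟨s, hs, hx⟩ := hP x
  obtain ⟨t, ht, hy⟩ := hQ x
  refine ⟨_, ?_, .fork hx hy⟩
  simp only [eval_add, eval_X, eval_one]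
  omega

theorem cond {f g : Val → Val} (hf : PT f) (hg : PT g) :
    PT fun x => if x.test = true then f x else g x := by
  obtain ⟨P, p, hP⟩ := hf
  obtain ⟨Q, q, hQ⟩ := hg
  refine ⟨.cond P Q, p + q + X + 1, fun x => ?_⟩
  simp only [eval_add, eval_X, eval_one]
  by_cases hx : x.test = true
  · obtain ⟨s, hs, h⟩ := hP x
    simp only [hx, if_true]
    exact ⟨_, by omega, .cond_pos hx h⟩
  · obtain ⟨s, hs, h⟩ := hQ x
    simp only [hx]
    exact ⟨_, by omega, .cond_neg (by simpa using hx) h⟩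

/-- A loop is polynomial-time if the number of its iterations and the size of its states are
polynomially bounded. -/
theorem loop {g init : Val → Val} (hg : PT g) (hi : PT init) (k : Val → ℕ) (b q : Polynomial ℕ)
    (hk : ∀ x, k x ≤ b.eval x.size)
    (hq : ∀ x, ∀ i ≤ k x, (g^[i] (init x)).size ≤ q.eval x.size)
    (hpos : ∀ x, ∀ i < k x, (g^[i] (init x)).test = true)
    (hneg : ∀ x, (g^[k x] (init x)).test = false) : PT fun x => g^[k x] (init x) := by
  obtain ⟨P, p, hP⟩ := hg
  obtain ⟨Q, r, hQ⟩ := hi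
  -- Each of at most `b` iterations costs `p` at a state of size `q`, plus the test; the extra
  -- summand 1 in `b + 1` pays for the last, failing test.
  refine ⟨.seq Q (.loop P), r + (b + 1) * (p.comp q + q + 1) + 1, fun x => ?_⟩
  obtain ⟨s, hs, hx⟩ := hQ x
  -- Induction on the number `m` of iterations still to be made, since the cost of a loop is defined
  -- from its end.
  have key : ∀ m i, i + m = k x → ∃ t ≤ (m + 1) * (p.eval (q.eval x.size) + q.eval x.size + 1),
      Exec (.loop P) (g^[i] (init x)) (g^[k x] (init x)) t := by
    intro m
    induction m with
    | zero =>
      intro i h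
      obtain rfl : i = k x := by omega
      refine ⟨_, ?_, Exec.loop_stop (hneg x)⟩
      have := hq x _ le_rfl
      omega
    | succ m ih =>
      intro i h
      obtain ⟨t, ht, he⟩ := ih (i + 1) (by omega)
      obtain ⟨u, hu, hb⟩ := hP (g^[i] (init x))
      rw [Function.iterate_succ_apply'] at he
      refine ⟨_, ?_, .loop_step (hpos x i (by omega)) hb he⟩
      have h1 := hq x i (by omega)
      have h2 := p.eval_mono_nat h1
      rw [add_mul (m + 1) 1]
      omega
  obtain ⟨t, ht, he⟩ := key (k x) 0 (by simp)
  refine ⟨_, ?_, .seq hx he⟩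
  simp only [eval_add, eval_mul, eval_comp, eval_one]
  have : (k x + 1) * (p.eval (q.eval x.size) + q.eval x.size + 1) ≤
      (b.eval x.size + 1) * (p.eval (q.eval x.size) + q.eval x.size + 1) := by
    gcongr; exact hk x
  omega

end PT

/-! ### Components of data and integer-valued polynomial-time functions -/

namespace Val

/-- The integer in a leaf (`0` on a pair). -/
def toInt : Val → ℤ
  | int z => z
  | pair _ _ => 0

/-- The component with number `m` of a list. -/
def nth : ℕ → Val → Val
  | 0, x => x.left
  | m + 1, x => nth m x.right

theorem nth_list (l : List Val) (m : ℕ) (h : m < l.length) : nth m (list l) = l[m] := by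
  induction l generalizing m with
  | nil => simp at h
  | cons a l ih =>
    cases m with
    | zero => rfl
    | succ m => exact ih m (by simpa using h)

theorem list_injective : Function.Injective list := by
  intro l
  induction l with
  | nil => intro m h; cases m <;> simp_all [list]
  | cons a l ih =>
    intro m h
    cases m with
    | nil => simp [list] at h
    | cons b m =>
      simp only [list, pair.injEq] at h
      rw [h.1, ih h.2]

theorem nth_vec {m : ℕ} (v : Fin m → ℤ) (i : Fin m) : nth i (vec v) = int (v i) := by
  rw [vec, nth_list _ _ (by simp)]
  simp

end Val

theorem PT.nth (m : ℕ) {f : Val → Val} (hf : PT f) : PT fun x => (f x).nth m := by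
  induction m generalizing f with
  | zero => exact hf.left
  | succ m ih => exact ih hf.right

theorem PT.list {α : Type*} (l : List α) {f : α → Val → Val} (hf : ∀ a ∈ l, PT (f a)) :
    PT fun x => .list (l.map fun a => f a x) := by
  induction l with
  | nil => exact .const _
  | cons a l ih =>
    exact (hf a (by simp)).pair (ih fun b hb => hf b (by simp [hb]))

theorem PT.ofFn {m : ℕ} {f : Fin m → Val → Val} (hf : ∀ a, PT (f a)) :
    PT fun x => .list (List.ofFn fun a => f a x) := by
  simp only [List.ofFn_eq_map]
  exact PT.list _ fun a _ => hf a

theorem PT.rounds (K : ℕ) {f : ℕ → Val → Val} (hf : ∀ k < K, PT (f k)) :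
    PT fun x => _root_.rounds K fun k => f k x :=
  PT.list _ fun a ha => hf a (List.mem_range.1 ha)

/-- Integer-valued polynomial-time functions. -/
def PTI (f : Val → ℤ) : Prop := PT fun x => .int (f x)

/-- Polynomial-time functions with values in the natural numbers. -/
def PTN (f : Val → ℕ) : Prop := PTI fun x => (f x : ℤ)

namespace PTI

theorem const (z : ℤ) : PTI fun _ => z := PT.const _

theorem arith (o : Arith) {f g : Val → ℤ} (hf : PTI f) (hg : PTI g) :
    PTI fun x => o.eval (f x) (g x) :=
  (PT.pair hf hg).binop o

theorem add {f g : Val → ℤ} (hf : PTI f) (hg : PTI g) : PTI fun x => f x + g x := arith .plus hf hg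
theorem sub {f g : Val → ℤ} (hf : PTI f) (hg : PTI g) : PTI fun x => f x - g x := arith .minus hf hg
theorem mul {f g : Val → ℤ} (hf : PTI f) (hg : PTI g) : PTI fun x => f x * g x := arith .times hf hg
theorem div {f g : Val → ℤ} (hf : PTI f) (hg : PTI g) : PTI fun x => f x / g x := arith .quot hf hg
theorem mod {f g : Val → ℤ} (hf : PTI f) (hg : PTI g) : PTI fun x => f x % g x := arith .rem hf hg

/-- Adding the leaf 0 fixes integers, and the default value of `Val.binop` sends everything else to
0. -/
theorem toInt {f : Val → Val} (hf : PT f) : PTI fun x => (f x).toInt := by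
  have := (hf.pair (PT.const (.int 0))).binop .plus
  refine this.congr fun x => ?_
  change _ = Val.int (f x).toInt
  generalize f x = y
  cases y <;> simp [Val.binop, Val.toInt, Arith.eval]

theorem prod {α : Type*} (s : Finset α) {f : α → Val → ℤ} (hf : ∀ a ∈ s, PTI (f a)) :
    PTI fun x => ∏ a ∈ s, f a x := by
  classical
  induction s using Finset.induction_on with
  | empty => simpa using const 1
  | insert a s ha ih =>
    simp only [Finset.prod_insert ha]
    exact (hf a (by simp)).mul (ih fun b hb => hf b (by simp [hb]))

theorem pow {f : Val → ℤ} (hf : PTI f) (m : ℕ) : PTI fun x => f x ^ m := by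
  induction m with
  | zero => simpa using const 1
  | succ m ih => simpa only [pow_succ] using ih.mul hf

end PTI

theorem PT.ite {h : Val → ℤ} {f g : Val → Val} (hh : PTI h) (hf : PT f) (hg : PT g) :
    PT fun x => if 0 < h x then f x else g x := by
  have := (PT.cond (hf.comp (PT.id.right)) (hg.comp (PT.id.right))).comp (PT.pair hh PT.id)
  simpa [Val.test, Val.right] using this

theorem PTI.ite {h f g : Val → ℤ} (hh : PTI h) (hf : PTI f) (hg : PTI g) :
    PTI fun x => if 0 < h x then f x else g x := by
  have := PT.ite hh hf hg
  simpa only [PTI, apply_ite Val.int] using this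

theorem PTI.ite_eq {f g u v : Val → ℤ} (hf : PTI f) (hg : PTI g) (hu : PTI u) (hv : PTI v) :
    PTI fun x => if f x = g x then u x else v x := by
  -- The only test available is positivity, so equality is decided by testing both differences.
  have := PTI.ite (hf.sub hg) hv (PTI.ite (hg.sub hf) hv hu)
  convert this using 2 with x
  split_ifs <;> first | rfl | omega

theorem PTI.congr {f g : Val → ℤ} (hf : PTI f) (h : ∀ x, f x = g x) : PTI g := funext h ▸ hf

theorem PTN.congr {f g : Val → ℕ} (hf : PTN f) (h : ∀ x, f x = g x) : PTN g := funext h ▸ hf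

namespace Val

/-- `1` on leaves and `0` on pairs. -/
def leafInd : Val → ℤ
  | int _ => 1
  | pair _ _ => 0

end Val

/-- Adding 1 and subtracting the original integer gives 1 on a leaf, whereas on a pair both terms
are the default 0. -/
theorem PTI.leafInd {f : Val → Val} (hf : PT f) : PTI fun x => (f x).leafInd := by
  refine ((PTI.toInt ((hf.pair (.const (.int 1))).binop .plus)).sub (PTI.toInt hf)).congr fun x => ?_
  cases f x <;> simp [Val.binop, Val.toInt, Arith.eval, Val.leafInd]

open Classical in
/-- Comparison with a fixed datum. -/
theorem PTI.eq_const (v : Val) {f : Val → Val} (hf : PT f) :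
    PTI fun x => if f x = v then 1 else 0 := by
  induction v generalizing f with
  | int z =>
    refine (PTI.ite (PTI.leafInd hf) (PTI.ite_eq (PTI.toInt hf) (.const z) (.const 1) (.const 0))
      (.const 0)).congr fun x => ?_
    generalize f x = y
    cases y <;> simp [Val.toInt, Val.leafInd]
    congr
  | pair u w hu hw =>
    refine (PTI.ite (PTI.leafInd hf) (.const 0) ((hu hf.left).mul (hw hf.right))).congr fun x => ?_
    generalize f x = y
    rcases y with _ | ⟨y_a, y_b⟩ <;>
      simp only [Val.leafInd, Val.left, Val.right, Val.pair.injEq, reduceCtorEq]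
    · simp
    · by_cases h1 : y_a = u <;> by_cases h2 : y_b = w <;> simp [h1, h2]

open Classical in
theorem PT.ite_const (v : Val) {h f g : Val → Val} (hh : PT h) (hf : PT f) (hg : PT g) :
    PT fun x => if h x = v then f x else g x :=
  (PT.ite (PTI.eq_const v hh) hf hg).congr fun x => by split_ifs <;> simp_all

/-! ### Modular exponentiation by repeated squaring -/

/-- Modular exponentiation, with default values for exponents and moduli out of range. -/
def modpow (b e m : ℤ) : ℤ := b ^ e.toNat % (if 0 < m then m else 1)

/-- One step of square and multiply on states (exponent, base, accumulator, modulus). -/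
def sqMulStep (x : Val) : Val :=
  let e := x.left.toInt
  let b := x.right.left.toInt
  let a := x.right.right.left.toInt
  let m := x.right.right.right.toInt
  .pair (.int (e / 2)) (.pair (.int (b * b % m))
    (.pair (.int (if 0 < e % 2 then a * b % m else a)) (.int m)))

theorem sqMulStep_pair (e b a m : ℤ) :
    sqMulStep (.pair (.int e) (.pair (.int b) (.pair (.int a) (.int m)))) =
      .pair (.int (e / 2)) (.pair (.int (b * b % m))
        (.pair (.int (if 0 < e % 2 then a * b % m else a)) (.int m))) := rfl

/-- The loop invariant: after `i` steps the lowest `i` binary digits of the exponent have been moved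
into the accumulator, and the base has been squared `i` times. -/
theorem sqMulStep_iterate (b : ℤ) (e : ℕ) (m : ℤ) (i : ℕ) :
    sqMulStep^[i] (.pair (.int e) (.pair (.int (b % m)) (.pair (.int (1 % m)) (.int m)))) =
      .pair (.int ((e / 2 ^ i : ℕ) : ℤ)) (.pair (.int (b ^ 2 ^ i % m))
        (.pair (.int (b ^ (e % 2 ^ i) % m)) (.int m))) := by
  induction i with
  | zero => simp [Nat.mod_one]
  | succ i ih =>
    rw [Function.iterate_succ_apply', ih, sqMulStep_pair]
    have h1 : ((e / 2 ^ i : ℕ) : ℤ) / 2 = ((e / 2 ^ (i + 1) : ℕ) : ℤ) := by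
      rw [pow_succ, ← Nat.div_div_eq_div_mul]; simp
    have h2 : b ^ 2 ^ i % m * (b ^ 2 ^ i % m) % m = b ^ 2 ^ (i + 1) % m := by
      rw [← Int.mul_emod, ← pow_add, pow_succ, mul_two]
    have h3 : e % 2 ^ (i + 1) = e % 2 ^ i + 2 ^ i * (e / 2 ^ i % 2) := by
      rw [pow_succ, Nat.mod_mul]
    rw [h1, h2]
    congr 4
    have h4 : ((e / 2 ^ i : ℕ) : ℤ) % 2 = ((e / 2 ^ i % 2 : ℕ) : ℤ) := by simp
    rw [h4]
    rcases Nat.mod_two_eq_zero_or_one (e / 2 ^ i) with h | h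
    · rw [h, if_neg (by norm_num), h3, h, mul_zero, add_zero]
    · rw [h, if_pos (by norm_num), h3, h, mul_one, ← Int.mul_emod, ← pow_add]

theorem Int.natAbs_emod_le_natAbs (a : ℤ) {m : ℤ} (hm : 0 < m) : (a % m).natAbs ≤ m.natAbs := by
  have h1 := Int.emod_nonneg a hm.ne'
  have h2 := Int.emod_lt_of_pos a hm
  omega

theorem PTN.toNat {f : Val → ℤ} (hf : PTI f) : PTN fun x => (f x).toNat :=
  PTI.congr (PTI.ite hf hf (.const 0)) fun x => by
    change _ = ((f x).toNat : ℤ)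
    split_ifs <;> omega

/-- The number of iterations is the bit length of the exponent, and base and accumulator stay
reduced, so the bounded-loop principle applies. -/
theorem PTI.modpow {b e m : Val → ℤ} (hb : PTI b) (he : PTI e) (hm : PTI m) :
    PTI fun x => modpow (b x) (e x) (m x) := by
  -- The program must be polynomial on every input; modulo 0 the squares would not be reduced at
  -- all, hence the default modulus 1.
  have hm' : PTI fun x => if 0 < m x then m x else 1 := .ite hm hm (.const 1)
  have he' : PTI fun x => ((e x).toNat : ℤ) := PTN.toNat he
  have hmpos : ∀ x, 0 < if 0 < m x then m x else 1 := fun x => by split_ifs <;> omega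
  have hinit : PT fun x => .pair (.int ((e x).toNat : ℤ))
      (.pair (.int (b x % if 0 < m x then m x else 1))
      (.pair (.int (1 % if 0 < m x then m x else 1)) (.int (if 0 < m x then m x else 1)))) :=
    he'.pair ((hb.mod hm').pair ((PTI.mod (.const 1) hm').pair hm'))
  have hstep : PT sqMulStep := by
    have h1 := PTI.toInt PT.id.left
    have h2 := PTI.toInt PT.id.right.left
    have h3 := PTI.toInt PT.id.right.right.left
    have h4 := PTI.toInt PT.id.right.right.right
    exact (h1.div (.const 2)).pair (((h2.mul h2).mod h4).pair
      ((PTI.ite (h1.mod (.const 2)) ((h3.mul h2).mod h4) h3).pair h4))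
  obtain ⟨q1, hq1⟩ := PT.size_le he'
  obtain ⟨q2, hq2⟩ := PT.size_le hm'
  -- In the size bound, `q1` covers the leaf of the exponent, `3 * q2` those of base, accumulator
  -- and modulus, and 3 the inner nodes.
  have := PT.loop hstep hinit (fun x => (e x).toNat.size) q1 (q1 + 3 * q2 + 3) ?_ ?_ ?_ ?_
  · refine (PTI.toInt this.right.right.left).congr fun x => ?_
    simp only [sqMulStep_iterate, Val.left, Val.right, Val.toInt]
    rw [Nat.mod_eq_of_lt (Nat.lt_size_self _), _root_.modpow]
  · intro x
    refine le_trans ?_ (hq1 x)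
    simp only [Val.size, Int.natAbs_natCast]
    omega
  · intro x i _
    have h1 := hq1 x
    have h2 := hq2 x
    simp only [sqMulStep_iterate, Val.size, Polynomial.eval_add, Polynomial.eval_mul] at *
    have a1 := Nat.size_le_size (Int.natAbs_emod_le_natAbs (b x ^ 2 ^ i) (hmpos x))
    have a2 := Nat.size_le_size (Int.natAbs_emod_le_natAbs
      (b x ^ ((e x).toNat % 2 ^ i)) (hmpos x))
    have a3 := Nat.size_le_size (Nat.div_le_self (e x).toNat (2 ^ i))
    simp only [Int.natAbs_natCast, Polynomial.eval_ofNat] at *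
    omega
  · intro x i hi
    simp only [sqMulStep_iterate, Val.test]
    have := Nat.lt_size.1 hi
    rw [decide_eq_true_eq]
    exact_mod_cast Nat.div_pos this (by positivity)
  · intro x
    simp only [sqMulStep_iterate, Val.test]
    simp [Nat.div_eq_of_lt (Nat.lt_size_self _)]

/-! ### Arithmetic of natural and rational numbers in polynomial time -/

namespace PTN

theorem const (m : ℕ) : PTN fun _ => m := PTI.const m

theorem add {f g : Val → ℕ} (hf : PTN f) (hg : PTN g) : PTN fun x => f x + g x :=
  (PTI.add hf hg).congr fun x => by push_cast; rfl

theorem mul {f g : Val → ℕ} (hf : PTN f) (hg : PTN g) : PTN fun x => f x * g x :=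
  (PTI.mul hf hg).congr fun x => by push_cast; rfl

theorem div {f g : Val → ℕ} (hf : PTN f) (hg : PTN g) : PTN fun x => f x / g x :=
  (PTI.div hf hg).congr fun x => by push_cast; rfl

theorem mod {f g : Val → ℕ} (hf : PTN f) (hg : PTN g) : PTN fun x => f x % g x :=
  (PTI.mod hf hg).congr fun x => by push_cast; rfl

theorem pow {f : Val → ℕ} (hf : PTN f) (m : ℕ) : PTN fun x => f x ^ m :=
  (PTI.pow hf m).congr fun x => by push_cast; rfl

theorem prod {α : Type*} (s : Finset α) {f : α → Val → ℕ} (hf : ∀ a ∈ s, PTN (f a)) :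
    PTN fun x => ∏ a ∈ s, f a x :=
  (PTI.prod s hf).congr fun x => by push_cast; rfl

theorem powMod {b e m : Val → ℕ} (hb : PTN b) (he : PTN e) (hm : PTN m) (h : ∀ x, 0 < m x) :
    PTN fun x => b x ^ e x % m x :=
  (PTI.modpow hb he hm).congr fun x => by simp [modpow, h x]

/-- The least nonnegative residue of an integer. -/
theorem zmodVal {N : Val → ℕ} {f : Val → ℤ} (hN : PTN N) (hf : PTI f) (h : ∀ x, 0 < N x) :
    PTN fun x => (f x : ZMod (N x)).val :=
  (PTI.mod hf hN).congr fun x => by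
    have : NeZero (N x) := ⟨(h x).ne'⟩
    rw [ZMod.val_intCast]

end PTN

/-- Rational-valued functions with a fixed denominator and a polynomial-time numerator. -/
def PTQ (f : Val → ℚ) : Prop := ∃ (d : ℕ) (g : Val → ℤ), 0 < d ∧ PTI g ∧ ∀ x, f x = g x / d

namespace PTQ

theorem ofInt {f : Val → ℤ} (hf : PTI f) : PTQ fun x => (f x : ℚ) := ⟨1, f, one_pos, hf, by simp⟩

theorem const_mul (q : ℚ) {f : Val → ℚ} (hf : PTQ f) : PTQ fun x => q * f x := by
  obtain ⟨d, g, hd, hg, h⟩ := hf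
  refine ⟨q.den * d, _, Nat.mul_pos q.den_pos hd, (PTI.const q.num).mul hg, fun x => ?_⟩
  have hq : (q.den : ℚ) ≠ 0 := by positivity
  have hd' : (d : ℚ) ≠ 0 := by positivity
  simp only [h]
  nth_rewrite 1 [← Rat.num_div_den q]
  push_cast
  field_simp

theorem div_nat {f : Val → ℚ} (hf : PTQ f) (m : ℕ) : PTQ fun x => f x / m := by
  simpa only [div_eq_inv_mul] using hf.const_mul (m : ℚ)⁻¹

theorem add {f g : Val → ℚ} (hf : PTQ f) (hg : PTQ g) : PTQ fun x => f x + g x := by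
  obtain ⟨d, u, hd, hu, h⟩ := hf
  obtain ⟨e, w, he, hw, h'⟩ := hg
  refine ⟨d * e, _, Nat.mul_pos hd he, (hu.mul (.const e)).add (hw.mul (.const d)), fun x => ?_⟩
  have hd' : (d : ℚ) ≠ 0 := by positivity
  have he' : (e : ℚ) ≠ 0 := by positivity
  simp only [h, h']
  push_cast
  field_simp

theorem sub {f g : Val → ℚ} (hf : PTQ f) (hg : PTQ g) : PTQ fun x => f x - g x := by
  simpa only [sub_eq_add_neg, neg_one_mul] using hf.add (hg.const_mul (-1))

theorem sum {α : Type*} (s : Finset α) {f : α → Val → ℚ} (hf : ∀ a ∈ s, PTQ (f a)) :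
    PTQ fun x => ∑ a ∈ s, f a x := by
  classical
  induction s using Finset.induction_on with
  | empty => simpa using ofInt (.const 0)
  | insert a s ha ih =>
    simp only [Finset.sum_insert ha]
    exact (hf a (by simp)).add (ih fun b hb => hf b (by simp [hb]))

theorem floor {f : Val → ℚ} (hf : PTQ f) : PTI fun x => ⌊f x⌋ := by
  obtain ⟨d, g, -, hg, h⟩ := hf
  exact (hg.div (.const d)).congr fun x => by rw [h, Rat.floor_intCast_div_natCast]

end PTQ

/-! # Algorithms from polynomial-time functions -/

theorem Val.size_param (κ : ℕ) : (Val.param κ).size = κ + 2 := by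
  simp [Val.param, Val.size, Nat.size_pow]

theorem Val.size_nat_le {ρ c : ℕ} (h : ρ < 2 ^ c) : (Val.nat ρ).size ≤ c + 1 := by
  have := Nat.size_le.2 h
  simp only [Val.nat, Val.size, Int.natAbs_natCast]
  omega

-- The word for κ has size κ + 2 and the coins at most c(κ) + 1, so a bound in the size of the whole
-- input is a bound in κ and the size of `x`; the remaining constant 5 includes the two pair nodes.
open Polynomial in
theorem exists_ppt {f : Val → Val} (hf : PT f) (c : Polynomial ℕ) :
    ∃ A : PPT, A.coins = c ∧
      ∀ κ x ρ, A.out κ x ρ = f (.pair (.param κ) (.pair x (.nat ρ))) := by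
  obtain ⟨P, q, h⟩ := hf
  refine ⟨⟨P, c, q.comp (X + c + C 5), fun κ x ρ => f (.pair (.param κ) (.pair x (.nat ρ))), ?_⟩,
    rfl, fun _ _ _ => rfl⟩
  intro κ x ρ hρ
  obtain ⟨t, ht, he⟩ := h (.pair (.param κ) (.pair x (.nat ρ)))
  refine ⟨t, ht.trans ?_, he⟩
  rw [eval_comp]
  apply q.eval_mono_nat
  have h1 := Val.size_nat_le hρ
  have h2 := c.eval_mono_nat (show κ ≤ κ + x.size by omega)
  simp only [Val.size, eval_add, eval_X, eval_C] at *
  have := Val.size_param κ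
  omega

open Polynomial in
/-- Running an algorithm on the result of a polynomial-time function. The coins of the combined
algorithm are split into those of the function and those of the algorithm. -/
theorem PPT.exists_precomp (D : PPT) {f : Val → Val} (hf : PT f) (m : ℕ) :
    ∃ A : PPT, A.coins = C (3 * m) * X + D.coins ∧
      ∀ κ x ρ, A.out κ x ρ =
        D.out κ (f (.pair (.param κ) (.pair x (.nat (ρ % 2 ^ (3 * κ * m))))))
          (ρ / 2 ^ (3 * κ * m)) := by
  -- The security parameter is presented as the integer 2^κ, so the splitting point 2^(3κm) is a
  -- fixed power of it.
  have hB : PTN fun v => v.left.toInt.toNat ^ (3 * m) := .pow (.toNat (.toInt PT.id.left)) _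
  have hρ : PTN fun v => v.right.right.toInt.toNat := .toNat (.toInt PT.id.right.right)
  have hpre : PT fun v => .pair v.left (.pair (f (.pair v.left (.pair v.right.left (.nat
      (v.right.right.toInt.toNat % v.left.toInt.toNat ^ (3 * m))))))
      (.nat (v.right.right.toInt.toNat / v.left.toInt.toNat ^ (3 * m)))) :=
    PT.id.left.pair ((hf.comp (PT.id.left.pair (PT.id.right.left.pair (hρ.mod hB)))).pair
      (hρ.div hB))
  have hval : ∀ κ x ρ, (.pair (Val.param κ) (.pair (f (.pair (.param κ) (.pair x (.nat
      (ρ % 2 ^ (3 * κ * m)))))) (.nat (ρ / 2 ^ (3 * κ * m))))) = (fun v : Val => Val.pair v.left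
      (.pair (f (.pair v.left (.pair v.right.left (.nat
      (v.right.right.toInt.toNat % v.left.toInt.toNat ^ (3 * m))))))
      (.nat (v.right.right.toInt.toNat / v.left.toInt.toNat ^ (3 * m)))))
      (.pair (.param κ) (.pair x (.nat ρ))) := by
    intro κ x ρ
    have : 3 * κ * m = κ * (3 * m) := by ring
    have h2 : ((2 : ℤ) ^ κ).toNat = 2 ^ κ := by
      rw [← Nat.cast_ofNat, ← Nat.cast_pow, Int.toNat_natCast]
    change _ = Val.pair (.param κ) (.pair (f (.pair (.param κ) (.pair x (.nat
      ((ρ : ℤ).toNat % ((2 : ℤ) ^ κ).toNat ^ (3 * m)))))) (.nat ((ρ : ℤ).toNat /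
        ((2 : ℤ) ^ κ).toNat ^ (3 * m))))
    rw [this, h2, ← pow_mul, Int.toNat_natCast]
  obtain ⟨P, p, hP⟩ := hpre
  set co : Polynomial ℕ := C (3 * m) * X + D.coins with hco
  set q : Polynomial ℕ := p.comp (X + co + C 5) with hq
  refine ⟨⟨.seq P D.prog, co, q + D.time.comp (X + q) + 1, _, ?_⟩, rfl, fun _ _ _ => rfl⟩
  intro κ x ρ hlt
  obtain ⟨s, hs, he⟩ := hP (.pair (.param κ) (.pair x (.nat ρ)))
  rw [← hval] at he
  have hs' : s ≤ q.eval (κ + x.size) := by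
    refine hs.trans ?_
    rw [hq, eval_comp]
    apply p.eval_mono_nat
    have h1 := Val.size_nat_le hlt
    have h2 := co.eval_mono_nat (show κ ≤ κ + x.size by omega)
    have h3 := Val.size_param κ
    simp only [Val.size, eval_add, eval_X, eval_C] at *
    omega
  obtain ⟨t, ht, hD⟩ := D.halts κ (f (.pair (.param κ) (.pair x (.nat (ρ % 2 ^ (3 * κ * m))))))
    (ρ / 2 ^ (3 * κ * m)) (by
      rw [Nat.div_lt_iff_lt_mul (by positivity), ← pow_add]
      refine hlt.trans_le (Nat.pow_le_pow_right (by norm_num) (le_of_eq ?_))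
      simp only [hco, eval_add, eval_mul, eval_C, eval_X]
      ring)
  refine ⟨_, ?_, .seq he hD⟩
  simp only [eval_add, eval_comp, eval_X, eval_one]
  have := D.time.eval_mono_nat (show κ + (f (.pair (.param κ) (.pair x (.nat
    (ρ % 2 ^ (3 * κ * m)))))).size ≤ κ + x.size + q.eval (κ + x.size) by
      have := he.size_le
      simp only [Val.size] at this ⊢
      omega)
  omega

/-! # Expectations over finite sets -/

section Expect

open Finset

/-- A map with fibres of constant size carries the uniform distribution to the uniform one. This is
the tool for reducing units modulo N and for resampling a coin. -/
theorem expect_of_fibers {α β : Type*} [DecidableEq β] {S : Finset α} {T : Finset β} {f : α → β}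
    (hf : ∀ a ∈ S, f a ∈ T) {c : ℕ} (hc : 0 < c) (h : ∀ b ∈ T, (S.filter fun a => f a = b).card = c)
    (φ : β → ℝ) : 𝔼 a ∈ S, φ (f a) = 𝔼 b ∈ T, φ b := by
  have h1 : S.card = T.card * c := by
    rw [card_eq_sum_card_fiberwise hf, sum_congr rfl h, sum_const, smul_eq_mul]
  have h2 : ∑ a ∈ S, φ (f a) = (∑ b ∈ T, φ b) * c := by
    rw [← sum_fiberwise_of_maps_to hf, sum_mul]
    refine sum_congr rfl fun b hb => ?_
    rw [sum_congr rfl (g := fun _ => φ b) fun a ha => by rw [(mem_filter.1 ha).2], sum_const, h b hb,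
      nsmul_eq_mul, mul_comm]
  rw [expect_eq_sum_div_card, expect_eq_sum_div_card, h1, h2]
  push_cast
  rw [mul_div_mul_right]
  positivity

theorem expect_pi_of_fibers {ι α β : Type*} [Fintype ι] [DecidableEq ι] [DecidableEq α]
    [DecidableEq β] {S : Finset α} {T : Finset β} {f : α → β}
    (hf : ∀ a ∈ S, f a ∈ T) {c : ℕ} (hc : 0 < c) (h : ∀ b ∈ T, (S.filter fun a => f a = b).card = c)
    (φ : (ι → β) → ℝ) :
    𝔼 ω ∈ Fintype.piFinset fun _ => S, φ (fun i => f (ω i)) =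
      𝔼 r ∈ Fintype.piFinset fun _ => T, φ r := by
  refine expect_of_fibers (f := fun (ω : ι → α) i => f (ω i)) (fun ω hω => ?_)
    (pow_pos hc (Fintype.card ι)) (fun r hr => ?_) φ
  · exact Fintype.mem_piFinset.2 fun i => hf _ (Fintype.mem_piFinset.1 hω i)
  · have : (Fintype.piFinset fun _ : ι => S).filter (fun ω => (fun i => f (ω i)) = r) =
        Fintype.piFinset fun i => S.filter fun a => f a = r i := by
      ext ω
      simp [funext_iff, forall_and]
    rw [this, Fintype.card_piFinset, prod_congr rfl fun i _ => h _ (Fintype.mem_piFinset.1 hr i)]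
    simp

/-- The difference equals the proportion of `S` outside `T` times the difference of the means
outside and inside `T`, both of which lie in [0, 1]. -/
theorem abs_expect_sub_expect_le_of_subset {α : Type*} {S T : Finset α} (h : T ⊆ S)
    (hT : T.Nonempty) {φ : α → ℝ} (h0 : ∀ a, 0 ≤ φ a) (h1 : ∀ a, φ a ≤ 1) :
    |𝔼 a ∈ S, φ a - 𝔼 a ∈ T, φ a| ≤ 1 - (T.card : ℝ) / S.card := by
  classical
  have ht : (0 : ℝ) < T.card := by exact_mod_cast hT.card_pos
  have hs : (0 : ℝ) < S.card := by exact_mod_cast (hT.mono h).card_pos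
  have e0 : 0 ≤ 𝔼 a ∈ T, φ a := expect_nonneg fun a _ => h0 a
  have e1 : 𝔼 a ∈ T, φ a ≤ 1 := expect_le hT fun a _ => h1 a
  have e2 : ∑ a ∈ T, φ a = T.card * 𝔼 a ∈ T, φ a := by
    rw [expect_eq_sum_div_card, mul_div_cancel₀ _ ht.ne']
  have e3 : ∑ a ∈ S, φ a = ∑ a ∈ S \ T, φ a + ∑ a ∈ T, φ a := (sum_sdiff h).symm
  have e4 : 0 ≤ ∑ a ∈ S \ T, φ a := sum_nonneg fun a _ => h0 a
  have e5 : ∑ a ∈ S \ T, φ a ≤ S.card - T.card := by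
    refine (sum_le_sum fun a _ => h1 a).trans ?_
    rw [sum_const, nsmul_eq_mul, mul_one, cast_card_sdiff h]
  have e6 : 𝔼 a ∈ S, φ a - 𝔼 a ∈ T, φ a =
      (∑ a ∈ S \ T, φ a - (S.card - T.card) * 𝔼 a ∈ T, φ a) / S.card := by
    rw [expect_eq_sum_div_card S, e3, e2]
    field_simp
    ring
  have e7 : 1 - (T.card : ℝ) / S.card = (S.card - T.card) / S.card := by field_simp
  have e8 : (T.card : ℝ) ≤ S.card := by exact_mod_cast card_le_card h
  rw [e6, e7, abs_div, abs_of_pos hs]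
  gcongr
  rw [abs_le]
  constructor <;> nlinarith

theorem abs_expect_sub_expect_le {α : Type*} {S : Finset α} {φ ψ : α → ℝ} {ε : ℝ}
    (hε : 0 ≤ ε) (h : ∀ a ∈ S, |φ a - ψ a| ≤ ε) : |𝔼 a ∈ S, φ a - 𝔼 a ∈ S, ψ a| ≤ ε := by
  rcases S.eq_empty_or_nonempty with rfl | hS
  · simpa using hε
  rw [← expect_sub_distrib]
  exact (abs_expect_le _ _).trans (expect_le hS h)

/-- Remainder and quotient of a random number are independent and uniform; in this way one coin
string serves two algorithms. -/
theorem expect_range_mul (A B : ℕ) (φ : ℕ → ℕ → ℝ) :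
    𝔼 ρ ∈ range (A * B), φ (ρ % A) (ρ / A) = 𝔼 a ∈ range A, 𝔼 b ∈ range B, φ a b := by
  rcases Nat.eq_zero_or_pos A with rfl | hA
  · simp
  rw [← expect_product']
  refine expect_nbij' (fun ρ => (ρ % A, ρ / A)) (fun x => x.1 + A * x.2) ?_ ?_ ?_ ?_ ?_
  · intro ρ hρ
    simp only [mem_product, mem_range] at *
    exact ⟨Nat.mod_lt _ hA, Nat.div_lt_of_lt_mul hρ⟩
  · rintro ⟨a, b⟩ h
    simp only [mem_product, mem_range] at *
    calc a + A * b < A + A * b := by omega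
      _ = A * (b + 1) := by ring
      _ ≤ A * B := Nat.mul_le_mul_left _ h.2
  · intro ρ _
    exact Nat.mod_add_div ρ A
  · rintro ⟨a, b⟩ h
    simp only [mem_product, mem_range] at *
    rw [Nat.add_mul_mod_self_left, Nat.mod_eq_of_lt h.1, Nat.add_mul_div_left _ _ hA,
      Nat.div_eq_of_lt h.1, zero_add]
  · intros; rfl

/-- Numbers below B^m correspond bijectively to their strings of base-B digits, so one coin string
yields `m` independent blocks. -/
theorem expect_digits {ι : Type*} [Fintype ι] [DecidableEq ι] {m : ℕ} (e : ι ≃ Fin m) (B : ℕ)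
    (φ : (ι → ℕ) → ℝ) :
    𝔼 ρ ∈ range (B ^ m), φ (fun i => ρ / B ^ (e i : ℕ) % B) =
      𝔼 ω ∈ Fintype.piFinset fun _ => range B, φ ω := by
  have key : ∀ ρ (h : ρ < B ^ m), (fun i => ρ / B ^ (e i : ℕ) % B) =
      fun i => ((finFunctionFinEquiv.symm ⟨ρ, h⟩ (e i) : Fin B) : ℕ) := fun ρ h => by
    ext i; simp
  refine expect_nbij (fun ρ i => ρ / B ^ (e i : ℕ) % B) ?_ (fun _ _ => rfl) ?_ ?_
  · intro ρ hρ
    refine Fintype.mem_piFinset.2 fun i => mem_range.2 ?_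
    have := congrFun (key ρ (mem_range.1 hρ)) i
    exact this ▸ Fin.is_lt _
  · intro ρ hρ ρ' hρ' h
    simp only [coe_range, Set.mem_Iio] at hρ hρ'
    simp only [key ρ hρ, key ρ' hρ'] at h
    have : finFunctionFinEquiv.symm ⟨ρ, hρ⟩ = finFunctionFinEquiv.symm ⟨ρ', hρ'⟩ := by
      ext i
      simpa using congrFun h (e.symm i)
    simpa using this
  · intro ω hω
    replace hω := fun i => mem_range.1 (Fintype.mem_piFinset.1 (mem_coe.1 hω) i)
    let w : Fin m → Fin B := fun i => ⟨ω (e.symm i), hω _⟩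
    refine ⟨(finFunctionFinEquiv w : ℕ), mem_coe.2 (mem_range.2 (Fin.is_lt _)), ?_⟩
    change (fun i => _) = _
    rw [key _ (finFunctionFinEquiv w).2, Fin.eta, Equiv.symm_apply_apply]
    simp [w]

/-- Independence of the coordinates: replacing one of them by a fresh sample leaves the product
distribution unchanged. -/
theorem expect_update {ι : Type*} [Fintype ι] [DecidableEq ι] {U : Finset ℕ} (hU : U.Nonempty)
    (i : ι) (ψ : (ι → ℕ) → ℝ) :
    𝔼 ω ∈ Fintype.piFinset (fun _ => U), ψ ω =
      𝔼 ω ∈ Fintype.piFinset (fun _ => U), 𝔼 r ∈ U, ψ (Function.update ω i r) := by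
  rw [← expect_product' _ _ fun ω r => ψ (Function.update ω i r)]
  symm
  refine expect_of_fibers (f := fun x : (ι → ℕ) × ℕ => Function.update x.1 i x.2) ?_ hU.card_pos
    ?_ ψ
  · rintro ⟨ω, r⟩ h
    simp only [mem_product, Fintype.mem_piFinset] at *
    intro j
    rcases eq_or_ne j i with rfl | hj
    · simpa using h.2
    · simpa [hj] using h.1 j
  · intro b hb
    rw [Fintype.mem_piFinset] at hb
    -- A preimage of `b` is determined by the forgotten old value at `i`, which ranges freely over
    -- `U`.
    rw [← card_image_of_injOn (s := U) (f := fun u => (Function.update b i u, b i))]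
    · congr 1
      ext ⟨ω, r⟩
      simp only [mem_filter, mem_product, Fintype.mem_piFinset, mem_image, Prod.mk.injEq]
      constructor
      · rintro ⟨⟨h1, h2⟩, rfl⟩
        refine ⟨ω i, h1 i, by simp, by simp⟩
      · rintro ⟨u, hu, rfl, rfl⟩
        refine ⟨⟨fun j => ?_, hb i⟩, by simp⟩
        rcases eq_or_ne j i with rfl | hj
        · simpa using hu
        · simpa [hj] using hb j
    · intro u _ v _ h
      simpa using congrFun (Prod.ext_iff.1 h).1 i

end Expect

/-! # Acceptance probabilities and indistinguishability -/

open Finset in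
theorem unif_bind_toReal {α β : Type} {S : Finset α} (hS : S.Nonempty) (d : α) (f : α → PMF β)
    (b : β) : (((unif S d).bind f) b).toReal = 𝔼 s ∈ S, (f s b).toReal := by
  classical
  rw [PMF.bind_apply, tsum_eq_sum (s := S)]
  · rw [ENNReal.toReal_sum fun a _ => ENNReal.mul_ne_top (PMF.apply_ne_top _ _) (PMF.apply_ne_top _ _),
      expect_eq_sum_div_card, sum_div]
    refine sum_congr rfl fun a ha => ?_
    rw [ENNReal.toReal_mul, unif, dif_pos hS, PMF.uniformOfFinset_apply_of_mem hS ha]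
    simp [div_eq_inv_mul]
  · intro a ha
    rw [unif, dif_pos hS, PMF.uniformOfFinset_apply_of_notMem hS ha, zero_mul]

namespace PPT

/-- Probability that the algorithm outputs `1` on a given input. -/
noncomputable def acc (D : PPT) (κ : ℕ) (v : Val) : ℝ := (D.run κ v (.int 1)).toReal

theorem acc_nonneg (D : PPT) (κ : ℕ) (v : Val) : 0 ≤ D.acc κ v := ENNReal.toReal_nonneg

theorem acc_le_one (D : PPT) (κ : ℕ) (v : Val) : D.acc κ v ≤ 1 :=
  ENNReal.toReal_le_of_le_ofReal zero_le_one (by simpa using PMF.coe_le_one _ _)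

open Finset in
theorem acc_eq_expect (D : PPT) (κ : ℕ) (v : Val) :
    D.acc κ v = 𝔼 ρ ∈ range (2 ^ D.coins.eval κ),
      (PMF.pure (D.out κ v ρ) (.int 1)).toReal := by
  rw [acc, run, ← PMF.bind_pure_comp, unif_bind_toReal (by simp)]
  rfl

-- The bridge from `PMF` to finite averages, in which all later estimates are made; it needs the
-- sampled sets to be nonempty, hence the existence of keys.
open Finset in
theorem accept_keyGen (D : PPT) {α : Type} {κ : ℕ} (hκ : (Paillier.keyPairs κ).Nonempty)
    {T : ℕ × ℕ → Finset α} (hT : ∀ s ∈ Paillier.keyPairs κ, (T s).Nonempty) (d : α)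
    (h : ℕ × ℕ → α → Val) :
    D.accept κ ((Paillier.keyGen κ).bind fun s => (unif (T s) d).map (h s)) =
      𝔼 s ∈ Paillier.keyPairs κ, 𝔼 t ∈ T s, D.acc κ (h s t) := by
  rw [accept, PMF.bind_bind, Paillier.keyGen, unif_bind_toReal hκ]
  refine expect_congr rfl fun s hs => ?_
  rw [PMF.bind_map, unif_bind_toReal (hT s hs)]
  rfl

end PPT

namespace CompIndist

theorem symm {X Y : ℕ → PMF Val} (h : CompIndist X Y) : CompIndist Y X := fun D P hP => by
  obtain ⟨κ₀, h⟩ := h D P hP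
  exact ⟨κ₀, fun κ hκ => by rw [abs_sub_comm]; exact h κ hκ⟩

theorem trans {X Y Z : ℕ → PMF Val} (h : CompIndist X Y) (h' : CompIndist Y Z) :
    CompIndist X Z := fun D P hP => by
  have h2P : ∀ m : ℕ, 0 < (2 * P).eval (m : ℝ) := fun m => by simpa using hP m
  obtain ⟨κ₁, h₁⟩ := h D (2 * P) h2P
  obtain ⟨κ₂, h₂⟩ := h' D (2 * P) h2P
  refine ⟨max κ₁ κ₂, fun κ hκ => ?_⟩
  have a1 := h₁ κ (le_of_max_le_left hκ)
  have a2 := h₂ κ (le_of_max_le_right hκ)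
  have a3 : 1 / P.eval (κ : ℝ) = 1 / (2 * P).eval (κ : ℝ) + 1 / (2 * P).eval (κ : ℝ) := by
    have := (hP κ).ne'
    simp only [Polynomial.eval_mul, Polynomial.eval_ofNat]
    field_simp
    norm_num
  rw [a3]
  exact (abs_sub_le _ _ _).trans_lt (add_lt_add a1 a2)

theorem congr_eventually {X Y : ℕ → PMF Val} {κ₀ : ℕ} (h : ∀ κ ≥ κ₀, X κ = Y κ) :
    CompIndist X Y := fun D P hP => ⟨κ₀, fun κ hκ => by
  rw [h κ hκ, sub_self, abs_zero]
  exact one_div_pos.2 (hP κ)⟩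

theorem refl (X : ℕ → PMF Val) : CompIndist X X := congr_eventually (κ₀ := 0) fun _ _ => rfl

/-- Exponential growth beats each monomial of the polynomial, so errors of order 2^-κ are
negligible. -/
theorem exists_bound_lt (C : ℝ) {P : Polynomial ℝ} (hP : ∀ m : ℕ, 0 < P.eval (m : ℝ)) :
    ∃ κ₀ : ℕ, ∀ κ ≥ κ₀, C / 2 ^ κ < 1 / P.eval (κ : ℝ) := by
  have h : Filter.Tendsto (fun κ : ℕ => C * (P.eval (κ : ℝ) / 2 ^ κ)) Filter.atTop (nhds 0) := by
    rw [← mul_zero C]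
    refine Filter.Tendsto.const_mul C ?_
    have : (fun κ : ℕ => P.eval (κ : ℝ) / 2 ^ κ) = fun κ : ℕ =>
        ∑ i ∈ P.support, P.coeff i * ((κ : ℝ) ^ i / 2 ^ κ) := by
      ext κ
      rw [Polynomial.eval_eq_sum, Polynomial.sum, Finset.sum_div]
      exact Finset.sum_congr rfl fun i _ => by ring
    have h0 : (0 : ℝ) = ∑ i ∈ P.support, 0 := Finset.sum_const_zero.symm
    rw [this, h0]
    refine tendsto_finsetSum _ fun i _ => ?_
    rw [← mul_zero (P.coeff i)]
    exact (tendsto_pow_const_div_const_pow_of_one_lt i one_lt_two).const_mul _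
  obtain ⟨κ₀, h₀⟩ := Filter.eventually_atTop.1 (h.eventually (gt_mem_nhds zero_lt_one))
  refine ⟨κ₀, fun κ hκ => ?_⟩
  rw [lt_div_iff₀ (hP κ)]
  convert h₀ κ hκ using 1
  ring

/-- Reduction: if every distinguisher for `X` and `Y` yields one for `X'` and `Y'` with
exponentially close acceptance probabilities, then indistinguishability carries over. -/
theorem of_reduction {X Y X' Y' : ℕ → PMF Val} (h : CompIndist X' Y')
    (hred : ∀ D : PPT, ∃ (A : PPT) (C : ℝ) (κ₁ : ℕ), ∀ κ ≥ κ₁,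
      |D.accept κ (X κ) - A.accept κ (X' κ)| ≤ C / 2 ^ κ ∧
      |D.accept κ (Y κ) - A.accept κ (Y' κ)| ≤ C / 2 ^ κ) : CompIndist X Y := by
  intro D P hP
  obtain ⟨A, C, κ₁, hA⟩ := hred D
  -- Half of 1 / P is reserved for the given indistinguishability, half for the two errors C / 2^κ
  -- of the reduction.
  have h2P : ∀ m : ℕ, 0 < (2 * P).eval (m : ℝ) := fun m => by simpa using hP m
  obtain ⟨κ₂, h₂⟩ := h A (2 * P) h2P
  obtain ⟨κ₃, h₃⟩ := exists_bound_lt (2 * C) h2P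
  refine ⟨max κ₁ (max κ₂ κ₃), fun κ hκ => ?_⟩
  simp only [ge_iff_le, max_le_iff] at hκ
  obtain ⟨a1, a1'⟩ := hA κ hκ.1
  have a2 := h₂ κ hκ.2.1
  have a3 := h₃ κ hκ.2.2
  have a4 : 1 / P.eval (κ : ℝ) = 1 / (2 * P).eval (κ : ℝ) + 1 / (2 * P).eval (κ : ℝ) := by
    have := (hP κ).ne'
    simp only [Polynomial.eval_mul, Polynomial.eval_ofNat]
    field_simp
    norm_num
  have a5 : 2 * C / 2 ^ κ = C / 2 ^ κ + C / 2 ^ κ := by ring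
  rw [abs_le] at a1 a1'
  rw [abs_lt] at a2 ⊢
  constructor <;> linarith

theorem of_bound {X Y : ℕ → PMF Val} (C : ℝ) (κ₁ : ℕ)
    (h : ∀ (D : PPT), ∀ κ ≥ κ₁, |D.accept κ (X κ) - D.accept κ (Y κ)| ≤ C / 2 ^ κ) :
    CompIndist X Y :=
  of_reduction (refl Y) fun D => ⟨D, C, κ₁, fun κ hκ => ⟨h D κ hκ, by
    have := (abs_nonneg _).trans (h D κ hκ)
    simpa using this⟩⟩

end CompIndist

/-! # Sampling invertible residues -/

namespace Paillier

open Finset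

theorem mem_units {N r : ℕ} : r ∈ units N ↔ r < N ∧ r.Coprime N := by simp [units]

theorem units_nonempty {N : ℕ} (hN : 0 < N) : (units N).Nonempty := by
  rcases eq_or_lt_of_le (Nat.succ_le_of_lt hN) with rfl | h
  · exact ⟨0, by simp [units]⟩
  · exact ⟨1, by simp [units, h]⟩

theorem card_units (N : ℕ) : (units N).card = N.totient := by
  rw [Nat.totient_eq_card_coprime]
  congr 1
  ext r
  simp [units, Nat.coprime_comm]

/-- The members of the fibre are r + N t with t < q; coprimality depends on the residue alone. -/
theorem card_fiber_mod {N : ℕ} (q : ℕ) {r : ℕ} (hr : r ∈ units N) :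
    (((range (N * q)).filter fun v => (v % N).Coprime N).filter fun v => v % N = r).card = q := by
  obtain ⟨h1, h2⟩ := mem_units.1 hr
  have hN : 0 < N := by omega
  conv_rhs => rw [← card_range q]
  rw [← card_image_of_injOn (s := range q) (f := fun t => r + N * t)]
  · congr 1
    ext v
    simp only [mem_filter, mem_range, mem_image]
    constructor
    · rintro ⟨⟨h3, -⟩, rfl⟩
      exact ⟨v / N, Nat.div_lt_of_lt_mul h3, Nat.mod_add_div v N⟩
    · rintro ⟨t, ht, rfl⟩
      have : (r + N * t) % N = r := by rw [Nat.add_mul_mod_self_left, Nat.mod_eq_of_lt h1]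
      rw [this]
      refine ⟨⟨?_, h2⟩, rfl⟩
      calc r + N * t < N + N * t := by omega
        _ = N * (t + 1) := by ring
        _ ≤ N * q := Nat.mul_le_mul_left _ ht
  · intro t _ t' _ h
    have : N * t = N * t' := by simpa using h
    exact Nat.eq_of_mul_eq_mul_left hN this

theorem units_sq (N : ℕ) :
    units (N ^ 2) = (range (N * N)).filter fun v => (v % N).Coprime N := by
  ext v
  simp only [mem_units, mem_filter, mem_range, sq]
  refine and_congr_right fun _ => ?_
  rw [Nat.coprime_mul_iff_right, and_self, Nat.Coprime, Nat.Coprime, ← Nat.gcd_rec, Nat.gcd_comm]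

/-- Reduction modulo `N` of a uniform unit modulo `N ^ 2` is a uniform unit modulo `N`. -/
theorem expect_units_sq {N : ℕ} (hN : 0 < N) (φ : ℕ → ℝ) :
    𝔼 u ∈ units (N ^ 2), φ (u % N) = 𝔼 r ∈ units N, φ r := by
  rw [units_sq N]
  refine expect_of_fibers (fun v hv => ?_) hN (fun r hr => card_fiber_mod N hr) φ
  exact mem_units.2 ⟨Nat.mod_lt _ hN, (mem_filter.1 hv).2⟩

/-- Uniform numbers below `B`, reduced modulo `N`, are statistically close to uniform units. -/
theorem abs_expect_mod_sub_le {ι : Type*} [Fintype ι] [DecidableEq ι] {N B : ℕ} (hN : 0 < N)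
    (hB : N ≤ B) {φ : (ι → ℕ) → ℝ} (h0 : ∀ a, 0 ≤ φ a) (h1 : ∀ a, φ a ≤ 1) :
    |𝔼 ω ∈ Fintype.piFinset (fun _ => range B), φ (fun i => ω i % N) -
      𝔼 r ∈ Fintype.piFinset (fun _ => units N), φ r| ≤
      Fintype.card ι * ((N : ℝ) / B + (N - N.totient) / N) := by
  -- `q` counts the complete periods of length N below B. On them, restricted to residues coprime to
  -- N, reduction is exactly uniform.
  set q := B / N with hq
  have hqpos : 0 < q := Nat.div_pos hB hN
  set T := (range (N * q)).filter fun v => (v % N).Coprime N with hT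
  have hmap : ∀ v ∈ T, v % N ∈ units N := fun v hv =>
    mem_units.2 ⟨Nat.mod_lt _ hN, (mem_filter.1 hv).2⟩
  have hcard : T.card = N.totient * q := by
    rw [card_eq_sum_card_fiberwise (f := fun v => v % N) (t := units N) hmap,
      sum_congr rfl fun r hr => card_fiber_mod q hr, sum_const, smul_eq_mul, card_units]
  have hsub : T ⊆ range B := by
    refine (filter_subset _ _).trans ?_
    rw [range_subset_range]
    exact Nat.mul_div_le B N
  have hTne : T.Nonempty := by
    rw [← card_pos, hcard]
    exact Nat.mul_pos (Nat.totient_pos.2 hN) hqpos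
  rw [← expect_pi_of_fibers hmap hqpos (fun r hr => card_fiber_mod q hr) φ]
  refine (abs_expect_sub_expect_le_of_subset (Fintype.piFinset_subset _ _ fun _ => hsub)
    (Fintype.piFinset_nonempty.2 fun _ => hTne) (fun _ => h0 _) fun _ => h1 _).trans ?_
  rw [Fintype.card_piFinset, Fintype.card_piFinset]
  simp only [prod_const, card_univ, card_range, hcard]
  have hBpos : (0 : ℝ) < B := by exact_mod_cast hN.trans_le hB
  have hNpos : (0 : ℝ) < N := by exact_mod_cast hN
  have hφN : (N.totient : ℝ) ≤ N := by exact_mod_cast Nat.totient_le N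
  have hBq : (B : ℝ) - N ≤ N * q := by
    have := Nat.lt_div_mul_add hN (a := B)
    rw [← hq] at this
    have h2 : (B : ℝ) < q * N + N := by exact_mod_cast this
    linarith
  have hqB : (q : ℝ) * N ≤ B := by exact_mod_cast Nat.div_mul_le_self B N
  -- Bernoulli's inequality turns the loss in the product into at most the number of coordinates
  -- times the loss in one.
  have hbern := one_add_mul_le_pow (a := ((N.totient * q : ℕ) : ℝ) / B - 1) (by
    have : (0 : ℝ) ≤ ((N.totient * q : ℕ) : ℝ) / B := by positivity
    linarith) (Fintype.card ι)
  rw [add_sub_cancel, div_pow] at hbern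
  push_cast at hbern ⊢
  -- The loss per coordinate: the incomplete last period, and the residues that are not invertible.
  have hone : 1 - (N.totient * q : ℝ) / B ≤ (N : ℝ) / B + (N - N.totient) / N := by
    rw [sub_le_iff_le_add, div_add_div _ _ hBpos.ne' hNpos.ne', div_add_div _ _ (by positivity)
      hBpos.ne', le_div_iff₀ (by positivity)]
    have : 0 ≤ ((N : ℝ) - N.totient) * (B - q * N) := mul_nonneg (by linarith) (by linarith)
    have h4 : 0 ≤ B * (N * q - (B - N : ℝ)) := mul_nonneg hBpos.le (by linarith)
    nlinarith
  have hm : (0 : ℝ) ≤ Fintype.card ι := by positivity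
  nlinarith [mul_le_mul_of_nonneg_left hone hm]

end Paillier

/-! # Two primes between `n` and `2 n` -/

namespace Nat

/-- If at most one prime lies between `n` and `2 * n`, the central binomial coefficient is small. -/
theorem centralBinom_le_of_unique_prime {n : ℕ} (n_large : 2 < n) {q : ℕ}
    (hq : ∀ p : ℕ, p.Prime → n < p → p ≤ 2 * n → p = q) :
    centralBinom n ≤ (2 * n) ^ sqrt (2 * n) * 4 ^ (2 * n / 3) * (2 * n) := by
  have n_pos : 0 < n := by omega
  have n2_pos : 1 ≤ 2 * n := by omega
  let f x := x ^ n.centralBinom.factorization x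
  have hf1 : ∀ x, f x ≤ 2 * n := fun x => pow_factorization_choose_le (by omega)
  have hfpos : ∀ x, ¬ x.Prime → f x = 1 := fun x hx => by
    simp only [f, factorization_eq_zero_of_not_prime _ hx, _root_.pow_zero]
  let S := {p ∈ Finset.range (2 * n / 3 + 1) | Nat.Prime p}
  have hle : centralBinom n ≤ (∏ x ∈ S, f x) * (2 * n) := by
    -- Primes in (2n/3, n] do not divide the central binomial coefficient, so beyond 2n/3 only the
    -- exceptional prime `q` can contribute, with a factor of at most 2n.
    have hsub : (Finset.range (2 * n + 1)).filter (fun x => f x ≠ 1) ⊆ insert q S := by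
      intro x hx
      obtain ⟨hx1, hx2⟩ := Finset.mem_filter.1 hx
      have hp : x.Prime := by by_contra h; exact hx2 (hfpos x h)
      rw [Finset.mem_insert, Finset.mem_filter, Finset.mem_range]
      by_cases h3 : x ≤ 2 * n / 3
      · exact Or.inr ⟨by omega, hp⟩
      · left
        rw [Finset.mem_range] at hx1
        refine hq x hp ?_ (by omega)
        by_contra hxn
        apply hx2
        simp only [f, factorization_centralBinom_of_two_mul_self_lt_three_mul n_large
          (by omega : x ≤ n) (by omega), _root_.pow_zero]
    have h1 : centralBinom n ≤ ∏ x ∈ insert q S, f x := by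
      rw [← n.prod_pow_factorization_centralBinom, ← Finset.prod_filter_ne_one]
      refine Finset.prod_le_prod_of_subset_of_one_le' hsub fun x _ _ => ?_
      by_cases h : x.Prime
      · exact Nat.pow_pos h.pos
      · exact (hfpos x h).ge
    refine h1.trans ?_
    by_cases h : q ∈ S
    · rw [Finset.insert_eq_of_mem h]
      exact Nat.le_mul_of_pos_right _ (by omega)
    · rw [Finset.prod_insert h, mul_comm]
      exact Nat.mul_le_mul_left _ (hf1 q)
  refine hle.trans (Nat.mul_le_mul_right _ ?_)
  -- Primes up to √(2n) contribute at most 2n each. Larger ones occur with exponent at most 1, so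
  -- their product is bounded by a primorial.
  rw [← Finset.prod_filter_mul_prod_filter_not S (· ≤ sqrt (2 * n))]
  apply mul_le_mul'
  · refine (Finset.prod_le_prod' fun p _ => hf1 p).trans ?_
    have : (Finset.Icc 1 (sqrt (2 * n))).card = sqrt (2 * n) := by rw [card_Icc, Nat.add_sub_cancel]
    rw [Finset.prod_const]
    refine pow_right_mono₀ n2_pos ((Finset.card_le_card fun x hx => ?_).trans this.le)
    obtain ⟨h1, h2⟩ := Finset.mem_filter.1 hx
    exact Finset.mem_Icc.mpr ⟨(Finset.mem_filter.1 h1).2.one_lt.le, h2⟩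
  · refine le_trans ?_ (primorial_le_four_pow (2 * n / 3))
    refine (Finset.prod_le_prod' fun p hp => (?_ : f p ≤ p)).trans ?_
    · obtain ⟨h1, h2⟩ := Finset.mem_filter.1 hp
      refine (pow_right_mono₀ (Finset.mem_filter.1 h1).2.one_lt.le ?_).trans (pow_one p).le
      exact Nat.factorization_choose_le_one (sqrt_lt'.mp <| not_le.1 h2)
    refine Finset.prod_le_prod_of_subset_of_one_le' (Finset.filter_subset _ _) ?_
    exact fun p hp _ => (Finset.mem_filter.1 hp).2.one_lt.le

/-- The comparison of exponents on which the contradiction in `exists_two_primes_two_pow` rests,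
with 2^r close to √n. -/
theorem mul_two_pow_le_two_pow {r : ℕ} (hr : 8 ≤ r) : 12 * r * 2 ^ r + 24 * r ≤ 2 ^ (2 * r) := by
  induction r, hr using Nat.le_induction with
  | base => norm_num
  | succ r hr ih =>
    have h1 : 2 ^ (2 * (r + 1)) = 4 * 2 ^ (2 * r) := by rw [mul_add, pow_add]; ring
    rw [h1, pow_succ]
    have h2 : r + 1 ≤ 2 * r := by omega
    calc 12 * (r + 1) * (2 ^ r * 2) + 24 * (r + 1) ≤
        12 * (2 * r) * (2 ^ r * 2) + 24 * (2 * r) := by gcongr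
      _ ≤ 4 * (12 * r * 2 ^ r + 24 * r) := by
        have : 0 ≤ r * 2 ^ r := Nat.zero_le _
        nlinarith
      _ ≤ _ := Nat.mul_le_mul_left _ ih

/-- Two primes with the same large number of binary digits. -/
theorem exists_two_primes_two_pow {t : ℕ} (ht : 16 ≤ t) : ∃ p q : ℕ, p.Prime ∧ q.Prime ∧ p ≠ q ∧
    2 ^ t < p ∧ p ≤ 2 * 2 ^ t ∧ 2 ^ t < q ∧ q ≤ 2 * 2 ^ t := by
  set n := 2 ^ t with hn
  have hn4 : 2 ^ 16 ≤ n := Nat.pow_le_pow_right (by norm_num) ht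
  obtain ⟨q, hq, hq1, hq2⟩ := exists_prime_lt_and_le_two_mul n (by omega)
  by_contra hcon
  have huniq : ∀ p : ℕ, p.Prime → n < p → p ≤ 2 * n → p = q := fun p hp h1 h2 => by
    by_contra hne
    exact hcon ⟨p, q, hp, hq, hne, h1, h2, hq1, hq2⟩
  have h1 := four_pow_lt_mul_centralBinom n (by omega)
  have h2 := centralBinom_le_of_unique_prime (by omega) huniq
  -- Then t + 1 ≤ 2r ≤ t + 2, so 2^r is an upper bound for √(2n) and 2^(2r) ≤ 4n.
  obtain ⟨r, hr⟩ : ∃ r, r = (t + 2) / 2 := ⟨_, rfl⟩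
  have hsq : sqrt (2 * n) ≤ 2 ^ r := by
    rw [← Nat.sqrt_eq' (2 ^ r), hn, ← pow_succ']
    refine Nat.sqrt_le_sqrt ?_
    rw [← pow_mul]
    exact Nat.pow_le_pow_right (by norm_num) (by omega)
  have h3 : n * ((2 * n) ^ sqrt (2 * n) * 4 ^ (2 * n / 3) * (2 * n)) ≤ 4 ^ n := by
    have e1 : 2 * n = 2 ^ (t + 1) := by rw [hn, pow_succ']
    have e2 : (2 * n) ^ sqrt (2 * n) ≤ 2 ^ ((t + 1) * 2 ^ r) := by
      rw [pow_mul, ← e1]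
      exact Nat.pow_le_pow_right (by omega) hsq
    have e4 : ∀ m, 4 ^ m = 2 ^ (2 * m) := fun m => by rw [pow_mul]; norm_num
    calc n * ((2 * n) ^ sqrt (2 * n) * 4 ^ (2 * n / 3) * (2 * n))
        ≤ 2 ^ t * (2 ^ ((t + 1) * 2 ^ r) * 2 ^ (2 * (2 * n / 3)) * 2 ^ (t + 1)) := by
          rw [← e4, ← e1, ← hn]; gcongr
      _ = 2 ^ (t + ((t + 1) * 2 ^ r + 2 * (2 * n / 3) + (t + 1))) := by simp only [pow_add]
      _ ≤ 2 ^ (2 * n) := by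
          refine Nat.pow_le_pow_right (by norm_num) ?_
          have b1 := mul_two_pow_le_two_pow (r := r) (by omega)
          have b2 : (t + 1) * 2 ^ r ≤ 2 * r * 2 ^ r := Nat.mul_le_mul_right _ (by omega)
          have b3 : 2 ^ (2 * r) ≤ 4 * n := by
            have : 4 * n = 2 ^ (t + 2) := by rw [hn, pow_add]; ring
            rw [this]
            exact Nat.pow_le_pow_right (by norm_num) (by omega)
          have b4 : 12 * r * 2 ^ r = 6 * (2 * r * 2 ^ r) := by ring
          rw [b4] at b1
          omega
      _ = 4 ^ n := (e4 n).symm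
  exact absurd (h1.trans_le (Nat.mul_le_mul_left n h2)) (not_lt.2 h3)

end Nat

/-! ### Existence and size of keys, and sampling of units by 3κ-bit numbers -/

namespace Paillier

open Finset

theorem mem_bitPrimes {κ a : ℕ} : a ∈ bitPrimes κ ↔ a < 2 ^ κ ∧ a.Prime ∧ 2 ^ κ ≤ 2 * a := by
  simp [bitPrimes]

theorem mem_keyPairs {κ : ℕ} {s : ℕ × ℕ} :
    s ∈ keyPairs κ ↔ (s.1 ∈ bitPrimes κ ∧ s.2 ∈ bitPrimes κ) ∧ s.1 ≠ s.2 := by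
  simp [keyPairs]

theorem keyPairs_nonempty {κ : ℕ} (hκ : 17 ≤ κ) : (keyPairs κ).Nonempty := by
  obtain ⟨t, rfl⟩ : ∃ t, κ = t + 1 := ⟨κ - 1, by omega⟩
  obtain ⟨p, q, hp, hq, hne, h1, h2, h3, h4⟩ := Nat.exists_two_primes_two_pow (t := t) (by omega)
  have key : ∀ m : ℕ, m.Prime → 2 ^ t < m → m ≤ 2 * 2 ^ t → m ∈ bitPrimes (t + 1) := by
    intro m hm h1 h2
    refine mem_bitPrimes.2 ⟨?_, hm, by rw [pow_succ]; omega⟩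
    rw [pow_succ']
    -- The upper end 2^(t+1) is excluded, being a proper power and thus not prime.
    refine lt_of_le_of_ne h2 fun h => ?_
    rw [← pow_succ'] at h
    rw [h] at hm
    have := hm.eq_one_of_pow
    omega
  exact ⟨(p, q), mem_keyPairs.2 ⟨⟨key p hp h1 h2, key q hq h3 h4⟩, hne⟩⟩

section Key

variable {κ : ℕ} {s : ℕ × ℕ}

theorem mul_pos_of_mem (hs : s ∈ keyPairs κ) : 0 < s.1 * s.2 := by
  obtain ⟨⟨h1, h2⟩, -⟩ := mem_keyPairs.1 hs
  exact Nat.mul_pos (mem_bitPrimes.1 h1).2.1.pos (mem_bitPrimes.1 h2).2.1.pos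

theorem two_pow_le_of_mem (hs : s ∈ keyPairs κ) : 2 ^ κ ≤ s.1 * s.2 := by
  obtain ⟨⟨h1, h2⟩, -⟩ := mem_keyPairs.1 hs
  have h3 := (mem_bitPrimes.1 h1).2.2
  have h4 := (mem_bitPrimes.1 h2).2.1.two_le
  calc 2 ^ κ ≤ 2 * s.1 := h3
    _ ≤ s.2 * s.1 := Nat.mul_le_mul_right _ h4
    _ = _ := mul_comm _ _

theorem lt_two_pow_of_mem (hs : s ∈ keyPairs κ) : s.1 * s.2 < 2 ^ (2 * κ) := by
  obtain ⟨⟨h1, h2⟩, -⟩ := mem_keyPairs.1 hs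
  rw [two_mul, pow_add]
  exact Nat.mul_lt_mul'' (mem_bitPrimes.1 h1).1 (mem_bitPrimes.1 h2).1

/-- Uniform numbers of `3 κ` bits, reduced modulo `N`, are exponentially close to uniform units. -/
theorem abs_expect_mod_sub_le_of_mem {ι : Type*} [Fintype ι] [DecidableEq ι]
    (hs : s ∈ keyPairs κ) {φ : (ι → ℕ) → ℝ} (h0 : ∀ a, 0 ≤ φ a) (h1 : ∀ a, φ a ≤ 1) :
    |𝔼 ω ∈ Fintype.piFinset (fun _ => range (2 ^ (3 * κ))), φ (fun i => ω i % (s.1 * s.2)) -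
      𝔼 r ∈ Fintype.piFinset (fun _ => units (s.1 * s.2)), φ r| ≤
      (5 * Fintype.card ι) / 2 ^ κ := by
  have hN := mul_pos_of_mem hs
  have hlt := lt_two_pow_of_mem hs
  have hB : s.1 * s.2 ≤ 2 ^ (3 * κ) :=
    hlt.le.trans (Nat.pow_le_pow_right (by norm_num) (by omega))
  refine (abs_expect_mod_sub_le hN hB h0 h1).trans ?_
  obtain ⟨⟨ha, hb⟩, hne⟩ := mem_keyPairs.1 hs
  obtain ⟨-, ha1, ha2⟩ := mem_bitPrimes.1 ha
  obtain ⟨-, hb1, hb2⟩ := mem_bitPrimes.1 hb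
  have hcop : Nat.Coprime s.1 s.2 := (Nat.coprime_primes ha1 hb1).2 hne
  have e1 : ((s.1 * s.2 : ℕ) : ℝ) / (2 ^ (3 * κ) : ℕ) ≤ 1 / 2 ^ κ := by
    have : ((s.1 * s.2 : ℕ) : ℝ) ≤ 2 ^ (2 * κ) := by exact_mod_cast hlt.le
    rw [div_le_div_iff₀ (by positivity) (by positivity)]
    push_cast at *
    calc (s.1 * s.2 : ℝ) * 2 ^ κ ≤ 2 ^ (2 * κ) * 2 ^ κ := by gcongr
      _ = 1 * 2 ^ (3 * κ) := by rw [← pow_add, one_mul]; congr 1; ring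
  -- The proportion of noninvertible residues is below 1/a + 1/b, and both primes are at least
  -- 2^(κ-1).
  have e2 : (((s.1 * s.2 : ℕ) : ℝ) - (s.1 * s.2).totient) / (s.1 * s.2 : ℕ) ≤ 4 / 2 ^ κ := by
    rw [Nat.totient_mul hcop, Nat.totient_prime ha1, Nat.totient_prime hb1]
    have a0 : (0 : ℝ) < s.1 := by exact_mod_cast ha1.pos
    have b0 : (0 : ℝ) < s.2 := by exact_mod_cast hb1.pos
    have a2 : (2 : ℝ) ^ κ ≤ 2 * s.1 := by exact_mod_cast ha2
    have b2 : (2 : ℝ) ^ κ ≤ 2 * s.2 := by exact_mod_cast hb2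
    push_cast [Nat.cast_sub ha1.one_le, Nat.cast_sub hb1.one_le]
    rw [div_le_div_iff₀ (by positivity) (by positivity)]
    nlinarith [mul_le_mul_of_nonneg_left a2 b0.le, mul_le_mul_of_nonneg_left b2 a0.le,
      pow_pos (two_pos : (0 : ℝ) < 2) κ]
  calc (Fintype.card ι : ℝ) * (_ + _) ≤ Fintype.card ι * (1 / 2 ^ κ + 4 / 2 ^ κ) := by gcongr
    _ = _ := by ring

/-! # Homomorphic properties and correctness of the Paillier cryptosystem -/

/-- Since N² = 0, the map x ↦ 1 + xN turns sums into products: the additive homomorphism behind the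
cryptosystem. -/
theorem one_add_mul_mul (N : ℕ) (x y : ZMod (N ^ 2)) :
    (1 + x * (N : ZMod (N ^ 2))) * (1 + y * (N : ZMod (N ^ 2))) =
      1 + (x + y) * (N : ZMod (N ^ 2)) := by
  have : (N : ZMod (N ^ 2)) * N = 0 := by
    rw [← sq, ← Nat.cast_pow, ZMod.natCast_self]
  linear_combination x * y * this

theorem one_add_mul_pow (N : ℕ) (x : ZMod (N ^ 2)) (k : ℕ) :
    (1 + x * (N : ZMod (N ^ 2))) ^ k = 1 + (k : ZMod (N ^ 2)) * x * (N : ZMod (N ^ 2)) := by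
  induction k with
  | zero => simp
  | succ k ih => rw [pow_succ (1 + x * (N : ZMod (N ^ 2))) k, ih, one_add_mul_mul]; push_cast; ring

theorem prod_one_add_mul {ι : Type*} (N : ℕ) (t : Finset ι) (f : ι → ZMod (N ^ 2)) :
    ∏ i ∈ t, (1 + f i * N) = 1 + (∑ i ∈ t, f i) * N := by
  classical
  induction t using Finset.induction_on with
  | empty => simp
  | insert a t ha ih => rw [prod_insert ha, ih, one_add_mul_mul, sum_insert ha]

/-- After multiplication by N only the residue modulo N matters, so plaintexts and scalars may be
reduced before they are used as exponents. -/
theorem val_mul_self {N : ℕ} (hN : 0 < N) (m : ℤ) :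
    (((m : ZMod N).val : ℕ) : ZMod (N ^ 2)) * N = m * N := by
  have : NeZero N := ⟨hN.ne'⟩
  have h1 : (((m : ZMod N).val : ℕ) : ℤ) = m % N := ZMod.val_intCast m
  have h2 : (((m : ZMod N).val : ℕ) : ZMod (N ^ 2)) = ((m % N : ℤ) : ZMod (N ^ 2)) := by
    rw [← h1, Int.cast_natCast]
  have h3 : (N : ZMod (N ^ 2)) * N = 0 := by
    rw [← sq, ← Nat.cast_pow, ZMod.natCast_self]
  rw [h2, Int.emod_def]
  push_cast
  linear_combination (-((m / N : ℤ) : ZMod (N ^ 2))) * h3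

theorem cast_one_add_pow_val {N : ℕ} (hN : 0 < N) (m : ℤ) :
    (((1 + N) ^ (m : ZMod N).val : ℕ) : ZMod (N ^ 2)) = 1 + m * N := by
  have := one_add_mul_pow N 1 (m : ZMod N).val
  push_cast
  rw [one_mul] at this
  rw [this, mul_one, val_mul_self hN]

theorem cast_mod_sq (N x : ℕ) : ((x % N ^ 2 : ℕ) : ZMod (N ^ 2)) = x := ZMod.natCast_mod x (N ^ 2)

theorem cast_enc {N : ℕ} (hN : 0 < N) (m : ℤ) (r : ℕ) :
    (enc N m r : ZMod (N ^ 2)) = (1 + m * N) * (r : ZMod (N ^ 2)) ^ N := by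
  rw [enc, cast_mod_sq, Nat.cast_mul, cast_one_add_pow_val hN, Nat.cast_pow]

theorem cast_enc_zero {N : ℕ} (hN : 0 < N) (r : ℕ) :
    (enc N 0 r : ZMod (N ^ 2)) = (r : ZMod (N ^ 2)) ^ N := by
  simp [cast_enc hN]

/-- The cofactors `b` are arbitrary and undergo the same homomorphic operation. In this form the
statement can be iterated through the aggregator; it serves correctness as well as the splitting of
the aggregated ciphertext. -/
theorem cast_hmul_eq {N : ℕ} (hN : 0 < N) {m n : ℕ} (A : Matrix (Fin m) (Fin n) ℤ)
    {c b : Fin n → ℕ} {v : Fin n → ℤ}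
    (h : ∀ l, (c l : ZMod (N ^ 2)) = (1 + v l * N) * b l) (i : Fin m) :
    (hmul N A c i : ZMod (N ^ 2)) = (1 + ((A *ᵥ v) i : ℤ) * N) * hmul N A b i := by
  simp only [hmul, cast_mod_sq, Nat.cast_prod, Nat.cast_pow, h, mul_pow, one_add_mul_pow,
    prod_mul_distrib]
  congr 1
  rw [prod_one_add_mul, sum_mul, Matrix.mulVec, dotProduct, Int.cast_sum, sum_mul]
  congr 1
  refine sum_congr rfl fun l _ => ?_
  push_cast
  rw [mul_right_comm, val_mul_self hN]
  ring

theorem cast_hsum_eq {N J n : ℕ} {c b : Fin J → Fin n → ℕ} {v : Fin J → Fin n → ℤ}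
    (h : ∀ j l, (c j l : ZMod (N ^ 2)) = (1 + v j l * N) * b j l) (l : Fin n) :
    (hsum N c l : ZMod (N ^ 2)) = (1 + ((∑ j, v j) l : ℤ) * N) * hsum N b l := by
  simp only [hsum, cast_mod_sq, Nat.cast_prod, h, prod_mul_distrib, prod_one_add_mul,
    Finset.sum_apply, Int.cast_sum]

/-- Invertible `N`-th powers modulo `N ^ 2`: the encryptions of `0`. -/
def IsResidue (N : ℕ) (x : ZMod (N ^ 2)) : Prop := ∃ v : ℕ, v.Coprime N ∧ x = (v : ZMod (N ^ 2)) ^ N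

theorem IsResidue.prod {ι : Type*} {N : ℕ} (t : Finset ι) {f : ι → ZMod (N ^ 2)}
    (h : ∀ i ∈ t, IsResidue N (f i)) : IsResidue N (∏ i ∈ t, f i) := by
  choose! v hv hf using h
  refine ⟨∏ i ∈ t, v i, Nat.Coprime.prod_left hv, ?_⟩
  rw [Nat.cast_prod, ← prod_pow]
  exact prod_congr rfl hf

theorem IsResidue.pow {N : ℕ} {x : ZMod (N ^ 2)} (h : IsResidue N x) (k : ℕ) :
    IsResidue N (x ^ k) := by
  obtain ⟨v, hv, rfl⟩ := h
  exact ⟨v ^ k, hv.pow_left k, by rw [Nat.cast_pow, ← pow_mul, ← pow_mul, mul_comm]⟩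

theorem IsResidue.hmul {N m n : ℕ} (A : Matrix (Fin m) (Fin n) ℤ) {c : Fin n → ℕ}
    (h : ∀ l, IsResidue N (c l)) (i : Fin m) : IsResidue N (hmul N A c i) := by
  simp only [Paillier.hmul, cast_mod_sq, Nat.cast_prod, Nat.cast_pow]
  exact .prod _ fun l _ => (h l).pow _

theorem IsResidue.hsum {N J n : ℕ} {c : Fin J → Fin n → ℕ}
    (h : ∀ j l, IsResidue N (c j l)) (l : Fin n) : IsResidue N (hsum N c l) := by
  simp only [Paillier.hsum, cast_mod_sq, Nat.cast_prod]
  exact .prod _ fun j _ => h j l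

theorem isResidue_enc_zero {N r : ℕ} (hr : r ∈ units N) : IsResidue N (enc N 0 r) :=
  have h := mem_units.1 hr
  ⟨r, h.2, cast_enc_zero (by omega) r⟩

/-- The order of the group of units modulo `N ^ 2` divides `N * lcm (a - 1) (b - 1)`. -/
theorem pow_mul_lcm_eq_one (hs : s ∈ keyPairs κ) {v : ℕ} (hv : v.Coprime (s.1 * s.2)) :
    (v : ZMod ((s.1 * s.2) ^ 2)) ^ (s.1 * s.2 * Nat.lcm (s.1 - 1) (s.2 - 1)) = 1 := by
  obtain ⟨⟨ha, hb⟩, hne⟩ := mem_keyPairs.1 hs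
  have ha1 := (mem_bitPrimes.1 ha).2.1
  have hb1 := (mem_bitPrimes.1 hb).2.1
  have hcop : Nat.Coprime s.1 s.2 := (Nat.coprime_primes ha1 hb1).2 hne
  have key : ∀ p : ℕ, p.Prime → v.Coprime p → ∀ k, p * (p - 1) ∣ k → v ^ k ≡ 1 [MOD p ^ 2] := by
    rintro p hp hvp _ ⟨k, rfl⟩
    have := Nat.ModEq.pow_totient (hvp.pow_right 2)
    rw [Nat.totient_prime_pow hp (by norm_num)] at this
    rw [pow_mul]
    simpa using this.pow k
  have h1 := key s.1 ha1 (Nat.Coprime.coprime_mul_right_right hv)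
    (s.1 * s.2 * Nat.lcm (s.1 - 1) (s.2 - 1))
    (Nat.mul_dvd_mul (Dvd.intro _ rfl) (Nat.dvd_lcm_left _ _))
  have h2 := key s.2 hb1 (Nat.Coprime.coprime_mul_left_right hv)
    (s.1 * s.2 * Nat.lcm (s.1 - 1) (s.2 - 1))
    (Nat.mul_dvd_mul (Dvd.intro_left _ rfl) (Nat.dvd_lcm_right _ _))
  -- The congruences modulo the squares of the two primes are combined by the Chinese remainder
  -- theorem.
  have h3 := (Nat.modEq_and_modEq_iff_modEq_mul (hcop.pow 2 2)).1 ⟨h1, h2⟩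
  rw [← mul_pow] at h3
  have h4 := (ZMod.natCast_eq_natCast_iff _ _ _).2 h3
  push_cast at h4 ⊢
  exact h4

/-- Equal bit length gives q < 2p, so p could divide q - 1 only if q = p + 1, which is impossible
for odd primes; the lower bound on κ makes both primes odd. Decryption needs this to invert λ. -/
theorem coprime_lcm (hκ : 3 ≤ κ) (hs : s ∈ keyPairs κ) :
    (Nat.lcm (s.1 - 1) (s.2 - 1)).Coprime (s.1 * s.2) := by
  obtain ⟨⟨ha, hb⟩, hne⟩ := mem_keyPairs.1 hs
  obtain ⟨ha0, ha1, ha2⟩ := mem_bitPrimes.1 ha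
  obtain ⟨hb0, hb1, hb2⟩ := mem_bitPrimes.1 hb
  have h8 : 2 ^ 3 ≤ 2 ^ κ := Nat.pow_le_pow_right (by norm_num) hκ
  have hodda := ha1.eq_two_or_odd
  have hoddb := hb1.eq_two_or_odd
  have key : ∀ p q : ℕ, p.Prime → p % 2 = 1 → q % 2 = 1 → q < 2 * p → 3 ≤ q →
      (q - 1).Coprime p := by
    intro p q hp hp2 hq2 hlt h3
    rw [Nat.coprime_comm, hp.coprime_iff_not_dvd]
    rintro ⟨k, hk⟩
    have : k < 2 := by
      by_contra hk2
      have : p * 2 ≤ p * k := Nat.mul_le_mul_left _ (by omega)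
      omega
    interval_cases k <;> omega
  have hmul : ((s.1 - 1) * (s.2 - 1)).Coprime (s.1 * s.2) := by
    refine Nat.Coprime.mul_left ?_ ?_ <;> refine Nat.Coprime.mul_right ?_ ?_ <;>
      apply key <;> first | assumption | omega
  exact hmul.coprime_dvd_left (Nat.lcm_dvd_mul _ _)

/-- The exponent λ kills the N-th power `x`, and c^λ becomes 1 + mλN; subtracting 1 and dividing by
N and λ returns m modulo N. -/
theorem dec_eq (hκ : 3 ≤ κ) (hs : s ∈ keyPairs κ) {c : ℕ} {m : ℤ} {x : ZMod ((s.1 * s.2) ^ 2)}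
    (hx : IsResidue (s.1 * s.2) x)
    (hc : (c : ZMod ((s.1 * s.2) ^ 2)) = (1 + m * ((s.1 * s.2 : ℕ) : ZMod ((s.1 * s.2) ^ 2))) * x) :
    dec s c = m := by
  obtain ⟨v, hv, rfl⟩ := hx
  have hN := mul_pos_of_mem hs
  have h2 := two_pow_le_of_mem hs
  have hlam := pow_mul_lcm_eq_one hs hv
  have hcop := coprime_lcm hκ hs
  rw [dec]
  generalize Nat.lcm (s.1 - 1) (s.2 - 1) = lam at *
  generalize s.1 * s.2 = N at *
  have : NeZero N := ⟨hN.ne'⟩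
  have hN1 : 1 < N := lt_of_lt_of_le (Nat.one_lt_two_pow (by omega)) h2
  have h3 : ((c ^ lam : ℕ) : ZMod (N ^ 2)) =
      ((1 + (((m * lam : ℤ) : ZMod N).val) * N : ℕ) : ZMod (N ^ 2)) := by
    push_cast
    rw [hc, mul_pow, ← pow_mul, hlam, mul_one, one_add_mul_pow]
    have := val_mul_self hN (m * lam)
    push_cast at this
    rw [this]
    ring
  have h4 := (ZMod.natCast_eq_natCast_iff' _ _ _).1 h3
  set t := (((m * lam : ℤ) : ZMod N).val) with ht
  have htN : t < N := ZMod.val_lt _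
  -- The residue modulo N² is thus literally the number 1 + tN, so truncated subtraction and integer
  -- division are exact.
  have h5 : 1 + t * N < N ^ 2 := by
    calc 1 + t * N < N + t * N := by omega
      _ = (t + 1) * N := by ring
      _ ≤ N ^ 2 := by rw [sq]; exact Nat.mul_le_mul_right _ htN
  rw [Nat.mod_eq_of_lt h5] at h4
  simp only [h4, Nat.add_sub_cancel_left, Nat.mul_div_cancel _ hN]
  rw [ht, ZMod.natCast_zmod_val]
  push_cast
  rw [mul_assoc, ZMod.coe_mul_inv_eq_one _ hcop, mul_one]

theorem decInt_eq (hκ : 3 ≤ κ) (hs : s ∈ keyPairs κ) {c : ℕ} {m : ℤ}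
    {x : ZMod ((s.1 * s.2) ^ 2)} (hx : IsResidue (s.1 * s.2) x)
    (hc : (c : ZMod ((s.1 * s.2) ^ 2)) = (1 + m * ((s.1 * s.2 : ℕ) : ZMod ((s.1 * s.2) ^ 2))) * x)
    (hm : |m| * 2 < 2 ^ κ) : decInt s c = m := by
  have : NeZero (s.1 * s.2) := ⟨(mul_pos_of_mem hs).ne'⟩
  have h2 : (2 : ℤ) ^ κ ≤ (s.1 * s.2 : ℕ) := by exact_mod_cast two_pow_le_of_mem hs
  rw [decInt, dec_eq hκ hs hx hc, ZMod.valMinAbs_spec]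
  refine ⟨rfl, ?_, ?_⟩
  · have := neg_abs_le m; omega
  · have := le_abs_self m; omega

end Key

/-! # Reparametrizations of encryption randomness -/

/-- Numbers congruent modulo N have N-th powers congruent modulo N². Hence a unit modulo N² can
serve as encryption randomness. -/
theorem enc_mod (N : ℕ) (m : ℤ) (r : ℕ) : enc N m (r % N) = enc N m r := by
  rw [enc, enc]
  refine Nat.ModEq.mul_left _ ?_
  have h1 : (N : ℤ) ∣ (r : ℤ) - (r % N : ℕ) := by
    rw [Int.natCast_mod]; exact Int.dvd_self_sub_emod
  have h2 := dvd_sub_pow_of_dvd_sub h1 1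
  rw [pow_one] at h2
  exact (Nat.modEq_iff_dvd.2 (by push_cast at h2 ⊢; exact h2))

theorem mul_pow_mod_eq_enc (N : ℕ) (m : ℤ) (u : ℕ) :
    (1 + N) ^ (m : ZMod N).val * (u ^ N % N ^ 2) % N ^ 2 = enc N m u := by
  rw [enc, Nat.mul_mod_mod]

/-- Multiplication by the unit (1 + N)^k permutes the units modulo N²: a random unit masks the
plaintext completely. -/
theorem expect_units_sq_mul {N : ℕ} (hN : 0 < N) (k : ℕ) (φ : ℕ → ℝ) :
    𝔼 u ∈ units (N ^ 2), φ ((1 + N) ^ k * u % N ^ 2) = 𝔼 u ∈ units (N ^ 2), φ u := by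
  have hN2 : 0 < N ^ 2 := pow_pos hN 2
  have hcop : ((1 + N) ^ k).Coprime (N ^ 2) := by
    refine Nat.Coprime.pow _ _ ?_
    simp
  have hmaps : Set.MapsTo (fun u => (1 + N) ^ k * u % N ^ 2) (units (N ^ 2)) (units (N ^ 2)) := by
    intro u hu
    have hu := mem_units.1 (mem_coe.1 hu)
    refine mem_coe.2 (mem_units.2 ⟨Nat.mod_lt _ hN2, ?_⟩)
    have := Nat.Coprime.mul_left hcop hu.2
    rwa [Nat.Coprime, ← Nat.gcd_rec, Nat.gcd_comm]
  have hinj : Set.InjOn (fun u => (1 + N) ^ k * u % N ^ 2) (units (N ^ 2)) := by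
    intro u hu v hv h
    have hu := mem_units.1 (mem_coe.1 hu)
    have hv := mem_units.1 (mem_coe.1 hv)
    have h' : (1 + N) ^ k * u ≡ (1 + N) ^ k * v [MOD N ^ 2] := h
    have := Nat.ModEq.cancel_left_of_coprime (by rwa [Nat.coprime_comm]  at hcop) h'
    rwa [Nat.ModEq, Nat.mod_eq_of_lt hu.1, Nat.mod_eq_of_lt hv.1] at this
  refine expect_nbij (fun u => (1 + N) ^ k * u % N ^ 2) (fun u hu => hmaps hu) (fun _ _ => rfl)
    hinj (surjOn_of_injOn_of_card_le _ hmaps hinj le_rfl)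

end Paillier

/-! # Exactness of the fixed-point encoding -/

/-- The scaled vector has integer entries. -/
def ExactVec {m : ℕ} (d : ℕ) (v : Fin m → ℚ) : Prop := ∀ i, ∃ z : ℤ, (d : ℚ) * v i = z

/-- The scaled matrix has integer entries. -/
def ExactMat {m l : ℕ} (d : ℕ) (A : Matrix (Fin m) (Fin l) ℚ) : Prop :=
  ∀ i j, ∃ z : ℤ, (d : ℚ) * A i j = z

namespace ExactVec

variable {m l : ℕ} {d e : ℕ} {v w : Fin m → ℚ}

theorem mono (h : ExactVec d v) (hd : d ∣ e) : ExactVec e v := fun i => by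
  obtain ⟨k, rfl⟩ := hd
  obtain ⟨z, hz⟩ := h i
  exact ⟨z * k, by push_cast; rw [← hz]; ring⟩

theorem add (h : ExactVec d v) (h' : ExactVec d w) : ExactVec d (v + w) := fun i => by
  obtain ⟨z, hz⟩ := h i
  obtain ⟨y, hy⟩ := h' i
  exact ⟨z + y, by push_cast; rw [← hz, ← hy, Pi.add_apply]; ring⟩

theorem sub (h : ExactVec d v) (h' : ExactVec d w) : ExactVec d (v - w) := fun i => by
  obtain ⟨z, hz⟩ := h i
  obtain ⟨y, hy⟩ := h' i
  exact ⟨z - y, by push_cast; rw [← hz, ← hy, Pi.sub_apply]; ring⟩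

theorem sum {ι : Type*} (s : Finset ι) {f : ι → Fin m → ℚ} (h : ∀ i ∈ s, ExactVec d (f i)) :
    ExactVec d (∑ i ∈ s, f i) := by
  classical
  induction s using Finset.induction_on with
  | empty => exact fun i => ⟨0, by simp⟩
  | insert a s ha ih =>
    rw [Finset.sum_insert ha]
    exact (h a (by simp)).add (ih fun i hi => h i (by simp [hi]))

theorem cast_mantVec (h : ExactVec d v) (i : Fin m) : (mantVec d v i : ℚ) = d * v i := by
  obtain ⟨z, hz⟩ := h i
  rw [mantVec, hz, Int.floor_intCast]

theorem ofMant_mantVec (h : ExactVec d v) (hd : 0 < d) : ofMant d (mantVec d v) = v := by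
  ext i
  have : (d : ℚ) ≠ 0 := by positivity
  rw [ofMant, h.cast_mantVec, mul_div_cancel_left₀ _ this]

theorem mantVec_sum {ι : Type*} (s : Finset ι) {f : ι → Fin m → ℚ}
    (h : ∀ i ∈ s, ExactVec d (f i)) : mantVec d (∑ i ∈ s, f i) = ∑ i ∈ s, mantVec d (f i) := by
  ext a
  have := (sum s h).cast_mantVec a
  rw [← Int.cast_inj (α := ℚ), this, Finset.sum_apply, Finset.sum_apply, Finset.mul_sum,
    Int.cast_sum]
  exact Finset.sum_congr rfl fun i hi => ((h i hi).cast_mantVec a).symm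

end ExactVec

namespace ExactMat

variable {m l : ℕ} {d e : ℕ} {A : Matrix (Fin m) (Fin l) ℚ} {v : Fin l → ℚ}

theorem mono (h : ExactMat d A) (hd : d ∣ e) : ExactMat e A := fun i j => by
  obtain ⟨k, rfl⟩ := hd
  obtain ⟨z, hz⟩ := h i j
  exact ⟨z * k, by push_cast; rw [← hz]; ring⟩

theorem cast_mantMat (h : ExactMat d A) (i : Fin m) (j : Fin l) :
    (mantMat d A i j : ℚ) = d * A i j := by
  obtain ⟨z, hz⟩ := h i j
  rw [mantMat, Matrix.map_apply, hz, Int.floor_intCast]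

theorem mul_mulVec (h : ExactMat d A) (hv : ExactVec e v) (i : Fin m) :
    ((d * e : ℕ) : ℚ) * (A *ᵥ v) i = ((mantMat d A *ᵥ mantVec e v) i : ℤ) := by
  simp only [Matrix.mulVec, dotProduct, Finset.mul_sum, Int.cast_sum, Int.cast_mul]
  refine Finset.sum_congr rfl fun j _ => ?_
  rw [h.cast_mantMat, hv.cast_mantVec]
  push_cast
  ring

theorem mulVec (h : ExactMat d A) (hv : ExactVec e v) : ExactVec (d * e) (A *ᵥ v) :=
  fun i => ⟨_, h.mul_mulVec hv i⟩

theorem mantVec_mulVec (h : ExactMat d A) (hv : ExactVec e v) :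
    mantVec (d * e) (A *ᵥ v) = mantMat d A *ᵥ mantVec e v := by
  ext i
  rw [← Int.cast_inj (α := ℚ), (h.mulVec hv).cast_mantVec, h.mul_mulVec hv]

end ExactMat

theorem matDen_pos {m l : ℕ} (A : Matrix (Fin m) (Fin l) ℚ) : 0 < matDen A :=
  Finset.prod_pos fun _ _ => Finset.prod_pos fun _ _ => Rat.den_pos _

theorem exactMat_matDen {m l : ℕ} (A : Matrix (Fin m) (Fin l) ℚ) : ExactMat (matDen A) A := by
  intro i j
  obtain ⟨k, hk⟩ : (A i j).den ∣ matDen A :=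
    (Finset.dvd_prod_of_mem (fun j => (A i j).den) (Finset.mem_univ j)).trans
      (Finset.dvd_prod_of_mem (fun i => ∏ j, (A i j).den) (Finset.mem_univ i))
  refine ⟨(A i j).num * k, ?_⟩
  rw [hk]
  push_cast
  rw [mul_right_comm, Rat.den_mul_eq_num]

theorem exactVec_ofMant {m d : ℕ} (hd : 0 < d) (z : Fin m → ℤ) : ExactVec d (ofMant d z) :=
  fun i => ⟨z i, mul_div_cancel₀ _ (by positivity)⟩

theorem mantVec_ofMant {m d : ℕ} (hd : 0 < d) (z : Fin m → ℤ) : mantVec d (ofMant d z) = z := by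
  ext i
  rw [← Int.cast_inj (α := ℚ), (exactVec_ofMant hd z).cast_mantVec, ofMant,
    mul_div_cancel₀ _ (by positivity)]

namespace Model

variable {n p J : ℕ} {I : Fin J → ℕ} {M : Model n p J I}

theorem localDen_pos (hM : M.Valid) (k : ℕ) : 0 < M.localDen k :=
  Nat.mul_pos hM.res_pos (Finset.prod_pos fun _ _ => Finset.prod_pos fun _ _ =>
    Nat.mul_pos (matDen_pos _) (matDen_pos _))

theorem scale_pos (hM : M.Valid) (k : ℕ) : 0 < M.scale k := by
  induction k with
  | zero => exact hM.res_pos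
  | succ k ih =>
    exact Nat.mul_pos (matDen_pos _) (Nat.mul_pos (matDen_pos _) (Nat.mul_pos
      (Finset.prod_pos fun _ _ => matDen_pos _) (Nat.mul_pos (localDen_pos hM k) ih)))

theorem exactMat_invDen (M : Model n p J I) (k : ℕ) (j : Fin J) :
    ExactMat (M.invDen k) (M.groupCov k j)⁻¹ :=
  (exactMat_matDen _).mono (Finset.dvd_prod_of_mem (fun j => matDen (M.groupCov k j)⁻¹)
    (Finset.mem_univ j))

/-- The factor `localDen` contains the measurement resolution and, for each sensor, the denominators
of its gain and of its observation matrix, which clears every summand at once. -/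
theorem exactVec_localUpdate (k : ℕ) (j : Fin J) {x : Fin n → ℚ}
    {y : Fin (I j) → Fin p → ℚ} (hx : ExactVec (M.scale k) x) (hy : ∀ i, ExactVec M.res (y i)) :
    ExactVec (M.localScale k) (M.localUpdate k j x y) := by
  refine (hx.mono (Dvd.intro_left _ rfl)).add (.sum _ fun i _ => ?_)
  have h1 : ExactVec (M.res * (matDen (M.H j i) * M.scale k)) (y i - M.H j i *ᵥ x) :=
    ((hy i).mono (Dvd.intro _ rfl)).sub
      (((exactMat_matDen _).mulVec hx).mono (Dvd.intro_left _ rfl))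
  refine ((exactMat_matDen (M.gain k j i)).mulVec h1).mono ?_
  have h2 : matDen (M.gain k j i) * matDen (M.H j i) ∣
      ∏ j, ∏ i, matDen (M.gain k j i) * matDen (M.H j i) :=
    (Finset.dvd_prod_of_mem (fun i => matDen (M.gain k j i) * matDen (M.H j i))
      (Finset.mem_univ i)).trans (Finset.dvd_prod_of_mem
        (fun j => ∏ i, matDen (M.gain k j i) * matDen (M.H j i)) (Finset.mem_univ j))
  obtain ⟨c, hc⟩ := h2
  refine ⟨c, ?_⟩
  change M.res * (∏ j, ∏ i, matDen (M.gain k j i) * matDen (M.H j i)) * M.scale k = _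
  rw [hc]
  ring

/-- The aggregation of round `k` on plaintext mantissas. -/
noncomputable def aggregateMant (M : Model n p J I) (k : ℕ) (m : Fin J → Fin n → ℤ) : Fin n → ℤ :=
  mantMat (matDen M.F) M.F *ᵥ (mantMat (matDen (M.diffCov k)) (M.diffCov k) *ᵥ
    ∑ j, mantMat (M.invDen k) (M.groupCov k j)⁻¹ *ᵥ m j)

/-- Mantissas of the global estimates of the diffusion Kalman filter. -/
noncomputable def estimateMant (M : Model n p J I) (x : Inputs n p J I) (k : ℕ) : Fin n → ℤ :=
  mantVec (M.scale k) (M.estimate x k)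

/-- Mantissas of the local estimates of the diffusion Kalman filter. -/
noncomputable def localEstimateMant (M : Model n p J I) (x : Inputs n p J I) (k : ℕ) (j : Fin J) :
    Fin n → ℤ :=
  mantVec (M.localScale k) (M.localEstimate x k j)

theorem exactVec_meas (hM : M.Valid) (x : Inputs n p J I) (k : ℕ) (j : Fin J) (i : Fin (I j)) :
    ExactVec M.res (M.meas x k j i) :=
  exactVec_ofMant hM.res_pos _

theorem exactVec_weighted (hM : M.Valid) (x : Inputs n p J I) (k : ℕ)
    (h : ExactVec (M.scale k) (M.estimate x k)) (j : Fin J) :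
    ExactVec (M.invDen k * (M.localDen k * M.scale k))
      ((M.groupCov k j)⁻¹ *ᵥ M.localEstimate x k j) :=
  (exactMat_invDen M k j).mulVec (exactVec_localUpdate k j h (exactVec_meas hM x k j))

theorem exactVec_estimate (hM : M.Valid) (x : Inputs n p J I) (k : ℕ) :
    ExactVec (M.scale k) (M.estimate x k) := by
  induction k with
  | zero => exact exactVec_ofMant hM.res_pos _
  | succ k ih =>
    exact (exactMat_matDen _).mulVec ((exactMat_matDen _).mulVec (.sum _ fun j _ =>
      exactVec_weighted hM x k ih j))

theorem ofMant_estimateMant (hM : M.Valid) (x : Inputs n p J I) (k : ℕ) :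
    ofMant (M.scale k) (M.estimateMant x k) = M.estimate x k :=
  (exactVec_estimate hM x k).ofMant_mantVec (scale_pos hM k)

theorem estimateMant_zero (hM : M.Valid) (x : Inputs n p J I) : M.estimateMant x 0 = x.x₀ :=
  mantVec_ofMant hM.res_pos _

/-- The scales multiply in the order of the aggregator's operations, so at every stage the floor in
the encoding is taken of an integer and commutes with the linear maps. -/
theorem estimateMant_succ (hM : M.Valid) (x : Inputs n p J I) (k : ℕ) :
    M.estimateMant x (k + 1) = M.aggregateMant k (M.localEstimateMant x k) := by
  have h1 := exactVec_weighted hM x k (exactVec_estimate hM x k)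
  have h2 : ExactVec _ (∑ j, (M.groupCov k j)⁻¹ *ᵥ M.localEstimate x k j) :=
    .sum Finset.univ fun j _ => h1 j
  have h3 := (exactMat_matDen (M.diffCov k)).mulVec h2
  have h4 := (exactMat_matDen M.F).mantVec_mulVec h3
  rw [(exactMat_matDen (M.diffCov k)).mantVec_mulVec h2,
    ExactVec.mantVec_sum _ fun j _ => h1 j] at h4
  refine h4.trans ?_
  rw [aggregateMant]
  congr 2
  refine Finset.sum_congr rfl fun j _ => ?_
  exact (exactMat_invDen M k j).mantVec_mulVec
    (exactVec_localUpdate k j (exactVec_estimate hM x k) (exactVec_meas hM x k j))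

theorem localMant_estimateMant (hM : M.Valid) (x : Inputs n p J I) (k : ℕ) (j : Fin J) :
    M.localMant x k (M.estimateMant x k) j = M.localEstimateMant x k j := by
  rw [localMant, ofMant_estimateMant hM]
  rfl

/-! # Correctness of the protocol -/

theorem cast_aggregate {N : ℕ} (hN : 0 < N) (M : Model n p J I) (k : ℕ) {c b : Fin J → Fin n → ℕ}
    {m : Fin J → Fin n → ℤ} (h : ∀ j l, (c j l : ZMod (N ^ 2)) =
      (1 + (m j l : ZMod (N ^ 2)) * (N : ZMod (N ^ 2))) * b j l) (l : Fin n) :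
    (M.aggregate N k c l : ZMod (N ^ 2)) =
      (1 + (M.aggregateMant k m l : ZMod (N ^ 2)) * (N : ZMod (N ^ 2))) * M.aggregate N k b l :=
  Paillier.cast_hmul_eq hN _ (Paillier.cast_hmul_eq hN _ (Paillier.cast_hsum_eq fun j =>
    Paillier.cast_hmul_eq hN _ (h j))) l

theorem cast_enc_eq {N : ℕ} (hN : 0 < N) (m : ℤ) (r : ℕ) : (Paillier.enc N m r : ZMod (N ^ 2)) =
    (1 + (m : ZMod (N ^ 2)) * (N : ZMod (N ^ 2))) * (Paillier.enc N 0 r : ZMod (N ^ 2)) := by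
  rw [Paillier.cast_enc hN, Paillier.cast_enc_zero hN]

theorem isResidue_aggregate {N : ℕ} (M : Model n p J I) (k : ℕ) {b : Fin J → Fin n → ℕ}
    (h : ∀ j l, Paillier.IsResidue N (b j l)) (l : Fin n) :
    Paillier.IsResidue N (M.aggregate N k b l) :=
  .hmul _ (.hmul _ (.hsum fun j => .hmul _ (h j))) l

/-- The aggregated ciphertext is determined by its plaintext and the randomness of the parts. -/
theorem aggregate_enc {N : ℕ} (hN : 0 < N) (M : Model n p J I) (k : ℕ) (m : Fin J → Fin n → ℤ)
    (r : Fin J → Fin n → ℕ) (l : Fin n) :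
    M.aggregate N k (fun j l => Paillier.enc N (m j l) (r j l)) l =
      (1 + N) ^ (M.aggregateMant k m l : ZMod N).val *
        M.aggregate N k (fun j l => Paillier.enc N 0 (r j l)) l % N ^ 2 := by
  have h1 := cast_aggregate hN M k (fun j l => cast_enc_eq hN (m j l) (r j l)) l
  rw [← Paillier.cast_one_add_pow_val hN, ← Nat.cast_mul, ZMod.natCast_eq_natCast_iff'] at h1
  rw [← h1, Nat.mod_eq_of_lt]
  exact Nat.mod_lt _ (by positivity)

/-- For fixed private data, finitely many mantissas occur, with a common bound. Once 2^κ exceeds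
twice that bound, no decryption wraps around, and induction on the rounds shows that the execution
follows the filter. -/
theorem exec_eq_estimateMant (hM : M.Valid) (x : Inputs n p J I) (K : ℕ) :
    ∃ κ₀ : ℕ, ∀ κ ≥ κ₀, ∀ s ∈ Paillier.keyPairs κ, ∀ ρ : ℕ → Fin J → Fin n → ℕ,
      (∀ k < K, ∀ j l, ρ k j l ∈ Paillier.units (s.1 * s.2)) →
        ∀ k ≤ K, M.exec s x ρ k = M.estimateMant x k := by
  set C : ℤ := ∑ k ∈ Finset.range (K + 1), ∑ l, |M.estimateMant x k l| with hC
  have hle : ∀ k ≤ K, ∀ l, |M.estimateMant x k l| ≤ C := fun k hk l =>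
    (Finset.single_le_sum (f := fun l => |M.estimateMant x k l|) (fun _ _ => abs_nonneg _)
      (Finset.mem_univ l)).trans (Finset.single_le_sum
        (f := fun k => ∑ l, |M.estimateMant x k l|)
        (fun _ _ => Finset.sum_nonneg fun _ _ => abs_nonneg _)
        (Finset.mem_range.2 (Nat.lt_succ_of_le hk)))
  -- This gives 2C ≤ κ < 2^κ; the summand 3 supplies the lower bound on κ under which decryption is
  -- correct.
  refine ⟨(2 * C).toNat + 3, fun κ hκ s hs ρ hρ k hk => ?_⟩
  have hN := Paillier.mul_pos_of_mem hs
  induction k with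
  | zero => exact (estimateMant_zero hM x).symm
  | succ k ih =>
    ext l
    rw [exec, ih (by omega)]
    have h1 : M.localCipher (s.1 * s.2) x ρ k (M.estimateMant x k) =
        fun j l => Paillier.enc (s.1 * s.2) (M.localEstimateMant x k j l) (ρ k j l) := by
      ext j l
      rw [localCipher, localMant_estimateMant hM]
    rw [h1]
    refine Paillier.decInt_eq (by omega) hs
      (isResidue_aggregate M k (fun j l => Paillier.isResidue_enc_zero (hρ k (by omega) j l)) l)
      ?_ ?_
    · rw [estimateMant_succ hM]
      exact cast_aggregate hN M k (fun j l => cast_enc_eq hN _ (ρ k j l)) l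
    · have h2 := hle (k + 1) hk l
      have h3 : κ < 2 ^ κ := Nat.lt_two_pow_self
      have h4 : (κ : ℤ) < 2 ^ κ := by exact_mod_cast h3
      omega

theorem mem_units_extend {K N : ℕ} {ρ : Fin K → Fin J → Fin n → ℕ} (hρ : ρ ∈ coinSet J n K N)
    {k : ℕ} (hk : k < K) (j : Fin J) (l : Fin n) : extend ρ k j l ∈ Paillier.units N := by
  simp only [coinSet, Fintype.mem_piFinset] at hρ
  rw [extend, dif_pos hk]
  exact hρ ⟨k, hk⟩ j l

end Model

/-! # Positive definiteness of the covariances -/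

section Cast

variable {m l o : ℕ}

theorem Matrix.mapRat_mul (A : Matrix (Fin m) (Fin l) ℚ) (B : Matrix (Fin l) (Fin o) ℚ) :
    (A * B).map (Rat.cast : ℚ → ℝ) = A.map Rat.cast * B.map Rat.cast :=
  Matrix.map_mul (f := Rat.castHom ℝ)

theorem Matrix.mapRat_add (A B : Matrix (Fin m) (Fin l) ℚ) :
    (A + B).map (Rat.cast : ℚ → ℝ) = A.map Rat.cast + B.map Rat.cast :=
  Matrix.map_add _ (fun a b => Rat.cast_add a b) A B

theorem Matrix.mapRat_sum {ι : Type*} (s : Finset ι) (A : ι → Matrix (Fin m) (Fin l) ℚ) :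
    (∑ i ∈ s, A i).map (Rat.cast : ℚ → ℝ) = ∑ i ∈ s, (A i).map Rat.cast :=
  map_sum (Rat.castHom ℝ).toAddMonoidHom.mapMatrix A s

theorem Matrix.mapRat_det (A : Matrix (Fin m) (Fin m) ℚ) :
    (A.map (Rat.cast : ℚ → ℝ)).det = (A.det : ℝ) :=
  ((Rat.castHom ℝ).map_det A).symm

theorem Matrix.mapRat_inv (A : Matrix (Fin m) (Fin m) ℚ) :
    A⁻¹.map (Rat.cast : ℚ → ℝ) = (A.map Rat.cast)⁻¹ := by
  by_cases h : IsUnit A.det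
  · refine (Matrix.inv_eq_left_inv ?_).symm
    refine (Matrix.mapRat_mul A⁻¹ A).symm.trans ?_
    rw [Matrix.nonsing_inv_mul _ h]
    ext i j
    simp [Matrix.one_apply, apply_ite]
  · have h' : ¬ IsUnit (A.map (Rat.cast : ℚ → ℝ)).det := by
      rw [Matrix.mapRat_det]
      simpa [isUnit_iff_ne_zero] using h
    rw [Matrix.nonsing_inv_apply_not_isUnit _ h, Matrix.nonsing_inv_apply_not_isUnit _ h']
    ext i j
    simp

theorem Matrix.mapRat_mulVec (A : Matrix (Fin m) (Fin l) ℚ) (v : Fin l → ℚ) :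
    (fun i => (((A *ᵥ v) i : ℚ) : ℝ)) = A.map Rat.cast *ᵥ fun i => (v i : ℝ) := by
  ext i
  simp [Matrix.mulVec, dotProduct]

theorem Matrix.PosDef.isUnit_det_of_mapRat {A : Matrix (Fin m) (Fin m) ℚ}
    (h : (A.map (Rat.cast : ℚ → ℝ)).PosDef) : IsUnit A.det := by
  have := (Matrix.isUnit_iff_isUnit_det _).1 h.isUnit
  rw [Matrix.mapRat_det] at this
  simpa [isUnit_iff_ne_zero] using this

/-- A vector on which a semidefinite form vanishes lies in the kernel, which is trivial here. -/
theorem Matrix.PosSemidef.posDef_of_isUnit_det {A : Matrix (Fin m) (Fin m) ℝ}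
    (h : A.PosSemidef) (hu : IsUnit A.det) : A.PosDef := by
  refine .of_dotProduct_mulVec_pos h.1 fun x hx => ?_
  refine lt_of_le_of_ne (h.dotProduct_mulVec_nonneg x) fun h0 => hx ?_
  have h1 := (h.dotProduct_mulVec_zero_iff x).1 h0.symm
  have h2 := congrArg (A⁻¹ *ᵥ ·) h1
  simpa [Matrix.mulVec_mulVec, Matrix.nonsing_inv_mul _ hu] using h2

end Cast

namespace Model

variable {n p J : ℕ} {I : Fin J → ℕ} {M : Model n p J I}

theorem posDef_groupCovOf (hM : M.Valid) (k : ℕ) {P : Matrix (Fin n) (Fin n) ℚ}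
    (hP : (P.map (Rat.cast : ℚ → ℝ)).PosDef) (j : Fin J) :
    ((M.groupCovOf k P j).map (Rat.cast : ℚ → ℝ)).PosDef := by
  rw [groupCovOf, Matrix.mapRat_inv, Matrix.mapRat_add, Matrix.mapRat_sum, Matrix.mapRat_inv]
  refine (hP.inv.add_posSemidef (Matrix.posSemidef_sum _ fun i _ => ?_)).inv
  rw [Matrix.mapRat_mul, Matrix.mapRat_mul, Matrix.mapRat_inv]
  exact (hM.posDef_R j i k).inv.posSemidef.conjTranspose_mul_mul_same _

/-- The recursion by itself preserves only semidefiniteness, since F and Q may be singular; the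
assumed invertibility of the global covariance closes the gap. -/
theorem posDef_cov (hM : M.Valid) (k : ℕ) : ((M.cov k).map (Rat.cast : ℚ → ℝ)).PosDef := by
  induction k with
  | zero => exact hM.posDef_P₀
  | succ k ih =>
    refine Matrix.PosSemidef.posDef_of_isUnit_det ?_ ?_
    · rw [cov, Matrix.mapRat_add, Matrix.mapRat_mul, Matrix.mapRat_mul, Matrix.mapRat_inv,
        Matrix.mapRat_sum]
      refine Matrix.PosSemidef.add ?_ (hM.posSemidef_Q k)
      refine Matrix.PosSemidef.mul_mul_conjTranspose_same
        (Matrix.PosSemidef.inv (Matrix.posSemidef_sum _ fun j _ => ?_)) _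
      rw [Matrix.mapRat_inv]
      exact (posDef_groupCovOf hM k ih j).inv.posSemidef
    · rw [Matrix.mapRat_det]
      simpa [isUnit_iff_ne_zero] using hM.isUnit_cov (k + 1)

theorem posDef_groupCov (hM : M.Valid) (k : ℕ) (j : Fin J) :
    ((M.groupCov k j).map (Rat.cast : ℚ → ℝ)).PosDef :=
  posDef_groupCovOf hM k (posDef_cov hM k) j

/-- The index `j` witnesses that the sum of information matrices is not empty, so that it is
positive definite. -/
theorem isUnit_det_diffCov (hM : M.Valid) (k : ℕ) (j : Fin J) : IsUnit (M.diffCov k).det := by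
  refine Matrix.PosDef.isUnit_det_of_mapRat ?_
  rw [diffCov, Matrix.mapRat_inv, Matrix.mapRat_sum]
  refine Matrix.PosDef.inv (Matrix.posDef_sum ⟨j, Finset.mem_univ j⟩ fun j _ => ?_)
  rw [Matrix.mapRat_inv]
  exact (posDef_groupCov hM k j).inv

/-! # The linear system for the estimates of the non-colluding groups -/

theorem sysMatrix_mulVec (M : Model n p J I) (g : Finset (Fin J)) (k : ℕ)
    (X : {j : Fin J // j ∉ g} × Fin n → ℝ) :
    M.sysMatrix g k *ᵥ X = ∑ j : {j : Fin J // j ∉ g},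
      (M.groupCov k j)⁻¹.map (Rat.cast : ℚ → ℝ) *ᵥ fun l => X (j, l) := by
  ext a
  rw [Finset.sum_apply]
  simp only [Matrix.mulVec, dotProduct, sysMatrix, Fintype.sum_prod_type, Matrix.map_apply]

theorem diffCov_inv_mulVec_diffEstimate (hM : M.Valid) (x : Inputs n p J I) (k : ℕ) (j₀ : Fin J) :
    (M.diffCov k)⁻¹ *ᵥ M.diffEstimate x k =
      ∑ j, (M.groupCov k j)⁻¹ *ᵥ M.localEstimate x k j := by
  rw [diffEstimate, diffuse, Matrix.mulVec_mulVec,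
    Matrix.nonsing_inv_mul _ (isUnit_det_diffCov hM k j₀), Matrix.one_mulVec]

/-- All blocks of the system matrix are invertible. With two groups outside the coalition, the
equation can be solved for one of them whatever value the other takes. -/
theorem underdetermined (hn : 0 < n) (hM : M.Valid) {g : Finset (Fin J)} (hg : 1 < gᶜ.card)
    (x : Inputs n p J I) (k : ℕ) : M.Underdetermined g x k := by
  obtain ⟨j₁, hj₁, j₂, hj₂, hne⟩ := Finset.one_lt_card.1 hg
  rw [Finset.mem_compl] at hj₁ hj₂
  have hD := diffCov_inv_mulVec_diffEstimate hM x k j₁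
  have hDu := isUnit_det_diffCov hM k j₁
  have hest : (fun a => ((M.estimate x (k + 1) a : ℚ) : ℝ)) =
      (M.F * M.diffCov k).map (Rat.cast : ℚ → ℝ) *ᵥ
        fun a => ((((M.diffCov k)⁻¹ *ᵥ M.diffEstimate x k) a : ℚ) : ℝ) := by
    rw [← Matrix.mapRat_mulVec, Matrix.mulVec_mulVec, mul_assoc,
      Matrix.mul_nonsing_inv _ hDu, mul_one]
    rfl
  have hout : ∀ X, M.sysMatrix g k *ᵥ X = M.sysRhs g x k ↔
      (fun a => (((∑ j ∈ g, (M.groupCov k j)⁻¹ *ᵥ M.localEstimate x k j) a : ℚ) : ℝ)) +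
        M.sysMatrix g k *ᵥ X = fun a => ((((M.diffCov k)⁻¹ *ᵥ M.diffEstimate x k) a : ℚ) : ℝ) := by
    intro X
    rw [← eq_sub_iff_add_eq']
    have : M.sysRhs g x k = (fun a => ((((M.diffCov k)⁻¹ *ᵥ M.diffEstimate x k) a : ℚ) : ℝ)) -
        fun a => (((∑ j ∈ g, (M.groupCov k j)⁻¹ *ᵥ M.localEstimate x k j) a : ℚ) : ℝ) := by
      ext a
      simp only [sysRhs, Pi.sub_apply, Rat.cast_sub]
    rw [this]
  have hfree : ∀ (j : {j : Fin J // j ∉ g}) (v : Fin n → ℝ),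
      ∃ X, M.sysMatrix g k *ᵥ X = M.sysRhs g x k ∧ ∀ l, X (j, l) = v l := by
    intro j v
    obtain ⟨i, hi⟩ : ∃ i : {j : Fin J // j ∉ g}, i ≠ j := by
      by_cases h : (⟨j₁, hj₁⟩ : {j : Fin J // j ∉ g}) = j
      · exact ⟨⟨j₂, hj₂⟩, fun h' => hne (congrArg Subtype.val (h.trans h'.symm))⟩
      · exact ⟨_, h⟩
    set A := fun j : {j : Fin J // j ∉ g} => (M.groupCov k j)⁻¹.map (Rat.cast : ℚ → ℝ) with hA
    have hAi : A i * (M.groupCov k i).map (Rat.cast : ℚ → ℝ) = 1 := by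
      simp only [hA, Matrix.mapRat_inv]
      exact Matrix.nonsing_inv_mul _
        ((Matrix.isUnit_iff_isUnit_det _).1 (posDef_groupCov hM k i).isUnit)
    -- `w` is the value of group `i` that compensates for the prescribed value `v` of group `j`, all
    -- remaining groups being set to 0.
    set w : Fin n → ℝ := (M.groupCov k i).map (Rat.cast : ℚ → ℝ) *ᵥ (M.sysRhs g x k - A j *ᵥ v)
      with hw
    refine ⟨fun b => if b.1 = j then v b.2 else if b.1 = i then w b.2 else 0, ?_, by simp⟩
    rw [sysMatrix_mulVec, Finset.sum_eq_add_of_mem j i (Finset.mem_univ _) (Finset.mem_univ _)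
      hi.symm]
    · simp only [if_true, hi, if_false]
      change A j *ᵥ v + A i *ᵥ w = _
      rw [hw, Matrix.mulVec_mulVec, hAi, Matrix.one_mulVec, add_sub_cancel]
    · rintro c - ⟨hcj, hci⟩
      simp only [hcj, hci, if_false]
      exact Matrix.mulVec_zero _
  refine ⟨?_, fun X hX => ?_, fun hF X hX => ?_, ?_, hfree⟩
  · rw [hout, hD, sysMatrix_mulVec]
    ext a
    have h1 : ∀ j, ((M.groupCov k j)⁻¹.map (Rat.cast : ℚ → ℝ) *ᵥ
        fun l => ((M.localEstimate x k j l : ℚ) : ℝ)) a =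
        ((((M.groupCov k j)⁻¹ *ᵥ M.localEstimate x k j) a : ℚ) : ℝ) := fun j =>
      (congrFun (Matrix.mapRat_mulVec (M.groupCov k j)⁻¹ (M.localEstimate x k j)) a).symm
    simp only [Pi.add_apply, Finset.sum_apply, sysUnknown, h1, Rat.cast_sum]
    rw [← Finset.sum_subtype gᶜ (fun j => Finset.mem_compl)
      (fun j => ((((M.groupCov k j)⁻¹ *ᵥ M.localEstimate x k j) a : ℚ) : ℝ))]
    exact Finset.sum_add_sum_compl g _
  · rw [outcome, (hout X).1 hX, hest]
  · rw [hout]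
    rw [outcome, hest] at hX
    have hu : IsUnit ((M.F * M.diffCov k).map (Rat.cast : ℚ → ℝ)).det := by
      rw [Matrix.mapRat_det, Matrix.det_mul]
      have := (hF.mul hDu)
      simpa [isUnit_iff_ne_zero] using this
    exact Matrix.mulVec_injective_of_isUnit ((Matrix.isUnit_iff_isUnit_det _).2 hu) hX
  · let j : {j : Fin J // j ∉ g} := ⟨j₁, hj₁⟩
    -- Constant vectors with different entries t give different solutions, told apart by the
    -- coordinate 0, which exists because n > 0.
    choose X hX hXj using fun t : ℝ => hfree j fun _ => t
    refine (Set.infinite_range_of_injective (f := X) fun t t' h => ?_).mono ?_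
    · rw [← hXj t ⟨0, hn⟩, h, hXj]
    · rintro _ ⟨t, rfl⟩
      exact hX t

end Model

/-! # Polynomial-time evaluation of the protocol -/

namespace PTN

variable {N : Val → ℕ}

theorem ite {h : Val → ℤ} {f g : Val → ℕ} (hh : PTI h) (hf : PTN f) (hg : PTN g) :
    PTN fun x => if 0 < h x then f x else g x :=
  (PTI.ite hh hf hg).congr fun _ => (Nat.cast_ite ..).symm

theorem one_add_pow_mul (hN : PTN N) (h : ∀ x, 0 < N x) {m : Val → ℤ} (hm : PTI m)
    {w : Val → ℕ} (hw : PTN w) :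
    PTN fun x => (1 + N x) ^ (m x : ZMod (N x)).val * w x % N x ^ 2 := by
  have h2 : ∀ x, 0 < N x ^ 2 := fun x => pow_pos (h x) 2
  refine (((powMod ((const 1).add hN) (zmodVal hN hm h) (hN.pow 2) h2).mul hw).mod
    (hN.pow 2)).congr fun x => ?_
  rw [Nat.mod_mul_mod]

theorem enc (hN : PTN N) (h : ∀ x, 0 < N x) {m : Val → ℤ} (hm : PTI m) {r : Val → ℕ}
    (hr : PTN r) : PTN fun x => Paillier.enc (N x) (m x) (r x) := by
  refine (one_add_pow_mul hN h hm
    (powMod hr hN (hN.pow 2) fun x => pow_pos (h x) 2)).congr fun x => ?_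
  rw [Paillier.enc, Nat.mul_mod_mod]

theorem hmul (hN : PTN N) (h : ∀ x, 0 < N x) {m n : ℕ} (A : Matrix (Fin m) (Fin n) ℤ)
    {c : Val → Fin n → ℕ} (hc : ∀ l, PTN fun x => c x l) (i : Fin m) :
    PTN fun x => Paillier.hmul (N x) A (c x) i := by
  refine ((prod Finset.univ fun l _ => powMod (hc l) (zmodVal hN (.const (A i l)) h) (hN.pow 2)
    fun x => pow_pos (h x) 2).mod (hN.pow 2)).congr fun x => ?_
  rw [Paillier.hmul, ← Finset.prod_nat_mod]

theorem hsum (hN : PTN N) {J n : ℕ} {c : Val → Fin J → Fin n → ℕ}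
    (hc : ∀ j l, PTN fun x => c x j l) (l : Fin n) :
    PTN fun x => Paillier.hsum (N x) (c x) l :=
  (prod Finset.univ fun j _ => hc j l).mod (hN.pow 2)

theorem aggregate (hN : PTN N) (h : ∀ x, 0 < N x) {n p J : ℕ} {I : Fin J → ℕ}
    (M : Model n p J I) (k : ℕ) {c : Val → Fin J → Fin n → ℕ}
    (hc : ∀ j l, PTN fun x => c x j l) (l : Fin n) :
    PTN fun x => M.aggregate (N x) k (c x) l :=
  hmul hN h _ (hmul hN h _ (hsum hN fun j => hmul hN h _ (hc j))) l

end PTN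

theorem PT.vec {m : ℕ} {f : Val → Fin m → ℤ} (hf : ∀ i, PTI fun x => f x i) :
    PT fun x => .vec (f x) :=
  PT.ofFn hf

namespace Model

variable {n p J : ℕ} {I : Fin J → ℕ}

/-- The model parameters are constants of the program, so the local update is an affine map with
fixed rational coefficients. -/
theorem pti_localMant (M : Model n p J I) {x : Val → Inputs n p J I}
    (hx : ∀ j i k a, PTI fun v => (x v).y j i k a) {e : Val → Fin n → ℤ}
    (he : ∀ l, PTI fun v => e v l) (k : ℕ) (j : Fin J) (l : Fin n) :
    PTI fun v => M.localMant (x v) k (e v) j l := by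
  have h1 : ∀ l, PTQ fun v => ofMant (M.scale k) (e v) l := fun l => (PTQ.ofInt (he l)).div_nat _
  have h2 : ∀ i a, PTQ fun v => M.meas (x v) k j i a := fun i a =>
    (PTQ.ofInt (hx j i k a)).div_nat _
  refine PTQ.floor (PTQ.const_mul _ ?_)
  simp only [localUpdate, Pi.add_apply, Finset.sum_apply, Matrix.mulVec, dotProduct, Pi.sub_apply]
  exact (h1 l).add (.sum _ fun i _ => .sum _ fun a _ => .const_mul _ ((h2 i a).sub
    (.sum _ fun b _ => .const_mul _ (h1 b))))

/-! # Transcripts -/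

/-- The data from which the views are made: modulus and secret key, measurements, global and
local estimates, ciphertexts of the groups with their randomness, and aggregated ciphertexts. -/
structure Transcript (n p J : ℕ) (I : Fin J → ℕ) : Type where
  modulus : ℕ
  key : ℕ × ℕ
  meas : (j : Fin J) → Fin (I j) → ℕ → Fin p → ℤ
  est : ℕ → Fin n → ℤ
  loc : ℕ → Fin J → Fin n → ℤ
  cipher : ℕ → Fin J → Fin n → ℕ
  coin : ℕ → Fin J → Fin n → ℕ
  sent : ℕ → Fin n → ℕ

/-- The view of a coalition, from a transcript. -/
noncomputable def Transcript.val (T : Transcript n p J I) (M : Model n p J I) (c : Kind) (K L : ℕ)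
    (g : Finset (Fin J)) : Val :=
  .list [M.publicVal K, .nat T.modulus,
    .list ((members g).map fun j => .list [
      rounds K fun k => .list (List.ofFn fun i => .vec (T.meas j i k)),
      rounds L fun k => .pair (.vec (T.est k)) (.mat (M.cov k)),
      rounds K fun k => .list [.vec (T.loc k j), .vec fun l => (T.cipher k j l : ℤ),
        .vec fun l => (T.coin k j l : ℤ)]]),
    match c with
    | .sensor => .int 0
    | .cloud => rounds K fun k => .list
      [.list (List.ofFn fun j => .pair (.vec fun l => (T.cipher k j l : ℤ))
        (.mat (M.groupCov k j))), .vec fun l => (T.sent k l : ℤ), .mat (M.cov (k + 1))]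
    | .query => .list [.nat T.key.1, .nat T.key.2, .vec (T.est 0),
      rounds K fun k => .list [.vec fun l => (T.sent k l : ℤ), .mat (M.cov (k + 1)),
        .vec (T.est (k + 1))]]]

/-- The transcript of the execution. -/
noncomputable def execTranscript (M : Model n p J I) (s : ℕ × ℕ) (x : Inputs n p J I)
    (ρ : ℕ → Fin J → Fin n → ℕ) : Transcript n p J I :=
  ⟨s.1 * s.2, s, x.y, M.exec s x ρ, fun k j => M.localMant x k (M.exec s x ρ k) j,
    M.received s x ρ, ρ, M.sent s x ρ⟩

theorem viewVal_eq (M : Model n p J I) (c : Kind) (K L : ℕ) (g : Finset (Fin J)) (s : ℕ × ℕ)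
    (x : Inputs n p J I) (ρ : ℕ → Fin J → Fin n → ℕ) :
    M.viewVal c K L g s x ρ = (M.execTranscript s x ρ).val M c K L g := by
  cases c <;> rfl

theorem rounds_congr {K : ℕ} {f f' : ℕ → Val} (h : ∀ k < K, f k = f' k) :
    rounds K f = rounds K f' := by
  rw [rounds, rounds, List.map_congr_left fun k hk => h k (List.mem_range.1 hk)]

theorem mem_members {g : Finset (Fin J)} {j : Fin J} : j ∈ members g ↔ j ∈ g := by
  simp [members]

/-- Only what the coalition reads has to agree: data of its own groups, all ciphertexts if it
contains the aggregator, aggregates unless it is a sensor coalition. The query node also reads the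
estimates with numbers 0 to K, whence the condition on `L`. -/
theorem Transcript.val_congr (M : Model n p J I) {c : Kind} {K L : ℕ} {g : Finset (Fin J)}
    (hL : c = .query → K < L) {T T' : Transcript n p J I} (hN : T.modulus = T'.modulus)
    (hkey : c = .query → T.key = T'.key)
    (hmeas : ∀ j ∈ g, ∀ i, ∀ k < K, T.meas j i k = T'.meas j i k)
    (hest : g.Nonempty ∨ c = .query → ∀ k < L, T.est k = T'.est k)
    (hloc : ∀ k < K, ∀ j ∈ g, T.loc k j = T'.loc k j)
    (hcipher : ∀ k < K, ∀ j, j ∈ g ∨ c = .cloud → T.cipher k j = T'.cipher k j)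
    (hcoin : ∀ k < K, ∀ j ∈ g, T.coin k j = T'.coin k j)
    (hsent : c ≠ .sensor → ∀ k < K, T.sent k = T'.sent k) :
    T.val M c K L g = T'.val M c K L g := by
  have h1 : ((members g).map fun j => Val.list [
      rounds K fun k => .list (List.ofFn fun i => .vec (T.meas j i k)),
      rounds L fun k => .pair (.vec (T.est k)) (.mat (M.cov k)),
      rounds K fun k => .list [.vec (T.loc k j), .vec fun l => (T.cipher k j l : ℤ),
        .vec fun l => (T.coin k j l : ℤ)]]) = (members g).map fun j => Val.list [
      rounds K fun k => .list (List.ofFn fun i => .vec (T'.meas j i k)),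
      rounds L fun k => .pair (.vec (T'.est k)) (.mat (M.cov k)),
      rounds K fun k => .list [.vec (T'.loc k j), .vec fun l => (T'.cipher k j l : ℤ),
        .vec fun l => (T'.coin k j l : ℤ)]] := by
    refine List.map_congr_left fun j hj => ?_
    rw [mem_members] at hj
    congr 2
    · exact rounds_congr fun k hk => by simp only [hmeas j hj _ k hk]
    · congr 1
      · exact rounds_congr fun k hk => by rw [hest (.inl ⟨j, hj⟩) k hk]
      · congr 1
        exact rounds_congr fun k hk => by
          rw [hloc k hk j hj, hcipher k hk j (.inl hj), hcoin k hk j hj]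
  unfold Transcript.val
  rw [h1, hN]
  cases c with
  | sensor => rfl
  | cloud =>
    congr 5
    exact rounds_congr fun k hk => by
      simp only [hsent (by simp) k hk, hcipher k hk _ (.inr rfl)]
  | query =>
    have hL := hL rfl
    have hest := hest (.inr rfl)
    simp only [hkey rfl, hest 0 (by omega)]
    congr 10
    exact rounds_congr fun k hk => by
      simp only [hsent (by simp) k hk, hest (k + 1) (by omega)]

theorem pt_transcript_val (M : Model n p J I) (c : Kind) (K L : ℕ) (g : Finset (Fin J))
    {T : Val → Transcript n p J I} (hN : PTN fun v => (T v).modulus)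
    (hkey₁ : PTN fun v => (T v).key.1) (hkey₂ : PTN fun v => (T v).key.2)
    (hmeas : ∀ j i k a, PTI fun v => (T v).meas j i k a)
    (hest : ∀ k l, PTI fun v => (T v).est k l) (hloc : ∀ k j l, PTI fun v => (T v).loc k j l)
    (hcipher : ∀ k j l, PTN fun v => (T v).cipher k j l)
    (hcoin : ∀ k j l, PTN fun v => (T v).coin k j l)
    (hsent : ∀ k l, PTN fun v => (T v).sent k l) :
    PT fun v => (T v).val M c K L g := by
  have nil : PT fun _ => .list [] := .const _
  have hgroups := PT.list (members g) (f := fun j v => .list [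
      rounds K fun k => .list (List.ofFn fun i => .vec ((T v).meas j i k)),
      rounds L fun k => .pair (.vec ((T v).est k)) (.mat (M.cov k)),
      rounds K fun k => .list [.vec ((T v).loc k j), .vec fun l => ((T v).cipher k j l : ℤ),
        .vec fun l => ((T v).coin k j l : ℤ)]]) fun j _ =>
    (PT.rounds K fun k _ => PT.ofFn fun i => PT.vec (hmeas j i k)).pair
      ((PT.rounds L fun k _ => (PT.vec (hest k)).pair (.const _)).pair
        ((PT.rounds K fun k _ => (PT.vec (hloc k j)).pair ((PT.vec (hcipher k j)).pair
          ((PT.vec (hcoin k j)).pair nil))).pair nil))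
  refine (PT.const _).pair (PT.pair hN (hgroups.pair (PT.pair ?_ nil)))
  cases c with
  | sensor => exact .const _
  | cloud =>
    exact PT.rounds K fun k _ => (PT.ofFn fun j => (PT.vec (hcipher k j)).pair (.const _)).pair
      ((PT.vec (hsent k)).pair ((PT.const _).pair nil))
  | query =>
    exact PT.pair hkey₁ (PT.pair hkey₂ ((PT.vec (hest 0)).pair (PT.pair
      (PT.rounds K fun k _ => (PT.vec (hsent k)).pair ((PT.const _).pair
        ((PT.vec (hest (k + 1))).pair nil))) nil)))

/-! # Simulated transcripts -/

/-- A family over rounds, groups and coordinates, extended by a default value to all rounds. -/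
def atIdx {α : Type} {K : ℕ} (f : Fin K × Fin J × Fin n → α) (d : α) : ℕ → Fin J → Fin n → α :=
  fun k j l => if h : k < K then f (⟨k, h⟩, j, l) else d

theorem atIdx_of_lt {α : Type} {K : ℕ} (f : Fin K × Fin J × Fin n → α) (d : α) {k : ℕ}
    (h : k < K) (j : Fin J) (l : Fin n) : atIdx f d k j l = f (⟨k, h⟩, j, l) := dif_pos h

theorem ptn_atIdx {K : ℕ} {f : Val → Fin K × Fin J × Fin n → ℕ} (hf : ∀ i, PTN fun v => f v i)
    (d k : ℕ) (j : Fin J) (l : Fin n) : PTN fun v => atIdx (f v) d k j l := by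
  by_cases h : k < K
  · simp only [atIdx, h, dif_pos]
    exact hf _
  · simp only [atIdx, h, dif_neg, not_false_eq_true]
    exact .const d

/-- The transcript made by the simulator: the estimates of the other groups are replaced by `0`,
and the ciphertext sent to a colluding query node is adapted to the known result. -/
noncomputable def idealTranscript (M : Model n p J I) (c : Kind) (g : Finset (Fin J)) (N : ℕ)
    (key : ℕ × ℕ) (y : (j : Fin J) → Fin (I j) → ℕ → Fin p → ℤ) (est : ℕ → Fin n → ℤ)
    (coin : ℕ → Fin J → Fin n → ℕ) : Transcript n p J I where
  modulus := N
  key := key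
  meas := y
  est := est
  loc k j := M.localMant ⟨0, y⟩ k (est k) j
  cipher k j l :=
    Paillier.enc N (if j ∈ g then M.localMant ⟨0, y⟩ k (est k) j l else 0) (coin k j l)
  coin := coin
  sent k l :=
    if c = .query then
      (1 + N) ^ (est (k + 1) l : ZMod N).val *
        M.aggregate N k (fun j l => Paillier.enc N 0 (coin k j l)) l % N ^ 2
    else M.aggregate N k (fun j l => Paillier.enc N
      (if j ∈ g then M.localMant ⟨0, y⟩ k (est k) j l else 0) (coin k j l)) l

theorem pt_idealTranscript (M : Model n p J I) (c : Kind) (K L : ℕ) (g : Finset (Fin J))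
    {N : Val → ℕ} (hN : PTN N) (hpos : ∀ v, 0 < N v) {key : Val → ℕ × ℕ}
    (hkey₁ : PTN fun v => (key v).1) (hkey₂ : PTN fun v => (key v).2)
    {y : Val → (j : Fin J) → Fin (I j) → ℕ → Fin p → ℤ} (hy : ∀ j i k a, PTI fun v => y v j i k a)
    {est : Val → ℕ → Fin n → ℤ} (hest : ∀ k l, PTI fun v => est v k l)
    {coin : Val → ℕ → Fin J → Fin n → ℕ} (hcoin : ∀ k j l, PTN fun v => coin v k j l) :
    PT fun v => (M.idealTranscript c g (N v) (key v) (y v) (est v) (coin v)).val M c K L g := by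
  have hloc : ∀ k j l, PTI fun v => M.localMant ⟨0, y v⟩ k (est v k) j l := fun k =>
    M.pti_localMant (x := fun v => ⟨0, y v⟩) hy (hest k) k
  have hcipher : ∀ k j l, PTN fun v => Paillier.enc (N v)
      (if j ∈ g then M.localMant ⟨0, y v⟩ k (est v k) j l else 0) (coin v k j l) := by
    intro k j l
    refine PTN.enc hN hpos ?_ (hcoin k j l)
    by_cases hj : j ∈ g
    · simpa only [hj, if_true] using hloc k j l
    · simpa only [hj, if_false] using PTI.const 0
  refine pt_transcript_val M c K L g hN hkey₁ hkey₂ hy hest hloc hcipher hcoin fun k l => ?_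
  by_cases hc : c = .query
  · simp only [idealTranscript, hc, if_true]
    exact PTN.one_add_pow_mul hN hpos (hest (k + 1) l)
      (PTN.aggregate hN hpos M k (fun j l => PTN.enc hN hpos (.const 0) (hcoin k j l)) l)
  · simp only [idealTranscript, hc, if_false]
    exact PTN.aggregate hN hpos M k (hcipher k) l

end Model

open Finset in
/-- The algorithm that applies `D` to the result of a polynomial-time function, which uses `m`
blocks of `3 κ` coins of its own. -/
theorem PPT.exists_acc_precomp (D : PPT) {f : Val → Val} (hf : PT f) (m : ℕ) :
    ∃ A : PPT, ∀ κ x, A.acc κ x = 𝔼 ρ ∈ range ((2 ^ (3 * κ)) ^ m),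
      D.acc κ (f (.pair (.param κ) (.pair x (.nat ρ)))) := by
  obtain ⟨A, hc, ho⟩ := D.exists_precomp hf m
  refine ⟨A, fun κ x => ?_⟩
  have hcoins : 2 ^ A.coins.eval κ = 2 ^ (3 * κ * m) * 2 ^ D.coins.eval κ := by
    rw [← pow_add, hc]
    simp only [Polynomial.eval_add, Polynomial.eval_mul, Polynomial.eval_C, Polynomial.eval_X]
    congr 1
    ring
  rw [acc_eq_expect, hcoins, ← pow_mul]
  simp only [ho, acc_eq_expect]
  exact expect_range_mul (2 ^ (3 * κ * m)) (2 ^ D.coins.eval κ) fun a b =>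
    (PMF.pure (D.out κ (f (.pair (.param κ) (.pair x (.nat a)))) b) (.int 1)).toReal

/-! # Sampling of the encryption randomness by algorithms -/

section Sampling

variable {ι : Type} {m : ℕ}

/-- Residues modulo `N` of the blocks of `3 κ` coins, for inputs of the form `(1^κ, x, ρ)`. -/
def sampled (e : ι ≃ Fin m) (N : ℕ) (v : Val) : ι → ℕ := fun i =>
  v.right.right.toInt.toNat / (v.left.toInt.toNat ^ 3) ^ (e i : ℕ) % v.left.toInt.toNat ^ 3 % N

theorem ptn_sampled (e : ι ≃ Fin m) {N : Val → ℕ} (hN : PTN N) (i : ι) :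
    PTN fun v => sampled e (N v) v i := by
  have hρ : PTN fun v => v.right.right.toInt.toNat := .toNat (.toInt PT.id.right.right)
  have hB : PTN fun v => v.left.toInt.toNat ^ 3 := .pow (.toNat (.toInt PT.id.left)) _
  exact ((hρ.div (hB.pow _)).mod hB).mod hN

theorem sampled_eq (e : ι ≃ Fin m) (N κ : ℕ) (x : Val) (ρ : ℕ) :
    sampled e N (.pair (.param κ) (.pair x (.nat ρ))) =
      fun i => ρ / (2 ^ (3 * κ)) ^ (e i : ℕ) % 2 ^ (3 * κ) % N := by
  have h : (Val.param κ).toInt.toNat = 2 ^ κ := by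
    change ((2 : ℤ) ^ κ).toNat = _
    rw [← Nat.cast_ofNat, ← Nat.cast_pow, Int.toNat_natCast]
  have h2 : (2 ^ κ) ^ 3 = 2 ^ (3 * κ) := by rw [← pow_mul, mul_comm]
  ext i
  simp only [sampled, Val.left, Val.right, h, h2]
  rfl

open Finset Paillier in
theorem abs_expect_sampled_sub_le [Fintype ι] [DecidableEq ι] (e : ι ≃ Fin m) {κ : ℕ} {s : ℕ × ℕ}
    (hs : s ∈ keyPairs κ) (x : Val) {φ : (ι → ℕ) → ℝ} (h0 : ∀ a, 0 ≤ φ a) (h1 : ∀ a, φ a ≤ 1) :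
    |𝔼 ρ ∈ range ((2 ^ (3 * κ)) ^ m),
        φ (sampled e (s.1 * s.2) (.pair (.param κ) (.pair x (.nat ρ)))) -
      𝔼 r ∈ Fintype.piFinset (fun _ => units (s.1 * s.2)), φ r| ≤ (5 * m) / 2 ^ κ := by
  have hm : Fintype.card ι = m := by rw [Fintype.card_congr e, Fintype.card_fin]
  simp only [sampled_eq]
  rw [expect_digits e (2 ^ (3 * κ)) fun ω => φ fun i => ω i % (s.1 * s.2), ← hm]
  exact abs_expect_mod_sub_le_of_mem hs h0 h1

end Sampling

/-- A number read from a datum, made positive. -/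
def posNat (z : ℤ) : ℕ := if 0 < z then z.toNat else 1

theorem posNat_pos (z : ℤ) : 0 < posNat z := by
  rw [posNat]; split_ifs <;> omega

theorem posNat_natCast {N : ℕ} (h : 0 < N) : posNat N = N := by
  rw [posNat, if_pos (by omega), Int.toNat_natCast]

theorem PTN.posNat {f : Val → ℤ} (hf : PTI f) : PTN fun v => posNat (f v) :=
  .ite hf (.toNat hf) (.const 1)

namespace Model

variable {n p J : ℕ} {I : Fin J → ℕ}

open Finset Paillier

/-! # The views as uniform averages -/

theorem expect_coinSet (K N : ℕ) (φ : (ℕ → Fin J → Fin n → ℕ) → ℝ) :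
    𝔼 ρ ∈ coinSet J n K N, φ (extend ρ) =
      𝔼 ω ∈ Fintype.piFinset (fun _ : Fin K × Fin J × Fin n => units N), φ (atIdx ω 1) := by
  refine expect_nbij' (fun ρ i => ρ i.1 i.2.1 i.2.2) (fun ω k j l => ω (k, j, l)) ?_ ?_ ?_ ?_ ?_
  · intro ρ hρ
    simp only [coinSet, Fintype.mem_piFinset] at *
    exact fun i => hρ _ _ _
  · intro ω hω
    simp only [coinSet, Fintype.mem_piFinset] at *
    exact fun k j l => hω _
  · intros; rfl
  · intros; rfl
  · intro ρ _
    congr 1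
    ext k j l
    by_cases h : k < K <;> simp [extend, atIdx, h]

theorem coinSet_nonempty (K : ℕ) {N : ℕ} (hN : 0 < N) : (coinSet J n K N).Nonempty :=
  Fintype.piFinset_nonempty.2 fun _ => Fintype.piFinset_nonempty.2 fun _ =>
    Fintype.piFinset_nonempty.2 fun _ => units_nonempty hN

theorem accept_view (D : PPT) (M : Model n p J I) (c : Kind) (K L : ℕ) (g : Finset (Fin J))
    (x : Inputs n p J I) {κ : ℕ} (hκ : 17 ≤ κ) :
    D.accept κ (M.view c K L g x κ) = 𝔼 s ∈ keyPairs κ,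
      𝔼 ω ∈ Fintype.piFinset (fun _ : Fin K × Fin J × Fin n => units (s.1 * s.2)),
        D.acc κ (M.viewVal c K L g s x (atIdx ω 1)) := by
  rw [view, D.accept_keyGen (keyPairs_nonempty hκ)
    (fun s hs => coinSet_nonempty K (mul_pos_of_mem hs))]
  exact expect_congr rfl fun s _ => expect_coinSet K _ fun ρ => D.acc κ (M.viewVal c K L g s x ρ)

theorem accept_simulated (D S : PPT) (M : Model n p J I) (c : Kind) (K L : ℕ) (g : Finset (Fin J))
    (x : Inputs n p J I) {κ : ℕ} (hκ : 17 ≤ κ) :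
    D.accept κ (M.simulated S c K L g x κ) = 𝔼 s ∈ keyPairs κ,
      𝔼 ρ ∈ range (2 ^ S.coins.eval κ), D.acc κ (S.out κ (M.known c K L g s x) ρ) :=
  D.accept_keyGen (keyPairs_nonempty hκ) (T := fun _ => range (2 ^ S.coins.eval κ))
    (fun _ _ => by simp) 0 fun s => S.out κ (M.known c K L g s x)

/-- The view of a coalition with the estimates of the other groups replaced by `0`. -/
noncomputable def idealVal (M : Model n p J I) (c : Kind) (K L : ℕ) (g : Finset (Fin J))
    (x : Inputs n p J I) (s : ℕ × ℕ) (ω : Fin K × Fin J × Fin n → ℕ) : Val :=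
  (M.idealTranscript c g (s.1 * s.2) s x.y (M.estimateMant x) (atIdx ω 1)).val M c K L g

/-- The ensemble of views with the estimates of the other groups replaced by `0`. -/
noncomputable def ideal (M : Model n p J I) (c : Kind) (K L : ℕ) (g : Finset (Fin J))
    (x : Inputs n p J I) : ℕ → PMF Val :=
  fun κ => (keyGen κ).bind fun s =>
    (unif (Fintype.piFinset fun _ => units (s.1 * s.2)) 1).map (M.idealVal c K L g x s)

theorem piFinset_units_nonempty {ι : Type*} [Fintype ι] [DecidableEq ι] {N : ℕ} (hN : 0 < N) :
    (Fintype.piFinset fun _ : ι => units N).Nonempty :=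
  Fintype.piFinset_nonempty.2 fun _ => units_nonempty hN

theorem accept_ideal (D : PPT) (M : Model n p J I) (c : Kind) (K L : ℕ) (g : Finset (Fin J))
    (x : Inputs n p J I) {κ : ℕ} (hκ : 17 ≤ κ) :
    D.accept κ (M.ideal c K L g x κ) = 𝔼 s ∈ keyPairs κ,
      𝔼 ω ∈ Fintype.piFinset (fun _ => units (s.1 * s.2)), D.acc κ (M.idealVal c K L g x s ω) :=
  D.accept_keyGen (keyPairs_nonempty hκ)
    (T := fun s => Fintype.piFinset fun _ : Fin K × Fin J × Fin n => units (s.1 * s.2))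
    (fun _ hs => piFinset_units_nonempty (mul_pos_of_mem hs)) 1 (M.idealVal c K L g x)

/-! # The simulator -/

/-- The measurements of the groups in `g`, read from the inputs and outputs of the coalition. -/
def readMeas (g : Finset (Fin J)) (v : Val) : (j : Fin J) → Fin (I j) → ℕ → Fin p → ℤ :=
  fun j i k a => (((((v.nth 2).nth ((members g).idxOf j)).nth k).nth i).nth a).toInt

/-- The global estimates, read from the inputs and outputs of the coalition. -/
def readEst (v : Val) : ℕ → Fin n → ℤ := fun k l => (((v.nth 4).nth k).nth l).toInt

/-- The secret key, read from the inputs and outputs of the coalition. -/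
def readKey (v : Val) : ℕ × ℕ := ((v.nth 3).left.toInt.toNat, (v.nth 3).right.toInt.toNat)

theorem nth_rounds {K k : ℕ} (f : ℕ → Val) (hk : k < K) : (rounds K f).nth k = f k := by
  rw [rounds, Val.nth_list _ _ (by simpa using hk)]
  simp

theorem readMeas_known (M : Model n p J I) (c : Kind) (K L : ℕ) (g : Finset (Fin J)) (s : ℕ × ℕ)
    (x : Inputs n p J I) {j : Fin J} (hj : j ∈ g) (i : Fin (I j)) {k : ℕ} (hk : k < K) :
    readMeas g (M.known c K L g s x) j i k = x.y j i k := by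
  ext a
  have h1 : (members g).idxOf j < (members g).length := List.idxOf_lt_length_of_mem (mem_members.2 hj)
  have h2 : ((M.known c K L g s x).nth 2).nth ((members g).idxOf j) = measVal x K j := by
    change Val.nth _ (Val.list ((members g).map (measVal x K))) = _
    rw [Val.nth_list _ _ (by simpa using h1)]
    simp
  rw [readMeas, h2, measVal, nth_rounds _ hk, Val.nth_list _ _ (by simp)]
  simp [Val.nth_vec, Val.toInt]

theorem readEst_known (M : Model n p J I) {c : Kind} (K : ℕ) {L : ℕ} {g : Finset (Fin J)}
    (s : ℕ × ℕ) (x : Inputs n p J I) (h : g.Nonempty ∨ c = .query) {k : ℕ} (hk : k < L) :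
    readEst (M.known c K L g s x) k = M.estimateMant x k := by
  ext l
  have h2 : (M.known c K L g s x).nth 4 = M.outputVal L x := by
    change (if g.Nonempty ∨ c = .query then M.outputVal L x else .int 0) = _
    rw [if_pos h]
  rw [readEst, h2, outputVal, nth_rounds _ hk, Val.nth_vec]
  rfl

theorem readKey_known (M : Model n p J I) (K L : ℕ) (g : Finset (Fin J)) (s : ℕ × ℕ)
    (x : Inputs n p J I) : readKey (M.known .query K L g s x) = s := by
  have h2 : (M.known .query K L g s x).nth 3 = .pair (.nat s.1) (.nat s.2) := rfl
  rw [readKey, h2]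
  rfl

/-- The result of the simulator for the coalition of the groups in `g` with `c`, on inputs of the
form `(1^κ, x, ρ)`. -/
noncomputable def simVal (M : Model n p J I) (c : Kind) (K L : ℕ) (g : Finset (Fin J)) {m : ℕ}
    (e : Fin K × Fin J × Fin n ≃ Fin m) (v : Val) : Val :=
  (M.idealTranscript c g (posNat (v.right.left.nth 1).toInt) (readKey v.right.left)
    (readMeas g v.right.left) (readEst v.right.left)
    (atIdx (sampled e (posNat (v.right.left.nth 1).toInt) v) 1)).val M c K L g

theorem pt_simVal (M : Model n p J I) (c : Kind) (K L : ℕ) (g : Finset (Fin J)) {m : ℕ}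
    (e : Fin K × Fin J × Fin n ≃ Fin m) : PT (M.simVal c K L g e) := by
  have hv : PT fun v => v.right.left := PT.id.right.left
  have hN : PTN fun v => posNat (v.right.left.nth 1).toInt := .posNat (.toInt (hv.nth 1))
  exact pt_idealTranscript M c K L g hN (fun _ => posNat_pos _)
    (.toNat (.toInt (hv.nth 3).left)) (.toNat (.toInt (hv.nth 3).right))
    (fun j i k a => .toInt (((((hv.nth 2).nth _).nth _).nth _).nth _))
    (fun k l => .toInt (((hv.nth 4).nth _).nth _))
    (fun k j l => ptn_atIdx (fun i => ptn_sampled e hN i) 1 k j l)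

/-- The reason why the ideal view can be simulated: it involves private data only through the
coalition's inputs and outputs. The initial state 0 put into the inputs is harmless, since the local
update takes the previous estimate as a separate argument. -/
theorem idealTranscript_val_congr (M : Model n p J I) {c : Kind} {K L : ℕ} {g : Finset (Fin J)}
    (hKL : K ≤ L) (hL : c = .query → K < L) (N : ℕ) {key key' : ℕ × ℕ}
    {y y' : (j : Fin J) → Fin (I j) → ℕ → Fin p → ℤ} {est est' : ℕ → Fin n → ℤ}
    (coin : ℕ → Fin J → Fin n → ℕ) (hkey : c = .query → key = key')
    (hy : ∀ j ∈ g, ∀ i, ∀ k < K, y j i k = y' j i k)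
    (hest : g.Nonempty ∨ c = .query → ∀ k < L, est k = est' k) :
    (M.idealTranscript c g N key y est coin).val M c K L g =
      (M.idealTranscript c g N key' y' est' coin).val M c K L g := by
  have hloc : ∀ k < K, ∀ j ∈ g,
      M.localMant ⟨0, y⟩ k (est k) j = M.localMant ⟨0, y'⟩ k (est' k) j := by
    intro k hk j hj
    have : M.meas ⟨0, y⟩ k j = M.meas ⟨0, y'⟩ k j := by
      ext i a
      simp only [meas, hy j hj i k hk]
    rw [localMant, localMant, this, hest (.inl ⟨j, hj⟩) k (by omega)]
  have hplain : ∀ k < K, ∀ j l, (if j ∈ g then M.localMant ⟨0, y⟩ k (est k) j l else 0) =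
      if j ∈ g then M.localMant ⟨0, y'⟩ k (est' k) j l else 0 := by
    intro k hk j l
    split_ifs with hj
    · rw [hloc k hk j hj]
    · rfl
  refine Transcript.val_congr M hL rfl hkey hy hest hloc ?_ (fun _ _ _ _ => rfl) ?_
  · intro k hk j _
    ext l
    simp only [idealTranscript, hplain k hk]
  · intro _ k hk
    ext l
    by_cases hc : c = .query
    · simp only [idealTranscript, hc, if_true, hest (.inr hc) (k + 1) (by have := hL hc; omega)]
    · simp only [idealTranscript, hc, if_false, hplain k hk]

theorem simVal_known (M : Model n p J I) {c : Kind} {K L : ℕ} (g : Finset (Fin J)) (hKL : K ≤ L)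
    (hL : c = .query → K < L) {m : ℕ} (e : Fin K × Fin J × Fin n ≃ Fin m) {κ : ℕ} {s : ℕ × ℕ}
    (hs : s ∈ keyPairs κ) (x : Inputs n p J I) (ρ : ℕ) :
    M.simVal c K L g e (.pair (.param κ) (.pair (M.known c K L g s x) (.nat ρ))) =
      M.idealVal c K L g x s (sampled e (s.1 * s.2)
        (.pair (.param κ) (.pair (M.known c K L g s x) (.nat ρ)))) := by
  have hN : posNat ((M.known c K L g s x).nth 1).toInt = s.1 * s.2 :=
    posNat_natCast (mul_pos_of_mem hs)
  rw [simVal, idealVal]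
  simp only [Val.right, Val.left, hN]
  refine idealTranscript_val_congr M hKL hL _ _ ?_ (fun j hj i k hk => ?_) fun h k hk => ?_
  · rintro rfl
    exact readKey_known M K L g s x
  · exact readMeas_known M c K L g s x hj i hk
  · exact readEst_known M K s x h hk

/-- The list of the members of a coalition as a datum. -/
def membersCode (g : Finset (Fin J)) : Val := .list ((members g).map fun j => .nat j)

/-- This lets a single program recognize from its input which coalition it has to simulate. -/
theorem membersCode_injective : Function.Injective (membersCode (J := J)) := by
  have h0 : ∀ g : Finset (Fin J),
      membersCode g = Val.list ((members g).map fun j : Fin J => Val.nat (j : ℕ)) := by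
    intro g
    simp only [membersCode, List.bind_eq_flatMap, List.pure_def, ← List.map_eq_flatMap,
      List.map_map, Function.comp_def]
  intro g g' h
  rw [h0, h0] at h
  have h2 : members g = members g' := by
    refine List.map_injective_iff.2 (fun a b hab => ?_) (Val.list_injective h)
    have := Val.int.inj hab
    exact Fin.ext (by exact_mod_cast this)
  ext j
  rw [← mem_members, h2, mem_members]

theorem known_nth_zero (M : Model n p J I) (c : Kind) (K L : ℕ) (g : Finset (Fin J)) (s : ℕ × ℕ)
    (x : Inputs n p J I) : (M.known c K L g s x).nth 0 = membersCode g := rfl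

/-- One polynomial-time function that simulates all coalitions. -/
theorem exists_pt_simVal (M : Model n p J I) (c : Kind) (K L : ℕ) {m : ℕ}
    (e : Fin K × Fin J × Fin n ≃ Fin m) :
    ∃ f : Val → Val, PT f ∧ ∀ (g : Finset (Fin J)) (v : Val),
      v.right.left.nth 0 = membersCode g →
        f v = M.simVal c K L g e v := by
  classical
  -- There are finitely many coalitions, independently of κ; the program is a chain of comparisons
  -- with their codes, built by induction over a set of coalitions.
  suffices h : ∀ G : Finset (Finset (Fin J)), ∃ f : Val → Val, PT f ∧ ∀ g ∈ G, ∀ v : Val,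
      v.right.left.nth 0 = membersCode g →
        f v = M.simVal c K L g e v by
    obtain ⟨f, hf, h⟩ := h univ
    exact ⟨f, hf, fun g => h g (mem_univ g)⟩
  intro G
  induction G using Finset.induction_on with
  | empty => exact ⟨_, PT.id, by simp⟩
  | insert g₀ G _ ih =>
    obtain ⟨f, hf, h⟩ := ih
    refine ⟨_, PT.ite_const (membersCode g₀) (PT.id.right.left.nth 0)
      (pt_simVal M c K L g₀ e) hf, fun g hg v hv => ?_⟩
    by_cases hgg : g = g₀
    · subst hgg
      exact if_pos hv
    · refine (if_neg fun h' => hgg (membersCode_injective (hv.symm.trans h'))).trans ?_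
      exact h g ((mem_insert.1 hg).resolve_left hgg) v hv

/-- The simulator outputs the ideal view with coins sampled from `m` blocks of 3κ bits, one block
for each encryption; the sampling error is the only discrepancy. -/
theorem exists_simulator (M : Model n p J I) (c : Kind) {K L : ℕ} (hKL : K ≤ L)
    (hL : c = .query → K < L) :
    ∃ S : PPT, ∀ g x, CompIndist (M.simulated S c K L g x) (M.ideal c K L g x) := by
  classical
  obtain ⟨m, ⟨e⟩⟩ : ∃ m, Nonempty (Fin K × Fin J × Fin n ≃ Fin m) :=
    ⟨_, ⟨Fintype.equivFin _⟩⟩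
  obtain ⟨f, hf, hfg⟩ := exists_pt_simVal M c K L e
  obtain ⟨S, hc, hS⟩ := exists_ppt hf (Polynomial.C (3 * m) * Polynomial.X)
  refine ⟨S, fun g x => CompIndist.of_bound (5 * m) 17 fun D κ hκ => ?_⟩
  have hcoins : 2 ^ S.coins.eval κ = (2 ^ (3 * κ)) ^ m := by
    rw [hc, ← pow_mul]
    simp only [Polynomial.eval_mul, Polynomial.eval_C, Polynomial.eval_X]
    congr 1
    ring
  rw [accept_simulated D S M c K L g x hκ, accept_ideal D M c K L g x hκ, hcoins]
  refine abs_expect_sub_expect_le (by positivity) fun s hs => ?_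
  have key : ∀ ρ, S.out κ (M.known c K L g s x) ρ = M.idealVal c K L g x s (sampled e (s.1 * s.2)
      (.pair (.param κ) (.pair (M.known c K L g s x) (.nat ρ)))) := fun ρ => by
    rw [hS, hfg g (.pair (.param κ) (.pair (M.known c K L g s x) (.nat ρ)))
      (known_nth_zero M c K L g s x), simVal_known M g hKL hL e hs]
  simp only [key]
  exact abs_expect_sampled_sub_le e hs (M.known c K L g s x)
    (φ := fun ω => D.acc κ (M.idealVal c K L g x s ω)) (fun _ => D.acc_nonneg _ _)
    fun _ => D.acc_le_one _ _

end Model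

namespace Model

variable {n p J : ℕ} {I : Fin J → ℕ} {M : Model n p J I}

open Finset Paillier

/-! # Views with exact estimates -/

theorem atIdx_mem_units {K N : ℕ} {ω : Fin K × Fin J × Fin n → ℕ}
    (hω : ω ∈ Fintype.piFinset fun _ => units N) {k : ℕ} (hk : k < K) (j : Fin J) (l : Fin n) :
    atIdx ω 1 k j l ∈ units N := by
  rw [atIdx_of_lt _ _ hk]
  exact Fintype.mem_piFinset.1 hω _

/-- Without a colluding aggregator, the view does not depend on the estimates of the other
groups. -/
theorem view_compIndist_ideal (hM : M.Valid) {c : Kind} (hc : c ≠ .cloud) {K L : ℕ}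
    (hKL : L ≤ K + 1) (hL : c = .query → K < L) (g : Finset (Fin J)) (x : Inputs n p J I) :
    CompIndist (M.view c K L g x) (M.ideal c K L g x) := by
  obtain ⟨κ₀, h₀⟩ := exec_eq_estimateMant hM x K
  -- The error is 0: for large κ both values coincide for every key and every choice of coins.
  refine CompIndist.of_bound 0 (max 17 κ₀) fun D κ hκ => ?_
  rw [ge_iff_le, max_le_iff] at hκ
  rw [accept_view D M c K L g x hκ.1, accept_ideal D M c K L g x hκ.1, zero_div]
  refine abs_expect_sub_expect_le le_rfl fun s hs => abs_expect_sub_expect_le le_rfl fun ω hω => ?_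
  have hN := mul_pos_of_mem hs
  have hexec := h₀ κ hκ.2 s hs (atIdx ω 1) fun k hk => atIdx_mem_units hω hk
  suffices h : M.viewVal c K L g s x (atIdx ω 1) = M.idealVal c K L g x s ω by
    rw [h, sub_self, abs_zero]
  rw [viewVal_eq, idealVal]
  have hreceived : ∀ k < K, M.received s x (atIdx ω 1) k = fun j l =>
      enc (s.1 * s.2) (M.localMant x k (M.estimateMant x k) j l) (atIdx ω 1 k j l) := by
    intro k hk
    ext j l
    rw [received, localCipher, hexec k hk.le]
  refine Transcript.val_congr M hL rfl (fun _ => rfl) (fun _ _ _ _ _ => rfl)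
    (fun _ k hk => hexec k (by omega)) (fun k hk j _ => ?_) (fun k hk j hj => ?_)
    (fun _ _ _ _ => rfl) fun hcs k hk => ?_
  · simp only [execTranscript, hexec k hk.le]
    rfl
  · ext l
    have hj := hj.resolve_right hc
    simp only [execTranscript, idealTranscript, hreceived k hk, hj, if_true]
    rfl
  -- Here the plaintext factor of the aggregate is split off by `aggregate_enc`; it encodes the next
  -- global estimate, which the query node knows.
  · have hcq : c = .query := by cases c <;> simp_all
    ext l
    simp only [execTranscript, idealTranscript, hcq, if_true]
    have hloc : M.localMant x k (M.estimateMant x k) = M.localEstimateMant x k :=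
      funext fun j => localMant_estimateMant hM x k j
    rw [sent, hreceived k hk, aggregate_enc hN, estimateMant_succ hM, ← hloc]

/-! # Hybrids for a colluding aggregator -/

/-- The view of a cloud coalition, from the ciphertexts and the randomness of the groups. -/
noncomputable def cloudVal (M : Model n p J I) (K L : ℕ) (g : Finset (Fin J)) (x : Inputs n p J I)
    (N : ℕ) (c ω : Fin K × Fin J × Fin n → ℕ) : Val :=
  (⟨N, (0, 0), x.y, M.estimateMant x, M.localEstimateMant x, atIdx c 0, atIdx ω 1,
    fun k => M.aggregate N k (atIdx c 0 k)⟩ : Transcript n p J I).val M .cloud K L g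

theorem pt_cloudVal (M : Model n p J I) (K L : ℕ) (g : Finset (Fin J)) (x : Inputs n p J I)
    {N : Val → ℕ} (hN : PTN N) (hpos : ∀ v, 0 < N v) {c ω : Val → Fin K × Fin J × Fin n → ℕ}
    (hc : ∀ i, PTN fun v => c v i) (hω : ∀ i, PTN fun v => ω v i) :
    PT fun v => M.cloudVal K L g x (N v) (c v) (ω v) :=
  pt_transcript_val M .cloud K L g hN (.const 0) (.const 0) (fun _ _ _ _ => .const _)
    (fun _ _ => .const _) (fun _ _ _ => .const _) (ptn_atIdx hc 0) (ptn_atIdx hω 1)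
    fun k => PTN.aggregate hN hpos M k (ptn_atIdx hc 0 k)

/-- The view shows the coins of colluding groups only. With the ciphertexts held fixed, a foreign
coin may therefore be resampled. -/
theorem cloudVal_update_coin (M : Model n p J I) (K L : ℕ) {g : Finset (Fin J)}
    (x : Inputs n p J I) (N : ℕ) (c ω : Fin K × Fin J × Fin n → ℕ) {i : Fin K × Fin J × Fin n}
    (hi : i.2.1 ∉ g) (r : ℕ) :
    M.cloudVal K L g x N c (Function.update ω i r) = M.cloudVal K L g x N c ω := by
  refine Transcript.val_congr M (by simp) rfl (fun _ => rfl) (fun _ _ _ _ _ => rfl)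
    (fun _ _ _ => rfl) (fun _ _ _ _ => rfl) (fun _ _ _ _ => rfl) (fun k hk j hj => ?_)
    fun _ _ _ => rfl
  ext l
  simp only [atIdx_of_lt _ _ hk]
  rw [Function.update_of_ne]
  rintro rfl
  exact hi hj

/-- Encryptions of the plaintexts `μ`. -/
def encAll {ι : Type} (N : ℕ) (μ : ι → ℤ) (ω : ι → ℕ) : ι → ℕ := fun i => enc N (μ i) (ω i)

/-- The ensemble of views of a cloud coalition with the plaintexts `μ`. -/
noncomputable def hybrid (M : Model n p J I) (K L : ℕ) (g : Finset (Fin J)) (x : Inputs n p J I)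
    (μ : Fin K × Fin J × Fin n → ℤ) : ℕ → PMF Val :=
  fun κ => (keyGen κ).bind fun s => (unif (Fintype.piFinset fun _ => units (s.1 * s.2)) 1).map
    fun ω => M.cloudVal K L g x (s.1 * s.2) (encAll (s.1 * s.2) μ ω) ω

/-- The same with the ciphertext at position `i` replaced by a random unit modulo `N ^ 2`. -/
noncomputable def hybridRandom (M : Model n p J I) (K L : ℕ) (g : Finset (Fin J))
    (x : Inputs n p J I) (μ : Fin K × Fin J × Fin n → ℤ) (i : Fin K × Fin J × Fin n) :
    ℕ → PMF Val :=
  fun κ => (keyGen κ).bind fun s => (unif (units ((s.1 * s.2) ^ 2) ×ˢ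
    Fintype.piFinset fun _ => units (s.1 * s.2)) (1, 1)).map
    fun t => M.cloudVal K L g x (s.1 * s.2)
      (Function.update (encAll (s.1 * s.2) μ t.2) i t.1) t.2

theorem accept_hybrid (D : PPT) (M : Model n p J I) (K L : ℕ) (g : Finset (Fin J))
    (x : Inputs n p J I) (μ : Fin K × Fin J × Fin n → ℤ) {κ : ℕ} (hκ : 17 ≤ κ) :
    D.accept κ (M.hybrid K L g x μ κ) = 𝔼 s ∈ keyPairs κ,
      𝔼 ω ∈ Fintype.piFinset (fun _ => units (s.1 * s.2)),
        D.acc κ (M.cloudVal K L g x (s.1 * s.2) (encAll (s.1 * s.2) μ ω) ω) :=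
  D.accept_keyGen (keyPairs_nonempty hκ)
    (T := fun s => Fintype.piFinset fun _ : Fin K × Fin J × Fin n => units (s.1 * s.2))
    (fun _ hs => piFinset_units_nonempty (mul_pos_of_mem hs)) 1
    fun s ω => M.cloudVal K L g x (s.1 * s.2) (encAll (s.1 * s.2) μ ω) ω

theorem accept_hybridRandom (D : PPT) (M : Model n p J I) (K L : ℕ) (g : Finset (Fin J))
    (x : Inputs n p J I) (μ : Fin K × Fin J × Fin n → ℤ) (i : Fin K × Fin J × Fin n)
    {κ : ℕ} (hκ : 17 ≤ κ) :
    D.accept κ (M.hybridRandom K L g x μ i κ) = 𝔼 s ∈ keyPairs κ,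
      𝔼 u ∈ units ((s.1 * s.2) ^ 2), 𝔼 ω ∈ Fintype.piFinset (fun _ => units (s.1 * s.2)),
        D.acc κ (M.cloudVal K L g x (s.1 * s.2)
          (Function.update (encAll (s.1 * s.2) μ ω) i u) ω) := by
  refine (D.accept_keyGen (keyPairs_nonempty hκ)
    (T := fun s => units ((s.1 * s.2) ^ 2) ×ˢ
      Fintype.piFinset fun _ : Fin K × Fin J × Fin n => units (s.1 * s.2))
    (fun s hs => (units_nonempty (pow_pos (mul_pos_of_mem hs) 2)).product
      (piFinset_units_nonempty (mul_pos_of_mem hs))) (1, 1)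
    fun s t => M.cloudVal K L g x (s.1 * s.2)
      (Function.update (encAll (s.1 * s.2) μ t.2) i t.1) t.2).trans ?_
  exact expect_congr rfl fun s _ => expect_product' _ _ fun u ω => D.acc κ
    (M.cloudVal K L g x (s.1 * s.2) (Function.update (encAll (s.1 * s.2) μ ω) i u) ω)

/-- A uniform unit modulo N² acts through its residue modulo N, which is a fresh uniform coin. The
old coin at `i` is not visible, so exchanging the two does not alter the distribution. -/
theorem expect_cloudVal_enc (D : PPT) (M : Model n p J I) (K L : ℕ) {g : Finset (Fin J)}
    (x : Inputs n p J I) (μ : Fin K × Fin J × Fin n → ℤ) {i : Fin K × Fin J × Fin n}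
    (hi : i.2.1 ∉ g) (κ : ℕ) {N : ℕ} (hN : 0 < N) :
    𝔼 u ∈ units (N ^ 2), 𝔼 ω ∈ Fintype.piFinset (fun _ => units N),
      D.acc κ (M.cloudVal K L g x N (Function.update (encAll N μ ω) i (enc N (μ i) u)) ω) =
    𝔼 ω ∈ Fintype.piFinset (fun _ => units N), D.acc κ (M.cloudVal K L g x N (encAll N μ ω) ω) := by
  rw [expect_comm]
  refine Eq.trans ?_ (expect_update (units_nonempty hN) i
    fun ω => D.acc κ (M.cloudVal K L g x N (encAll N μ ω) ω)).symm
  refine expect_congr rfl fun ω _ => ?_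
  have h2 : ∀ r, Function.update (encAll N μ ω) i (enc N (μ i) r) =
      encAll N μ (Function.update ω i r) := by
    intro r
    ext a
    rcases eq_or_ne a i with rfl | h
    · simp [encAll]
    · simp [encAll, h]
  have h3 := expect_units_sq hN fun r => D.acc κ (M.cloudVal K L g x N
    (Function.update (encAll N μ ω) i (enc N (μ i) r)) ω)
  simp only [enc_mod] at h3
  refine h3.trans (expect_congr rfl fun r _ => ?_)
  rw [h2, cloudVal_update_coin M K L x N _ ω hi]

/-- The view of a cloud coalition in which the ciphertext at position `i` is obtained from a
challenge `w`. -/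
noncomputable def challengeVal (M : Model n p J I) (K L : ℕ) (g : Finset (Fin J))
    (x : Inputs n p J I) (μ : Fin K × Fin J × Fin n → ℤ) (i : Fin K × Fin J × Fin n) (N w : ℕ)
    (ω : Fin K × Fin J × Fin n → ℕ) : Val :=
  M.cloudVal K L g x N
    (Function.update (encAll N μ ω) i ((1 + N) ^ (μ i : ZMod N).val * w % N ^ 2)) ω

/-- The view of a cloud coalition computed from a challenge, on inputs of the form
`(1^κ, (N, w), ρ)`. -/
noncomputable def reductionVal (M : Model n p J I) (K L : ℕ) (g : Finset (Fin J))
    (x : Inputs n p J I) (μ : Fin K × Fin J × Fin n → ℤ) (i : Fin K × Fin J × Fin n) {m : ℕ}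
    (e : Fin K × Fin J × Fin n ≃ Fin m) (v : Val) : Val :=
  M.challengeVal K L g x μ i (posNat v.right.left.left.toInt) v.right.left.right.toInt.toNat
    (sampled e (posNat v.right.left.left.toInt) v)

theorem pt_reductionVal (M : Model n p J I) (K L : ℕ) (g : Finset (Fin J))
    (x : Inputs n p J I) (μ : Fin K × Fin J × Fin n → ℤ) (i : Fin K × Fin J × Fin n) {m : ℕ}
    (e : Fin K × Fin J × Fin n ≃ Fin m) : PT (M.reductionVal K L g x μ i e) := by
  have hw : PTN fun v => v.right.left.right.toInt.toNat := .toNat (.toInt PT.id.right.left.right)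
  have hN : PTN fun v => posNat v.right.left.left.toInt := .posNat (.toInt PT.id.right.left.left)
  have hpos : ∀ v : Val, 0 < posNat v.right.left.left.toInt := fun _ => posNat_pos _
  have hω := ptn_sampled e hN
  refine pt_cloudVal M K L g x hN hpos (fun a => ?_) hω
  rcases eq_or_ne a i with rfl | h
  · simpa only [Function.update_self] using PTN.one_add_pow_mul hN hpos (.const _) hw
  · simpa only [Function.update_of_ne h, encAll] using PTN.enc hN hpos (.const _) (hω a)

theorem reductionVal_eq (M : Model n p J I) (K L : ℕ) (g : Finset (Fin J))
    (x : Inputs n p J I) (μ : Fin K × Fin J × Fin n → ℤ) (i : Fin K × Fin J × Fin n) {m : ℕ}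
    (e : Fin K × Fin J × Fin n ≃ Fin m) (κ : ℕ) {N : ℕ} (hN : 0 < N) (w ρ : ℕ) :
    M.reductionVal K L g x μ i e (.pair (.param κ) (.pair (.pair (.nat N) (.nat w)) (.nat ρ))) =
      M.challengeVal K L g x μ i N w
        (sampled e N (.pair (.param κ) (.pair (.pair (.nat N) (.nat w)) (.nat ρ)))) := by
  have h1 : posNat (Val.nat N).toInt = N := posNat_natCast hN
  have h2 : (Val.nat w).toInt.toNat = w := Int.toNat_natCast w
  rw [reductionVal]
  simp only [Val.right, Val.left, h1, h2]

theorem abs_acc_reduction_sub_le (D A : PPT) (M : Model n p J I) (K L : ℕ) (g : Finset (Fin J))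
    (x : Inputs n p J I) (μ : Fin K × Fin J × Fin n → ℤ) (i : Fin K × Fin J × Fin n) {m : ℕ}
    (e : Fin K × Fin J × Fin n ≃ Fin m)
    (hA : ∀ κ x', A.acc κ x' = 𝔼 ρ ∈ range ((2 ^ (3 * κ)) ^ m),
      D.acc κ (M.reductionVal K L g x μ i e (.pair (.param κ) (.pair x' (.nat ρ)))))
    {κ : ℕ} {s : ℕ × ℕ} (hs : s ∈ keyPairs κ) (w : ℕ) :
    |A.acc κ (.pair (.nat (s.1 * s.2)) (.nat w)) -
      𝔼 ω ∈ Fintype.piFinset (fun _ => units (s.1 * s.2)),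
        D.acc κ (M.challengeVal K L g x μ i (s.1 * s.2) w ω)| ≤ 5 * m / 2 ^ κ := by
  rw [hA]
  simp only [reductionVal_eq M K L g x μ i e κ (mul_pos_of_mem hs)]
  exact abs_expect_sampled_sub_le e hs (.pair (.nat (s.1 * s.2)) (.nat w))
    (φ := fun ω => D.acc κ (M.challengeVal K L g x μ i (s.1 * s.2) w ω))
    (fun _ => D.acc_nonneg _ _) fun _ => D.acc_le_one _ _

theorem accept_challenge (A : PPT) (W : ℕ × ℕ → ℕ → ℕ) {κ : ℕ} (hκ : 17 ≤ κ) :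
    A.accept κ ((keyGen κ).bind fun s => (unif (units ((s.1 * s.2) ^ 2)) 1).map fun u =>
      Val.pair (.nat (s.1 * s.2)) (.nat (W s u))) = 𝔼 s ∈ keyPairs κ,
        𝔼 u ∈ units ((s.1 * s.2) ^ 2), A.acc κ (.pair (.nat (s.1 * s.2)) (.nat (W s u))) :=
  A.accept_keyGen (keyPairs_nonempty hκ) (T := fun s => units ((s.1 * s.2) ^ 2))
    (fun _ hs => units_nonempty (pow_pos (mul_pos_of_mem hs) 2)) 1
    fun s u => Val.pair (.nat (s.1 * s.2)) (.nat (W s u))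

/-- The first case of the reduction: when the challenge is an N-th power, the planted ciphertext is
a genuine encryption of `μ i`. -/
theorem expect_challengeVal_pow (D : PPT) (M : Model n p J I) (K L : ℕ) {g : Finset (Fin J)}
    (x : Inputs n p J I) (μ : Fin K × Fin J × Fin n → ℤ) {i : Fin K × Fin J × Fin n}
    (hi : i.2.1 ∉ g) (κ : ℕ) {N : ℕ} (hN : 0 < N) :
    𝔼 u ∈ units (N ^ 2), 𝔼 ω ∈ Fintype.piFinset (fun _ => units N),
      D.acc κ (M.challengeVal K L g x μ i N (u ^ N % N ^ 2) ω) =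
    𝔼 ω ∈ Fintype.piFinset (fun _ => units N),
      D.acc κ (M.cloudVal K L g x N (encAll N μ ω) ω) := by
  simp only [challengeVal, mul_pow_mod_eq_enc]
  exact expect_cloudVal_enc D M K L x μ hi κ hN

/-- The second case of the reduction: when the challenge is a random unit, the plaintext factor is
absorbed by it. -/
theorem expect_challengeVal (D : PPT) (M : Model n p J I) (K L : ℕ) (g : Finset (Fin J))
    (x : Inputs n p J I) (μ : Fin K × Fin J × Fin n → ℤ) (i : Fin K × Fin J × Fin n) (κ : ℕ)
    {N : ℕ} (hN : 0 < N) :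
    𝔼 w ∈ units (N ^ 2), 𝔼 ω ∈ Fintype.piFinset (fun _ => units N),
      D.acc κ (M.challengeVal K L g x μ i N w ω) =
    𝔼 u ∈ units (N ^ 2), 𝔼 ω ∈ Fintype.piFinset (fun _ => units N),
      D.acc κ (M.cloudVal K L g x N (Function.update (encAll N μ ω) i u) ω) :=
  expect_units_sq_mul hN (μ i : ZMod N).val fun u =>
    𝔼 ω ∈ Fintype.piFinset (fun _ => units N),
      D.acc κ (M.cloudVal K L g x N (Function.update (encAll N μ ω) i u) ω)

/-- The challenge is planted at position `i` and all other ciphertexts are produced with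
self-sampled coins; the plaintexts and private data are constants of the reduction. A distinguisher
of the two views would break the residuosity assumption up to the sampling error. -/
theorem hybrid_compIndist_hybridRandom (hDCRA : DCRA) (M : Model n p J I) (K L : ℕ)
    {g : Finset (Fin J)} (x : Inputs n p J I) (μ : Fin K × Fin J × Fin n → ℤ)
    {i : Fin K × Fin J × Fin n} (hi : i.2.1 ∉ g) :
    CompIndist (M.hybrid K L g x μ) (M.hybridRandom K L g x μ i) := by
  obtain ⟨m, ⟨e⟩⟩ : ∃ m, Nonempty (Fin K × Fin J × Fin n ≃ Fin m) :=
    ⟨_, ⟨Fintype.equivFin _⟩⟩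
  refine CompIndist.of_reduction hDCRA fun D => ?_
  obtain ⟨A, hA⟩ := D.exists_acc_precomp (pt_reductionVal M K L g x μ i e) m
  refine ⟨A, 5 * m, 17, fun κ hκ => ⟨?_, ?_⟩⟩
  · rw [accept_hybrid D M K L g x μ hκ, abs_sub_comm,
      accept_challenge A (fun s u => u ^ (s.1 * s.2) % (s.1 * s.2) ^ 2) hκ]
    refine abs_expect_sub_expect_le (by positivity) fun s hs => ?_
    rw [← expect_challengeVal_pow D M K L x μ hi κ (mul_pos_of_mem hs)]
    exact abs_expect_sub_expect_le (by positivity) fun u _ =>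
      abs_acc_reduction_sub_le D A M K L g x μ i e hA hs _
  · rw [accept_hybridRandom D M K L g x μ i hκ, abs_sub_comm,
      accept_challenge A (fun _ u => u) hκ]
    refine abs_expect_sub_expect_le (by positivity) fun s hs => ?_
    rw [← expect_challengeVal D M K L g x μ i κ (mul_pos_of_mem hs)]
    exact abs_expect_sub_expect_le (by positivity) fun u _ =>
      abs_acc_reduction_sub_le D A M K L g x μ i e hA hs u

/-- The intermediate view with a random unit at position `i` does not depend on the plaintext there,
so it can be reached from both sides. -/
theorem hybrid_compIndist_update (hDCRA : DCRA) (M : Model n p J I) (K L : ℕ)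
    {g : Finset (Fin J)} (x : Inputs n p J I) (μ : Fin K × Fin J × Fin n → ℤ)
    {i : Fin K × Fin J × Fin n} (hi : i.2.1 ∉ g) (z : ℤ) :
    CompIndist (M.hybrid K L g x μ) (M.hybrid K L g x (Function.update μ i z)) := by
  have h : M.hybridRandom K L g x μ i = M.hybridRandom K L g x (Function.update μ i z) i := by
    have : ∀ (N : ℕ) (ω : Fin K × Fin J × Fin n → ℕ) (u : ℕ),
        Function.update (encAll N μ ω) i u =
          Function.update (encAll N (Function.update μ i z) ω) i u := by
      intro N ω u
      ext a
      rcases eq_or_ne a i with rfl | h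
      · simp
      · simp [encAll, h]
    unfold hybridRandom
    simp only [← this]
  exact (hybrid_compIndist_hybridRandom hDCRA M K L x μ hi).trans
    (h ▸ (hybrid_compIndist_hybridRandom hDCRA M K L x _ hi).symm)

/-- Foreign positions are changed one after another. Their number is fixed as κ grows, so plain
transitivity suffices and no uniform bound over the hybrids is required. -/
theorem hybrid_compIndist (hDCRA : DCRA) (M : Model n p J I) (K L : ℕ)
    {g : Finset (Fin J)} (x : Inputs n p J I) (μ μ' : Fin K × Fin J × Fin n → ℤ)
    (h : ∀ i, i.2.1 ∈ g → μ i = μ' i) :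
    CompIndist (M.hybrid K L g x μ) (M.hybrid K L g x μ') := by
  suffices H : ∀ t : Finset (Fin K × Fin J × Fin n), (∀ i ∈ t, i.2.1 ∉ g) →
      CompIndist (M.hybrid K L g x μ) (M.hybrid K L g x fun i => if i ∈ t then μ' i else μ i) by
    convert H (univ.filter fun i => i.2.1 ∉ g) (by simp) using 2
    ext i
    by_cases hi : i.2.1 ∈ g <;> simp [hi, h]
  intro t
  induction t using Finset.induction_on with
  | empty => intro _; simpa using CompIndist.refl _
  | insert a t ha ih =>
    intro hg
    refine (ih fun i hi => hg i (mem_insert_of_mem hi)).trans ?_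
    convert hybrid_compIndist_update hDCRA M K L x _ (hg a (mem_insert_self a t)) (μ' a) using 2
    ext i
    rcases eq_or_ne i a with rfl | hi
    · simp
    · simp [hi]

/-- A cloud coalition cannot detect that the estimates of the other groups are replaced by `0`. -/
theorem view_cloud_compIndist_ideal (hDCRA : DCRA) (hM : M.Valid) {K L : ℕ} (hKL : L ≤ K + 1)
    (g : Finset (Fin J)) (x : Inputs n p J I) :
    CompIndist (M.view .cloud K L g x) (M.ideal .cloud K L g x) := by
  set μ : Fin K × Fin J × Fin n → ℤ := fun i => M.localEstimateMant x i.1 i.2.1 i.2.2 with hμ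
  have hview : CompIndist (M.view .cloud K L g x) (M.hybrid K L g x μ) := by
    obtain ⟨κ₀, h₀⟩ := exec_eq_estimateMant hM x K
    refine CompIndist.of_bound 0 (max 17 κ₀) fun D κ hκ => ?_
    rw [ge_iff_le, max_le_iff] at hκ
    rw [accept_view D M .cloud K L g x hκ.1, accept_hybrid D M K L g x μ hκ.1, zero_div]
    refine abs_expect_sub_expect_le le_rfl fun s hs =>
      abs_expect_sub_expect_le le_rfl fun ω hω => ?_
    have hexec := h₀ κ hκ.2 s hs (atIdx ω 1) fun k hk => atIdx_mem_units hω hk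
    suffices h : M.viewVal .cloud K L g s x (atIdx ω 1) =
        M.cloudVal K L g x (s.1 * s.2) (encAll (s.1 * s.2) μ ω) ω by
      rw [h, sub_self, abs_zero]
    rw [viewVal_eq]
    have hreceived : ∀ k < K, M.received s x (atIdx ω 1) k =
        atIdx (encAll (s.1 * s.2) μ ω) 0 k := by
      intro k hk
      ext j l
      rw [received, localCipher, hexec k hk.le, localMant_estimateMant hM, atIdx_of_lt _ _ hk,
        atIdx_of_lt _ _ hk]
      rfl
    refine Transcript.val_congr M (by simp) rfl (by simp) (fun _ _ _ _ _ => rfl)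
      (fun _ k hk => hexec k (by omega)) (fun k hk j _ => ?_) (fun k hk j _ => ?_)
      (fun _ _ _ _ => rfl) fun _ k hk => ?_
    · simp only [execTranscript, hexec k hk.le, localMant_estimateMant hM]
    · simp only [execTranscript, hreceived k hk]
    · simp only [execTranscript, sent, hreceived k hk]
  -- With foreign plaintexts 0 the hybrid is the ideal view itself; the different default values of
  -- the index extensions concern only rounds that are never read.
  have hideal : CompIndist
      (M.hybrid K L g x fun i => if i.2.1 ∈ g then μ i else 0) (M.ideal .cloud K L g x) := by
    refine CompIndist.of_bound 0 17 fun D κ hκ => ?_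
    rw [accept_ideal D M .cloud K L g x hκ, accept_hybrid D M K L g x _ hκ, zero_div]
    refine abs_expect_sub_expect_le le_rfl fun s hs =>
      abs_expect_sub_expect_le le_rfl fun ω hω => ?_
    suffices h : M.cloudVal K L g x (s.1 * s.2)
        (encAll (s.1 * s.2) (fun i => if i.2.1 ∈ g then μ i else 0) ω) ω =
          M.idealVal .cloud K L g x s ω by
      rw [h, sub_self, abs_zero]
    have hloc : ∀ k j, M.localMant ⟨0, x.y⟩ k (M.estimateMant x k) j =
        M.localEstimateMant x k j := fun k j => localMant_estimateMant hM x k j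
    have hcipher : ∀ k < K,
        atIdx (encAll (s.1 * s.2) (fun i => if i.2.1 ∈ g then μ i else 0) ω) 0 k = fun j l =>
          enc (s.1 * s.2) (if j ∈ g then M.localEstimateMant x k j l else 0)
            (atIdx ω 1 k j l) := by
      intro k hk
      ext j l
      rw [atIdx_of_lt _ _ hk, atIdx_of_lt _ _ hk]
      rfl
    refine Transcript.val_congr M (by simp) rfl (by simp) (fun _ _ _ _ _ => rfl)
      (fun _ k hk => rfl) (fun k hk j _ => ?_) (fun k hk j _ => ?_)
      (fun _ _ _ _ => rfl) fun _ k hk => ?_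
    · simp only [idealTranscript, hloc]
    · simp only [idealTranscript, hloc, hcipher k hk]
    · simp only [idealTranscript, hloc, hcipher k hk, reduceCtorEq, if_false]
  refine hview.trans ((hybrid_compIndist hDCRA M K L x _ _ fun i hi => ?_).trans hideal)
  simp [hi]

/-! # Privacy -/

theorem known_congr (M : Model n p J I) {c : Kind} {K L : ℕ} {g : Finset (Fin J)} (s : ℕ × ℕ)
    {x x' : Inputs n p J I} (h : M.Agree c K L g x x') :
    M.known c K L g s x = M.known c K L g s x' := by
  have h1 : (members g).map (measVal x K) = (members g).map (measVal x' K) := by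
    refine List.map_congr_left fun j hj => rounds_congr fun k hk => ?_
    simp only [h.1 j (mem_members.1 hj) _ k hk]
  have h2 : (if g.Nonempty ∨ c = .query then M.outputVal L x else .int 0) =
      if g.Nonempty ∨ c = .query then M.outputVal L x' else .int 0 := by
    split_ifs with hc
    · exact rounds_congr fun k hk => by rw [h.2 hc k hk]
    · rfl
  rw [known, known, h1, h2]

/-- Two inputs on which the coalition's knowledge agrees give identical simulated ensembles, and
each real view is indistinguishable from its simulation; so the second requirement follows from the
first by transitivity. -/
theorem privateAgainst_of_ideal (M : Model n p J I) {c : Kind} {K L : ℕ}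
    (ok : Finset (Fin J) → Prop) (hKL : K ≤ L) (hL : c = .query → K < L)
    (h : ∀ g x, CompIndist (M.view c K L g x) (M.ideal c K L g x)) :
    M.PrivateAgainst c K L ok := by
  obtain ⟨S, hS⟩ := exists_simulator M c hKL hL
  have hsim : ∀ g x, CompIndist (M.simulated S c K L g x) (M.view c K L g x) := fun g x =>
    (hS g x).trans (h g x).symm
  refine ⟨⟨S, fun g _ x => hsim g x⟩, fun g _ x x' hxx' => ?_⟩
  have heq : M.simulated S c K L g x = M.simulated S c K L g x' := by
    unfold simulated
    simp only [known_congr M _ hxx']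
  exact (hsim g x).symm.trans (heq ▸ hsim g x')

end Model

/-! ### The main theorem -/

theorem theorem2 {n p J : ℕ} {I : Fin J → ℕ} (hn : 0 < n) (M : Model n p J I) (hM : M.Valid)
    (hDCRA : Paillier.DCRA) (K : ℕ) :
    -- the query node obtains the estimates of the diffusion Kalman filter
    (∀ x : Inputs n p J I, ∃ κ₀ : ℕ, ∀ κ ≥ κ₀, ∀ s ∈ Paillier.keyPairs κ,
      ∀ ρ ∈ Model.coinSet J n K (s.1 * s.2), ∀ k ≤ K,
        ofMant (M.scale k) (M.exec s x (Model.extend ρ) k) = M.estimate x k) ∧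
    -- sensor coalitions: before and after the result of the last round is delivered
    (∀ L, L = K ∨ L = K + 1 → M.PrivateAgainst .sensor K L fun _ => True) ∧
    -- cloud coalitions: likewise
    (∀ L, L = K ∨ L = K + 1 → M.PrivateAgainst .cloud K L fun _ => True) ∧
    -- query coalitions that leave out more than one group
    (M.PrivateAgainst .query K (K + 1) fun g => 1 < gᶜ.card) ∧
    (∀ g : Finset (Fin J), 1 < gᶜ.card → ∀ (x : Inputs n p J I), ∀ k < K,
      M.Underdetermined g x k) := by
  refine ⟨fun x => ?_, fun L hL => ?_, fun L hL => ?_, ?_, fun g hg x k _ =>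
    Model.underdetermined hn hM hg x k⟩
  · obtain ⟨κ₀, h₀⟩ := Model.exec_eq_estimateMant hM x K
    refine ⟨κ₀, fun κ hκ s hs ρ hρ k hk => ?_⟩
    rw [h₀ κ hκ s hs (Model.extend ρ) (fun k hk => Model.mem_units_extend hρ hk) k hk,
      Model.ofMant_estimateMant hM]
  · exact Model.privateAgainst_of_ideal M _ (by omega) (by simp) fun g x =>
      Model.view_compIndist_ideal hM (by simp) (by omega) (by simp) g x
  · exact Model.privateAgainst_of_ideal M _ (by omega) (by simp) fun g x =>
      Model.view_cloud_compIndist_ideal hDCRA hM (by omega) g x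
  · exact Model.privateAgainst_of_ideal M _ (by omega) (fun _ => by omega) fun g x =>
      Model.view_compIndist_ideal hM (by simp) le_rfl (fun _ => by omega) g x
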